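/- **Setting.** Let $n_b>n_r>1$, $\Delta_r=\frac{n_r}{n_r-1}$, $\Delta_b=\frac{n_b}{n_b-1}$; let $\rho_0,d_0>0$ and $k_0=\rho_0/d_0$. *The functional system.* For a color with refractive index $n\in\{n_r,n_b\}$, for $t\in\mathbb R$ and $\zeta,\xi\in\mathbb R^5$, put $$R=|(\zeta_2-\rho_0,\zeta_3)|,\quad S_n=\sqrt{R^2+(n^2-1)|(\zeta_4,\zeta_5+\rho_0)|^2},\quad \mathcal A_n(\zeta)=\frac{1-n^2}{R+S_n},$$ $$\mu_n(t,\zeta)=\tfrac1n\big[\sin t-\mathcal A_n\zeta_4\big],\quad \tau_n(t,\zeta)=\tfrac1n\big[\cos t-\mathcal A_n(\zeta_5+\rho_0)\big],$$ $$D_n(t,\zeta)=\frac{(n-1)d_0-R-\zeta_2+\rho_0}{n-\tau_n},\quad \Lambda_n(t,\zeta)=\sqrt{1+\tfrac1{n^2}-\tfrac2n\tau_n},$$ and, with $q=(\zeta_2-\rho_0)\xi_2+\zeta_3\xi_3$, $$\widetilde{\mathcal A}_n(\zeta,\xi)=\frac{\mathcal A_n^2}{n^2-1}\Big[\frac{q}{R}+\frac{q+(n^2-1)(\zeta_4\xi_4+(\zeta_5+\rho_0)\xi_5)}{S_n}\Big],$$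 $$\widetilde\mu_n(t,\zeta,\xi)=\tfrac1n\big[\cos t-\mathcal A_n\xi_4-\widetilde{\mathcal A}_n\zeta_4\big],\quad \widetilde\tau_n(t,\zeta,\xi)=\tfrac1n\big[-\sin t-\mathcal A_n\xi_5-\widetilde{\mathcal A}_n(\zeta_5+\rho_0)\big],$$ $$\widetilde D_n(t,\zeta,\xi)=\frac{-q/R-\xi_2+\widetilde\tau_nD_n}{n-\tau_n},\quad \widetilde F_n(t,\zeta,\xi)=\xi_3+D_n\widetilde\mu_n+\widetilde D_n\mu_n,\quad \widetilde\Lambda_n(t,\zeta,\xi)=-\frac{\widetilde\tau_n}{n\Lambda_n}.$$ For $t\in\mathbb R$ and $\zeta^0,\zeta^1,\xi^0,\xi^1\in\mathbb R^5$ let the subscript $r$ denote the function with $n=n_r$ evaluated at $(t,\zeta^0,\xi^0)$, and the subscript $b$ the function with $n=n_b$ evaluated at $(\zeta^0_1,\zeta^1,\xi^1)$. Define $H(t;\zeta^0,\zeta^1;\xi^0,\xi^1)=(h_1,\dots,h_5)$ by $$h_1=\frac{\widetilde F_r}{\widetilde F_b},\qquad h_2=\zeta^0_4,\qquad h_3=\zeta^0_5+\rho_0,$$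 $$h_4=-\frac{\xi^0_1\big[\widetilde\mu_b\Lambda_r-\widetilde\Lambda_b\mu_r\big]+\mu_b\widetilde\Lambda_r-\frac1{n_r}\big(\cos t-\widetilde{\mathcal A}_r\zeta^0_4\big)\Lambda_b}{\frac1{n_r}\mathcal A_r\Lambda_b},$$ $$h_5=-(\tan t)\,\xi^0_4-\frac{2\zeta^0_4}{\cos^2t}-\frac{2\sin t}{\cos^3t}(\zeta^0_2-\rho_0).$$ The domain of $H$ consists of the points with $|t|<\pi/2$ at which $R$ and the radicands in $\Lambda_r,\Lambda_b$ are positive and $n_r-\tau_r$, $n_b-\tau_b$, $\widetilde F_b$ do not vanish. With $\sigma=(\Delta_r-\Delta_b)^2-4k_0\Delta_r\Delta_b$, let $$P=\Big(\frac{\Delta_r-\Delta_b-\sqrt\sigma}{\Delta_b-\Delta_r-\sqrt\sigma},\;0,\;\rho_0,\;-\frac{\rho_0}{2}\Big(\frac{\Delta_r}{n_r}+\frac{\Delta_b}{n_b}+\sqrt\sigma\Big),\;0\Big).$$ A *solution of the functional system on $[-\delta,\delta]$* is a $C^1$ map $Z=(z_1,\dots,z_5):[-\delta,\delta]\to\mathbb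 R^5$ with $Z(0)=0$, $Z'(0)=P$, $|z_1(t)|\le|t|$, and, for all $|t|\le\delta$, $\big(t;Z(t),Z(z_1(t));Z'(t),Z'(z_1(t))\big)$ in the domain of $H$ and $$Z'(t)=H\big(t;Z(t),Z(z_1(t));Z'(t),Z'(z_1(t))\big).$$ *Problem B in the plane.* Let $e=(0,1)$, $x(t)=(\sin t,\cos t)$. For a positive $C^2$ function $\rho$ on $[-\delta,\delta]$ let $\nu(t)$ be the outer unit normal of the curve $\rho(t)x(t)$ and, for a refractive index $n$ and a constant $C_n$, let $$m_n=\tfrac1n\big(x-\Phi_n(x\cdot\nu)\,\nu\big),\quad \Phi_n(s)=s-\sqrt{n^2-1+s^2},\quad d_n=\frac{C_n-\rho\,(1-e\cdot x)}{n-e\cdot m_n},\quad f_n=\rho\,x+d_n m_n .$$ A *solution of Problem B on $[-\delta,\delta]$* (with data $\rho_0,d_0$) is a pair $(\rho,\varphi)$, $\rho\in C^2[-\delta,\delta]$ positive, $\varphi:[-\delta,\delta]\to[-\delta,\delta]$ of class $C^1$, such that $\rho(0)=\rho_0$ and, for some real constants $C_{n_r},C_{n_b}$: for both colors $n\in\{n_r,n_b\}$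 one has $d_n(0)=d_0$ and, for all $|t|\le\delta$, $d_n(t)>0$, $e\cdot m_n(t)\ge 1/n$ (no total reflection) and $f_n'(t)\ne0$ (the upper face has a normal); and $$f_{n_r}(t)=f_{n_b}(\varphi(t))\qquad\text{for all }|t|\le\delta .$$ **Theorem.** For all $n_b>n_r>1$ there is a constant $C(r,b)$, depending only on $n_r$ and $n_b$, with $$0<C(r,b)<\frac{(\Delta_r-\Delta_b)^2}{4\Delta_r\Delta_b},$$ such that for all $\rho_0,d_0>0$ with $k_0=\rho_0/d_0<C(r,b)$: 1. the functional system has a unique local solution: there is $\delta_0\in(0,\pi/2)$ such that for every $0<\delta\le\delta_0$ there is exactly one solution $Z$ of the functional system on $[-\delta,\delta]$; 2. Problem B has a unique local solution: there is $\delta_0\in(0,\pi/2)$ such that for every $0<\delta\le\delta_0$ there is exactly one solution $(\rho,\varphi)$ of Problem B on $[-\delta,\delta]$. -/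

import Mathlib

open Set

noncomputable section

namespace AchromaticLens

/-! ### Constants attached to the two refractive indices -/

/-- `Δ = n / (n - 1)`. -/
def Delta (n : ℝ) : ℝ := n / (n - 1)

/-- The upper threshold `(Δ_r - Δ_b)² / (4 Δ_r Δ_b)` for the ratio `k₀ = ρ₀ / d₀`. -/
def threshold (nr nb : ℝ) : ℝ := (Delta nr - Delta nb) ^ 2 / (4 * Delta nr * Delta nb)

/-- The discriminant `(Δ_r - Δ_b)² - 4 k₀ Δ_r Δ_b`, with `k₀ = ρ₀ / d₀`. -/
def disc (nr nb ρ₀ d₀ : ℝ) : ℝ :=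
  (Delta nr - Delta nb) ^ 2 - 4 * (ρ₀ / d₀) * Delta nr * Delta nb

/-- The initial velocity `P` of the functional system. -/
def initialVelocity (nr nb ρ₀ d₀ : ℝ) : Fin 5 → ℝ :=
  ![(Delta nr - Delta nb - √(disc nr nb ρ₀ d₀)) / (Delta nb - Delta nr - √(disc nr nb ρ₀ d₀)),
    0,
    ρ₀,
    (-(Delta nr / nr + Delta nb / nb) - √(disc nr nb ρ₀ d₀)) / 2 * ρ₀,
    0]

/-! ### The optical functional system

A vector `ζ = (ζ_1, …, ζ_5)` is a function `ζ : Fin 5 → ℝ`, so `ζ_i` is `ζ (i - 1)`.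
The functions below are written for one color with refractive index `n`. -/

section OneColor

variable (n ρ₀ d₀ : ℝ)

/-- `|(ζ_2 - ρ₀, ζ_3)|`. -/
def rad (ζ : Fin 5 → ℝ) : ℝ := √((ζ 1 - ρ₀) ^ 2 + ζ 2 ^ 2)

/-- `√(|(ζ_2 - ρ₀, ζ_3)|² + (n² - 1) |(ζ_4, ζ_5 + ρ₀)|²)`. -/
def root (ζ : Fin 5 → ℝ) : ℝ :=
  √((ζ 1 - ρ₀) ^ 2 + ζ 2 ^ 2 + (n ^ 2 - 1) * (ζ 3 ^ 2 + (ζ 4 + ρ₀) ^ 2))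

/-- `𝒜(ζ)`. -/
def A (ζ : Fin 5 → ℝ) : ℝ := (1 - n ^ 2) / (rad ρ₀ ζ + root n ρ₀ ζ)

/-- `μ(t, ζ)`. -/
def mu (t : ℝ) (ζ : Fin 5 → ℝ) : ℝ := 1 / n * (Real.sin t - A n ρ₀ ζ * ζ 3)

/-- `τ(t, ζ)`. -/
def tau (t : ℝ) (ζ : Fin 5 → ℝ) : ℝ := 1 / n * (Real.cos t - A n ρ₀ ζ * (ζ 4 + ρ₀))

/-- `D(t, ζ)`, with the constant `C = (n - 1) d₀`. -/
def D (t : ℝ) (ζ : Fin 5 → ℝ) : ℝ :=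
  ((n - 1) * d₀ - rad ρ₀ ζ - ζ 1 + ρ₀) / (n - tau n ρ₀ t ζ)

/-- `Λ_2(t, ζ)`. -/
def Lam (t : ℝ) (ζ : Fin 5 → ℝ) : ℝ := √(1 + 1 / n ^ 2 - 2 / n * tau n ρ₀ t ζ)

/-- `𝒜~(ζ, ξ)`. -/
def dA (ζ ξ : Fin 5 → ℝ) : ℝ :=
  A n ρ₀ ζ ^ 2 / (n ^ 2 - 1) *
    (((ζ 1 - ρ₀) * ξ 1 + ζ 2 * ξ 2) / rad ρ₀ ζ +
      ((ζ 1 - ρ₀) * ξ 1 + ζ 2 * ξ 2 + (n ^ 2 - 1) * (ζ 3 * ξ 3 + (ζ 4 + ρ₀) * ξ 4)) /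
        root n ρ₀ ζ)

/-- `μ~(t, ζ, ξ)`. -/
def dmu (t : ℝ) (ζ ξ : Fin 5 → ℝ) : ℝ :=
  1 / n * (Real.cos t - A n ρ₀ ζ * ξ 3 - dA n ρ₀ ζ ξ * ζ 3)

/-- `τ~(t, ζ, ξ)`. -/
def dtau (t : ℝ) (ζ ξ : Fin 5 → ℝ) : ℝ :=
  1 / n * (-Real.sin t - A n ρ₀ ζ * ξ 4 - dA n ρ₀ ζ ξ * (ζ 4 + ρ₀))

/-- `D~(t, ζ, ξ)`. -/
def dD (t : ℝ) (ζ ξ : Fin 5 → ℝ) : ℝ :=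
  (-(((ζ 1 - ρ₀) * ξ 1 + ζ 2 * ξ 2) / rad ρ₀ ζ) - ξ 1 + dtau n ρ₀ t ζ ξ * D n ρ₀ d₀ t ζ) /
    (n - tau n ρ₀ t ζ)

/-- `F~_1(t, ζ, ξ)`. -/
def dF1 (t : ℝ) (ζ ξ : Fin 5 → ℝ) : ℝ :=
  ξ 2 + D n ρ₀ d₀ t ζ * dmu n ρ₀ t ζ ξ + dD n ρ₀ d₀ t ζ ξ * mu n ρ₀ t ζ

/-- `Λ~_2(t, ζ, ξ)`. -/
def dLam (t : ℝ) (ζ ξ : Fin 5 → ℝ) : ℝ := -(1 / n * dtau n ρ₀ t ζ ξ / Lam n ρ₀ t ζ)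

/-- All the one-color expressions are well defined (and smooth) at `(t, ζ)`: no denominator
vanishes and no square root is taken at a nonpositive number. -/
def ColorRegular (t : ℝ) (ζ : Fin 5 → ℝ) : Prop :=
  0 < (ζ 1 - ρ₀) ^ 2 + ζ 2 ^ 2 ∧ n - tau n ρ₀ t ζ ≠ 0 ∧
    0 < 1 + 1 / n ^ 2 - 2 / n * tau n ρ₀ t ζ

end OneColor

section System

variable (nr nb ρ₀ d₀ : ℝ)

/-- The component `h_1`. -/
def h1 (t : ℝ) (ζ0 ζ1 ξ0 ξ1 : Fin 5 → ℝ) : ℝ :=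
  dF1 nr ρ₀ d₀ t ζ0 ξ0 / dF1 nb ρ₀ d₀ (ζ0 0) ζ1 ξ1

/-- The component `h_4`. -/
def h4 (t : ℝ) (ζ0 ζ1 ξ0 ξ1 : Fin 5 → ℝ) : ℝ :=
  -((ξ0 0 * (dmu nb ρ₀ (ζ0 0) ζ1 ξ1 * Lam nr ρ₀ t ζ0 - dLam nb ρ₀ (ζ0 0) ζ1 ξ1 * mu nr ρ₀ t ζ0)
      + mu nb ρ₀ (ζ0 0) ζ1 * dLam nr ρ₀ t ζ0 ξ0
      - 1 / nr * (Real.cos t - dA nr ρ₀ ζ0 ξ0 * ζ0 3) * Lam nb ρ₀ (ζ0 0) ζ1) /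
    (1 / nr * A nr ρ₀ ζ0 * Lam nb ρ₀ (ζ0 0) ζ1))

/-- The component `h_5`. -/
def h5 (t : ℝ) (ζ0 ξ0 : Fin 5 → ℝ) : ℝ :=
  -Real.tan t * ξ0 3 - 2 / Real.cos t ^ 2 * ζ0 3
    - 2 * Real.sin t / Real.cos t ^ 3 * (ζ0 1 - ρ₀)

/-- The map `H(t; ζ⁰, ζ¹; ξ⁰, ξ¹) = (h_1, …, h_5)`. -/
def H (t : ℝ) (ζ0 ζ1 ξ0 ξ1 : Fin 5 → ℝ) : Fin 5 → ℝ :=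
  ![h1 nr nb ρ₀ d₀ t ζ0 ζ1 ξ0 ξ1,
    ζ0 3,
    ζ0 4 + ρ₀,
    h4 nr nb ρ₀ t ζ0 ζ1 ξ0 ξ1,
    h5 ρ₀ t ζ0 ξ0]

/-- The points `(t; ζ⁰, ζ¹; ξ⁰, ξ¹)` at which the formulas for `H` make sense. -/
def InDomain (t : ℝ) (ζ0 ζ1 ξ1 : Fin 5 → ℝ) : Prop :=
  t ∈ Ioo (-(Real.pi / 2)) (Real.pi / 2) ∧
  ColorRegular nr ρ₀ t ζ0 ∧ ColorRegular nb ρ₀ (ζ0 0) ζ1 ∧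
  dF1 nb ρ₀ d₀ (ζ0 0) ζ1 ξ1 ≠ 0

/-- `Z` is a `C¹` solution on `[-δ, δ]` of the optical functional system
`Z'(t) = H(t; Z(t), Z(z_1(t)); Z'(t), Z'(z_1(t)))`, `Z(0) = 0`, such that `Z'(0) = P` and
`|z_1(t)| ≤ |t|`. Only the values of `Z` on `[-δ, δ]` matter. -/
structure IsSystemSolution (δ : ℝ) (Z : ℝ → Fin 5 → ℝ) : Prop where
  contDiffOn : ContDiffOn ℝ 1 Z (Icc (-δ) δ)
  init : Z 0 = 0
  init_deriv : derivWithin Z (Icc (-δ) δ) 0 = initialVelocity nr nb ρ₀ d₀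
  abs_le : ∀ t ∈ Icc (-δ) δ, |Z t 0| ≤ |t|
  inDomain : ∀ t ∈ Icc (-δ) δ, InDomain nr nb ρ₀ d₀ t (Z t) (Z (Z t 0))
    (derivWithin Z (Icc (-δ) δ) (Z t 0))
  eqn : ∀ t ∈ Icc (-δ) δ, derivWithin Z (Icc (-δ) δ) t =
    H nr nb ρ₀ d₀ t (Z t) (Z (Z t 0))
      (derivWithin Z (Icc (-δ) δ) t) (derivWithin Z (Icc (-δ) δ) (Z t 0))

end System

/-! ### The planar dichromatic lens problem with a point source at the origin -/

/-- The Euclidean plane. -/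
abbrev Plane : Type := EuclideanSpace ℝ (Fin 2)

/-- The vertical direction `e = (0, 1)`. -/
def e : Plane := !₂[0, 1]

/-- The emission direction `x(t) = (sin t, cos t)`. -/
def x (t : ℝ) : Plane := !₂[Real.sin t, Real.cos t]

/-- The tangent vector at the parameter `t ∈ I` of the curve `γ`, parametrized by the
interval `I`. -/
def tangent (I : Set ℝ) (γ : ℝ → Plane) (t : ℝ) : Plane := derivWithin γ I t

/-- The outer unit normal of the lower face `t ↦ ρ(t) x(t)`: the tangent vector, turned
counterclockwise by a right angle and normalized (so that `x(t) · ν(t) > 0` when `ρ > 0`). -/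
def nu (I : Set ℝ) (ρ : ℝ → ℝ) (t : ℝ) : Plane :=
  ‖tangent I (fun s => ρ s • x s) t‖⁻¹ •
    !₂[-(tangent I (fun s => ρ s • x s) t 1), tangent I (fun s => ρ s • x s) t 0]

/-- `Φ_κ(s) = s - √(κ² - 1 + s²)`. -/
def Phi (κ s : ℝ) : ℝ := s - √(κ ^ 2 - 1 + s ^ 2)

/-- The direction, inside the lens, of the refracted ray with refractive index `n`, by the Snell
law `x - n m = Φ_n(x · ν) ν`. -/
def m (n : ℝ) (I : Set ℝ) (ρ : ℝ → ℝ) (t : ℝ) : Plane :=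
  (1 / n) • (x t - Phi n (inner ℝ (x t) (nu I ρ t)) • nu I ρ t)

/-- The length of the path travelled inside the lens by the ray with refractive index `n`. -/
def d (n C : ℝ) (I : Set ℝ) (ρ : ℝ → ℝ) (t : ℝ) : ℝ :=
  (C - ρ t * (1 - inner ℝ e (x t))) / (n - inner ℝ e (m n I ρ t))

/-- The parametrization of the upper face that refracts the color with refractive index `n` into
the direction `e`. -/
def f (n C : ℝ) (I : Set ℝ) (ρ : ℝ → ℝ) (t : ℝ) : Plane :=
  ρ t • x t + d n C I ρ t • m n I ρ t

/-- On the parameter interval `I`, the lower face `ρ` together with the upper face `f n C I ρ` is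
an admissible lens for the color with refractive index `n`: the travelled lengths are positive,
there is no total internal reflection at the upper face, and the upper face has a normal
(a nonzero tangent vector) at every point. -/
structure Admissible (n C : ℝ) (I : Set ℝ) (ρ : ℝ → ℝ) : Prop where
  d_pos : ∀ t ∈ I, 0 < d n C I ρ t
  no_reflection : ∀ t ∈ I, 1 / n ≤ inner ℝ e (m n I ρ t)
  normal : ∀ t ∈ I, tangent I (f n C I ρ) t ≠ 0

/-- `(ρ, φ)` solves, on the parameter interval `[-δ, δ]`, the problem of finding a lens that
refracts both colors, emitted from the origin, into the direction `e`, where the lower face passes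
through `(0, ρ₀)` and the thickness of the lens at `t = 0` is `d₀`. Only the values of `ρ` and `φ`
on `[-δ, δ]` matter. -/
structure IsLensSolution (nr nb ρ₀ d₀ δ : ℝ) (ρ φ : ℝ → ℝ) : Prop where
  rho_contDiffOn : ContDiffOn ℝ 2 ρ (Icc (-δ) δ)
  rho_pos : ∀ t ∈ Icc (-δ) δ, 0 < ρ t
  phi_contDiffOn : ContDiffOn ℝ 1 φ (Icc (-δ) δ)
  phi_mapsTo : MapsTo φ (Icc (-δ) δ) (Icc (-δ) δ)
  rho_zero : ρ 0 = ρ₀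
  faces : ∃ Cr Cb : ℝ,
    Admissible nr Cr (Icc (-δ) δ) ρ ∧ Admissible nb Cb (Icc (-δ) δ) ρ ∧
    d nr Cr (Icc (-δ) δ) ρ 0 = d₀ ∧ d nb Cb (Icc (-δ) δ) ρ 0 = d₀ ∧
    ∀ t ∈ Icc (-δ) δ, f nr Cr (Icc (-δ) δ) ρ t = f nb Cb (Icc (-δ) δ) ρ (φ t)

end AchromaticLens

end

open Set

noncomputable section

namespace AchromaticLens

/-! ### Abstract functional equation, solved by contraction in the derivative. -/

section FunctionalEquation

open Metric
open scoped NNReal BoundedContinuousFunction Topology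

variable {E : Type*} [NormedAddCommGroup E] [NormedSpace ℝ E]

/-! The system is an equation for the velocity Y = Z', implicit because Y(t) and Y(z₁(t)) also occur
on the right. A change of Y by D changes Z only by δ·D, so for short intervals the dependence on Z
is harmless. What has to be contracting is the dependence of H on the pair of velocities, in a norm
where the pair carries the maximum of its entries. Under this assumption `exists_fdeSolution`
applies Banach's theorem to velocities with a fixed Lipschitz constant (needed because Y is composed
with z₁), and `fdeSolution_unique` compares an arbitrary C¹ solution with the one constructed.

At the initial point only the rows of h₁ and h₄ depend on the velocities. The data are encoded by
the larger root K of K² - (Δ_r + Δ_b) K + (1 + k₀) Δ_r Δ_b = 0, with z₁'(0) = p = (K - Δ_r)/(K -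
Δ_b). A diagonal rescaling makes the velocity derivative smaller than 1 as soon as Δ_b + |p| (Δ_r +
K) < K (`exists_weights`, `norm_fderiv_weightedH_le`). Since p tends to 0 with k₀, this holds for
small k₀, and `ratioBound` is an explicit sufficient bound (`exists_lensData`).

From the system to the lens: h₂, h₃, h₅ say that Z records position and tangent of one lower face.
The equation with h₄ is the derivative of the equality of the horizontal components of the unit
normals of the two upper faces, and the one with h₁ equates the horizontal components of their
velocities. The vertical components follow because each upper face is orthogonal to n m - e
(`tangent_f_orthogonal`), a consequence of Snell's law below and of the optical path identity ρ + n
d = C + e·f. Hence both faces coincide (`faces_eq`).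

From the lens to the system, what must be proved is φ(0) = 0, |φ(t)| ≤ |t| and the initial velocity.
A fixed point of φ exists by continuity, and the optics forces it to be 0 (`origin`). Let q = ρ'/ρ₀,
let K' be the smaller root, and put u = q - K t, v = q - K' t. To first order the two face
conditions say that passing from t to φ(t) multiplies u by -b/c and v by -c/b, where b = K - Δ_b > c
= Δ_r - K > 0. As φ maps the interval into itself, a maximum argument excludes the expanding
direction and puts (u, v) in a thin cone about u = 0, where φ does not increase |t|
(`exists_abs_phi_le`). Then |φ'(0)| ≤ 1 singles out the root K, and the lens yields a solution of
the system, so uniqueness carries over. -/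

/-- The primitive of `Y` that vanishes at `0`. -/
def prim (Y : ℝ → E) (t : ℝ) : E := ∫ s in (0 : ℝ)..t, Y s

lemma hasDerivAt_prim [CompleteSpace E] {Y : ℝ → E} (hY : Continuous Y) (t : ℝ) :
    HasDerivAt (prim Y) (Y t) t :=
  (hY.integral_hasStrictDerivAt 0 t).hasDerivAt

@[simp] lemma prim_zero (Y : ℝ → E) : prim Y 0 = 0 := by simp [prim]

lemma norm_sub_le_of_hasDerivWithinAt {Z Y : ℝ → E} {B δ : ℝ}
    (hZ : ∀ t ∈ Icc (-δ) δ, HasDerivWithinAt Z (Y t) (Icc (-δ) δ) t)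
    (hB : ∀ t ∈ Icc (-δ) δ, ‖Y t‖ ≤ B) {s t : ℝ} (hs : s ∈ Icc (-δ) δ) (ht : t ∈ Icc (-δ) δ) :
    ‖Z s - Z t‖ ≤ B * |s - t| :=
  Convex.norm_image_sub_le_of_norm_hasDerivWithin_le hZ hB (convex_Icc _ _) ht hs

/-- Truncation of the real line to `[-δ, δ]`. -/
def clamp (δ t : ℝ) : ℝ := max (-δ) (min δ t)

lemma abs_clamp_le {δ : ℝ} (hδ : 0 ≤ δ) (t : ℝ) : |clamp δ t| ≤ δ := by
  rw [abs_le]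
  exact ⟨le_max_left _ _, max_le (by linarith) (min_le_left _ _)⟩

lemma abs_clamp_sub_le (δ s t : ℝ) : |clamp δ s - clamp δ t| ≤ |s - t| := by
  have h := abs_max_sub_max_le_max (-δ) (min δ s) (-δ) (min δ t)
  have h' := abs_min_sub_min_le_max δ s δ t
  simp only [sub_self, abs_zero, abs_nonneg, max_eq_right] at h h'
  exact h.trans h'

lemma clamp_of_abs_le {δ t : ℝ} (h : |t| ≤ δ) : clamp δ t = t := by
  rw [abs_le] at h
  rw [clamp, min_eq_right h.2, max_eq_right h.1]

lemma continuous_clamp (δ : ℝ) : Continuous (clamp δ) := by unfold clamp; fun_prop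

/-- Continuity method on `[-δ, δ]`: if on each smaller symmetric interval the bound `g ≤ r` improves
to `g ≤ r'`, then the latter holds on `[-δ, δ]`. -/
lemma le_of_bootstrap {g : ℝ → ℝ} {δ r r' : ℝ} (hg : ContinuousOn g (Icc (-δ) δ)) (hr : r' < r)
    (h0 : g 0 ≤ r')
    (step : ∀ s, 0 ≤ s → s ≤ δ → (∀ t ∈ Icc (-s) s, g t ≤ r) → ∀ t ∈ Icc (-s) s, g t ≤ r') :
    ∀ t ∈ Icc (-δ) δ, g t ≤ r' := by
  intro t₀ ht₀
  have hδ : 0 ≤ δ := (abs_nonneg t₀).trans (abs_le.2 ht₀)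
  have hcl : ∀ t, clamp δ t ∈ Icc (-δ) δ := fun t => abs_le.1 (abs_clamp_le hδ t)
  have hcont : Continuous fun t => g (clamp δ t) :=
    hg.comp_continuous (continuous_clamp δ) hcl
  have heq : ∀ s ≤ δ, ∀ t ∈ Icc (-s) s, g (clamp δ t) = g t := fun s hs t ht => by
    rw [clamp_of_abs_le ((abs_le.2 ht).trans hs)]
  -- Writing the points of [-s, s] as u s with |u| ≤ 1 makes the improved bound on [-s, s] a closed
  -- condition on s, as continuous induction on [0, δ] requires.
  have hall : Icc 0 δ ⊆ ⋂ u ∈ Icc (-1 : ℝ) 1, {s | g (clamp δ (u * s)) ≤ r'} := by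
    refine IsClosed.Icc_subset_of_forall_exists_gt (IsClosed.inter ?_ isClosed_Icc) ?_ ?_
    · exact isClosed_biInter fun u _ =>
        isClosed_le (hcont.comp (continuous_const.mul continuous_id)) continuous_const
    · simp only [mem_iInter]
      intro u _
      show g (clamp δ (u * 0)) ≤ r'
      rw [mul_zero, clamp_of_abs_le (by simpa using hδ)]
      exact h0
    · rintro s ⟨hs, hs0, hsδ⟩ y hy
      simp only [mem_iInter] at hs
      have hs' : ∀ t ∈ Icc (-s) s, g (clamp δ t) ≤ r' := fun t ht => by
        rcases hs0.eq_or_lt with h | h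
        · have := hs 1 (by simp)
          have ht0 : t = 0 := by
            rw [← h] at ht
            simpa using ht
          rw [ht0]
          simpa [← h] using this
        · have := hs (t / s) ⟨by rw [le_div_iff₀ h]; linarith [ht.1],
            by rw [div_le_iff₀ h]; linarith [ht.2]⟩
          simpa [div_mul_cancel₀ _ h.ne'] using this
      have hev : ∀ a, g (clamp δ a) ≤ r' → ∃ ε > 0, ∀ t, |t - a| < ε → g (clamp δ t) < r := by
        intro a ha
        obtain ⟨ε, hε, h⟩ := Metric.eventually_nhds_iff.1
          (hcont.continuousAt.eventually_lt continuousAt_const (ha.trans_lt hr))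
        exact ⟨ε, hε, fun t ht => h (by rwa [Real.dist_eq])⟩
      obtain ⟨ε₁, hε₁, h₁⟩ := hev s (hs' s ⟨by linarith, le_rfl⟩)
      obtain ⟨ε₂, hε₂, h₂⟩ := hev (-s) (hs' (-s) ⟨le_rfl, by linarith⟩)
      obtain ⟨s', hss', hs'm⟩ := exists_between
        (show s < min (min y δ) (min (s + ε₁) (s + ε₂)) by
          simp only [lt_min_iff]; exact ⟨⟨hy, hsδ⟩, by linarith, by linarith⟩)
      simp only [lt_min_iff] at hs'm
      have hr' : ∀ t ∈ Icc (-s') s', g t ≤ r := fun t ht => by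
        rw [← heq s' hs'm.1.2.le t ht]
        rcases le_total t s with h | h
        · rcases le_total (-s) t with h' | h'
          · exact (hs' t ⟨h', h⟩).trans hr.le
          · exact (h₂ t (by rw [abs_lt]; constructor <;> linarith [ht.1])).le
        · exact (h₁ t (by rw [abs_lt]; constructor <;> linarith [ht.2])).le
      refine ⟨s', ?_, hss', hs'm.1.1.le⟩
      simp only [mem_iInter]
      intro u hu
      have hm : u * s' ∈ Icc (-s') s' :=
        ⟨by nlinarith [hu.1], by nlinarith [hu.2]⟩
      show g (clamp δ (u * s')) ≤ r'
      rw [heq s' hs'm.1.2.le _ hm]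
      exact step s' (hs0.trans hss'.le) hs'm.1.2.le hr' _ hm
  rw [← heq δ le_rfl t₀ ht₀]
  have h := hall (right_mem_Icc.2 hδ)
  simp only [mem_iInter] at h
  rcases hδ.eq_or_lt with hd | hd
  · have : t₀ = 0 := by
      rw [← hd] at ht₀
      simpa using ht₀
    rw [this, clamp_of_abs_le (by simpa using hδ)]
    exact h0
  · have := h (t₀ / δ) ⟨by rw [le_div_iff₀ hd]; linarith [ht₀.1],
      by rw [div_le_iff₀ hd]; linarith [ht₀.2]⟩
    simpa [div_mul_cancel₀ _ hd.ne'] using this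

/-- The argument of the right-hand side of the functional equation. -/
def fdeArg (π : E →L[ℝ] ℝ) (Z Y : ℝ → E) (t : ℝ) : (ℝ × E × E) × (E × E) :=
  ((t, Z t, Z (π (Z t))), (Y t, Y (π (Z t))))

/-- The base point of the functional equation. -/
def fdeBase (P : E) : (ℝ × E × E) × (E × E) := ((0, 0, 0), (P, P))

/-- `Z`, with derivative `Y`, solves on `[-δ, δ]` the functional equation with right-hand side `H`
and with the initial velocity `P`. -/
structure IsFDESolution (H : (ℝ × E × E) × (E × E) → E) (π : E →L[ℝ] ℝ) (P : E) (δ : ℝ)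
    (Z Y : ℝ → E) : Prop where
  hasDeriv : ∀ t ∈ Icc (-δ) δ, HasDerivWithinAt Z (Y t) (Icc (-δ) δ) t
  cont : ContinuousOn Y (Icc (-δ) δ)
  init : Z 0 = 0
  init_deriv : Y 0 = P
  abs_le : ∀ t ∈ Icc (-δ) δ, |π (Z t)| ≤ |t|
  eqn : ∀ t ∈ Icc (-δ) δ, Y t = H (fdeArg π Z Y t)

lemma abs_le_mem_Icc {δ s t : ℝ} (ht : t ∈ Icc (-δ) δ) (h : |s| ≤ |t|) : s ∈ Icc (-δ) δ :=
  abs_le.1 (h.trans (abs_le.2 ht))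

lemma fdeArg_mem_closedBall {π : E →L[ℝ] ℝ} {P : E} {δ r B : ℝ} {Z Y : ℝ → E}
    (hZ : ∀ t ∈ Icc (-δ) δ, HasDerivWithinAt Z (Y t) (Icc (-δ) δ) t) (h0 : Z 0 = 0)
    (hπ : ∀ t ∈ Icc (-δ) δ, |π (Z t)| ≤ |t|) (hB : ∀ t ∈ Icc (-δ) δ, ‖Y t‖ ≤ B)
    (hP : ∀ t ∈ Icc (-δ) δ, ‖Y t - P‖ ≤ r) (hδr : δ ≤ r) (hBr : B * δ ≤ r) {t : ℝ}
    (ht : t ∈ Icc (-δ) δ) : fdeArg π Z Y t ∈ closedBall (fdeBase P) r := by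
  have h0m : (0 : ℝ) ∈ Icc (-δ) δ := abs_le_mem_Icc ht (by simp)
  have hB0 : 0 ≤ B := (norm_nonneg _).trans (hB 0 h0m)
  have hZr : ∀ s ∈ Icc (-δ) δ, ‖Z s‖ ≤ r := fun s hs => by
    have := norm_sub_le_of_hasDerivWithinAt hZ hB hs h0m
    rw [h0, sub_zero, sub_zero] at this
    exact this.trans ((mul_le_mul_of_nonneg_left (abs_le.2 hs) hB0).trans hBr)
  have hm := abs_le_mem_Icc ht (hπ t ht)
  rw [mem_closedBall, dist_eq_norm]
  simp only [fdeArg, fdeBase, Prod.mk_sub_mk, Prod.norm_mk, max_le_iff, sub_zero,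
    Real.norm_eq_abs]
  exact ⟨⟨(abs_le.2 ht).trans hδr, hZr t ht, hZr _ hm⟩, hP t ht, hP _ hm⟩

/-- The comparison estimate behind existence and uniqueness. -/
lemma norm_sub_le_of_fdeArg {H : (ℝ × E × E) × (E × E) → E} {π : E →L[ℝ] ℝ} {P : E}
    {δ r B L lam M D : ℝ} (hL : 0 ≤ L) (hlam : 0 ≤ lam)
    (hlip : ∀ x ∈ closedBall (fdeBase P) r, ∀ y ∈ closedBall (fdeBase P) r,
      ‖H x - H y‖ ≤ L * ‖x.1 - y.1‖ + lam * ‖x.2 - y.2‖)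
    {Z Y W V : ℝ → E} (hZ : ∀ t ∈ Icc (-δ) δ, HasDerivWithinAt Z (Y t) (Icc (-δ) δ) t)
    (hW : ∀ t ∈ Icc (-δ) δ, HasDerivWithinAt W (V t) (Icc (-δ) δ) t)
    (hZ0 : Z 0 = 0) (hW0 : W 0 = 0)
    (hπZ : ∀ t ∈ Icc (-δ) δ, |π (Z t)| ≤ |t|) (hπW : ∀ t ∈ Icc (-δ) δ, |π (W t)| ≤ |t|)
    (hYB : ∀ t ∈ Icc (-δ) δ, ‖Y t‖ ≤ B) (hVB : ∀ t ∈ Icc (-δ) δ, ‖V t‖ ≤ B)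
    (hYP : ∀ t ∈ Icc (-δ) δ, ‖Y t - P‖ ≤ r) (hVP : ∀ t ∈ Icc (-δ) δ, ‖V t - P‖ ≤ r)
    (hδr : δ ≤ r) (hBr : B * δ ≤ r)
    (hM : 0 ≤ M) (hYM : ∀ s ∈ Icc (-δ) δ, ∀ t ∈ Icc (-δ) δ, ‖Y s - Y t‖ ≤ M * |s - t|)
    (hD : ∀ t ∈ Icc (-δ) δ, ‖Y t - V t‖ ≤ D) {t : ℝ} (ht : t ∈ Icc (-δ) δ) :
    ‖H (fdeArg π Z Y t) - H (fdeArg π W V t)‖ ≤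
      (lam + δ * (L * (1 + B * ‖π‖) + lam * (M * ‖π‖))) * D := by
  have h0m : (0 : ℝ) ∈ Icc (-δ) δ := abs_le_mem_Icc ht (by simp)
  have hδ : 0 ≤ δ := h0m.2
  have hB0 : 0 ≤ B := (norm_nonneg _).trans (hYB 0 h0m)
  have hD0 : 0 ≤ D := (norm_nonneg _).trans (hD 0 h0m)
  have hdiff : ∀ s ∈ Icc (-δ) δ, ‖Z s - W s‖ ≤ δ * D := fun s hs => by
    have := norm_sub_le_of_hasDerivWithinAt (Z := fun s => Z s - W s) (Y := fun s => Y s - V s)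
      (fun t ht => (hZ t ht).sub (hW t ht)) hD hs h0m
    simp only [hZ0, hW0, sub_zero] at this
    rw [mul_comm]
    exact this.trans (mul_le_mul_of_nonneg_left (abs_le.2 hs) hD0)
  have hz := abs_le_mem_Icc ht (hπZ t ht)
  have hw := abs_le_mem_Icc ht (hπW t ht)
  have hπ : |π (Z t) - π (W t)| ≤ ‖π‖ * (δ * D) := by
    rw [← map_sub]
    exact (π.le_opNorm _).trans (mul_le_mul_of_nonneg_left (hdiff t ht) (norm_nonneg _))
  -- Both function and argument differ: first the argument is moved inside Z, then Z and W are
  -- compared at a common point.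
  have h3 : ‖Z (π (Z t)) - W (π (W t))‖ ≤ (1 + B * ‖π‖) * δ * D := by
    have e1 := norm_sub_le_of_hasDerivWithinAt hZ hYB hz hw
    have e2 := hdiff _ hw
    have e3 := mul_le_mul_of_nonneg_left hπ hB0
    have e4 := norm_sub_le_norm_sub_add_norm_sub (Z (π (Z t))) (Z (π (W t))) (W (π (W t)))
    nlinarith
  -- The argument is moved inside Y only, so V need not be Lipschitz. For uniqueness this allows V
  -- to be any continuous velocity.
  have h4 : ‖Y (π (Z t)) - V (π (W t))‖ ≤ (1 + M * ‖π‖ * δ) * D := by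
    have e1 := hYM _ hz _ hw
    have e2 := hD _ hw
    have e3 := mul_le_mul_of_nonneg_left hπ hM
    have e4 := norm_sub_le_norm_sub_add_norm_sub (Y (π (Z t))) (Y (π (W t))) (V (π (W t)))
    nlinarith
  have hv : ‖(fdeArg π Z Y t).1 - (fdeArg π W V t).1‖ ≤ (1 + B * ‖π‖) * δ * D := by
    have : 0 ≤ B * ‖π‖ * δ * D := by positivity
    have hc := hdiff t ht
    simp only [fdeArg, Prod.mk_sub_mk, sub_self, Prod.norm_mk, norm_zero, max_le_iff]
    exact ⟨by positivity, by linarith, h3⟩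
  have hu : ‖(fdeArg π Z Y t).2 - (fdeArg π W V t).2‖ ≤ (1 + M * ‖π‖ * δ) * D := by
    have : 0 ≤ M * ‖π‖ * δ * D := by positivity
    have hc := hD t ht
    simp only [fdeArg, Prod.mk_sub_mk, Prod.norm_mk, max_le_iff]
    exact ⟨by linarith, h4⟩
  have := hlip _ (fdeArg_mem_closedBall hZ hZ0 hπZ hYB hYP hδr hBr ht) _
    (fdeArg_mem_closedBall hW hW0 hπW hVB hVP hδr hBr ht)
  have e1 := mul_le_mul_of_nonneg_left hv hL
  have e2 := mul_le_mul_of_nonneg_left hu hlam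
  nlinarith

/-- Banach's fixed point theorem for the map sending a velocity Y to the right-hand side evaluated
along Y and its primitive. The strict inequality |π P| < 1 leaves room for |π Y| ≤ 1 near 0, which
keeps the deviated argument within [-|t|, |t|]. -/
theorem exists_fdeSolution [CompleteSpace E] {H : (ℝ × E × E) × (E × E) → E} {π : E →L[ℝ] ℝ}
    {P : E} {r L lam : ℝ} (hr : 0 < r) (hL : 0 ≤ L) (hlam : 0 ≤ lam) (hlam1 : lam < 1)
    (hπ : |π P| < 1) (hfix : H (fdeBase P) = P)
    (hlip : ∀ x ∈ closedBall (fdeBase P) r, ∀ y ∈ closedBall (fdeBase P) r,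
      ‖H x - H y‖ ≤ L * ‖x.1 - y.1‖ + lam * ‖x.2 - y.2‖) :
    ∃ δ > 0, ∃ M ≥ 0, ∃ Z Y : ℝ → E, IsFDESolution H π P δ Z Y ∧ (∀ t, HasDerivAt Z (Y t) t) ∧
      (∀ s t, ‖Y s - Y t‖ ≤ M * |s - t|) ∧ (∀ t, ‖Y t - P‖ ≤ r) := by
  set B : ℝ := ‖P‖ + r with hBdef
  have hB0 : 0 ≤ B := by positivity
  -- The solution of L (1 + B) + lam M = M: velocities with Lipschitz constant M are sent to
  -- velocities with the same constant.
  set M : ℝ := L * (1 + B) / (1 - lam) with hMdef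
  have h1l : 0 < 1 - lam := by linarith
  have hM0 : 0 ≤ M := by positivity
  have hMeq : L * (1 + B) + lam * M = M := by rw [hMdef]; field_simp; ring
  -- The first three bounds keep all arguments in the ball where H is controlled, the fourth gives
  -- |π Y| ≤ 1, and the last makes (1 + lam)/2 a contraction factor.
  obtain ⟨δ, hδ, hδr, hBr, hMr, hMπ, hcon⟩ : ∃ δ > 0, δ ≤ r ∧ B * δ ≤ r ∧ M * δ ≤ r ∧
      ‖π‖ * (M * δ) ≤ 1 - |π P| ∧
      lam + δ * (L * (1 + B * ‖π‖) + lam * (M * ‖π‖)) ≤ (1 + lam) / 2 := by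
    have key : ∀ c b : ℝ, 0 < b → ∀ᶠ δ in 𝓝[>] (0 : ℝ), c * δ ≤ b := fun c b hb => by
      have : Filter.Tendsto (fun δ : ℝ => c * δ) (𝓝[>] 0) (𝓝 (c * 0)) :=
        (Continuous.tendsto (by fun_prop) 0).mono_left nhdsWithin_le_nhds
      rw [mul_zero] at this
      exact this.eventually_le_const hb
    have hpos : ∀ᶠ δ in 𝓝[>] (0 : ℝ), 0 < δ := eventually_mem_nhdsWithin
    obtain ⟨δ, h0, h1, h2, h3, h4, h5⟩ := (hpos.and <| (key 1 r hr).and <| (key B r hr).and <|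
      (key M r hr).and <| (key (‖π‖ * M) (1 - |π P|) (by linarith)).and
      (key (L * (1 + B * ‖π‖) + lam * (M * ‖π‖)) ((1 - lam) / 2) (by linarith))).exists
    exact ⟨δ, h0, by linarith, h2, h3, by linarith, by linarith⟩
  let S : Set (ℝ →ᵇ E) :=
    {Y | (∀ s t, ‖Y s - Y t‖ ≤ M * |s - t|) ∧ Y 0 = P ∧ ∀ t, ‖Y t - P‖ ≤ M * δ}
  have hSc : IsClosed S := by
    have ev : ∀ t : ℝ, Continuous fun Y : ℝ →ᵇ E => Y t := fun t => continuous_eval_const t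
    have e : S = (⋂ s, ⋂ t, {Y : ℝ →ᵇ E | ‖Y s - Y t‖ ≤ M * |s - t|}) ∩
        ({Y : ℝ →ᵇ E | Y 0 = P} ∩ ⋂ t, {Y : ℝ →ᵇ E | ‖Y t - P‖ ≤ M * δ}) := by
      ext Y; simp [S]
    rw [e]
    exact (isClosed_iInter fun s => isClosed_iInter fun t =>
        isClosed_le ((ev s).sub (ev t)).norm continuous_const).inter
      ((isClosed_eq (ev 0) continuous_const).inter
        (isClosed_iInter fun t => isClosed_le ((ev t).sub continuous_const).norm continuous_const))
  have hderiv : ∀ Y : ℝ →ᵇ E, ∀ t, HasDerivAt (prim Y) (Y t) t := fun Y t =>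
    hasDerivAt_prim Y.continuous t
  have hYr : ∀ Y ∈ S, ∀ t, ‖Y t - P‖ ≤ r := fun Y hY t => (hY.2.2 t).trans hMr
  have hYB : ∀ Y ∈ S, ∀ t, ‖Y t‖ ≤ B := fun Y hY t => by
    have := norm_le_norm_add_norm_sub' (Y t) P
    have := hYr Y hY t
    linarith
  have hπY : ∀ Y ∈ S, ∀ t, ‖π (Y t)‖ ≤ 1 := fun Y hY t => by
    have e1 := π.le_opNorm (Y t - P)
    have e2 := mul_le_mul_of_nonneg_left (hY.2.2 t) (norm_nonneg π)
    have e3 := norm_le_norm_add_norm_sub' (π (Y t)) (π P)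
    rw [← map_sub] at e3
    rw [Real.norm_eq_abs (π P)] at e3
    linarith
  have hπlip : ∀ Y ∈ S, ∀ s t, |π (prim Y s) - π (prim Y t)| ≤ |s - t| := fun Y hY s t => by
    have := Convex.norm_image_sub_le_of_norm_hasDerivWithin_le (s := univ) (C := 1)
      (fun u _ => (π.hasFDerivAt.comp_hasDerivAt u (hderiv Y u)).hasDerivWithinAt)
      (fun u _ => hπY Y hY u) convex_univ (mem_univ t) (mem_univ s)
    simpa using this
  have hπabs : ∀ Y ∈ S, ∀ t, |π (prim Y t)| ≤ |t| := fun Y hY t => by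
    simpa using hπlip Y hY t 0
  have hprim : ∀ Y ∈ S, ∀ s t, ‖prim Y s - prim Y t‖ ≤ B * |s - t| := fun Y hY s t =>
    Convex.norm_image_sub_le_of_norm_hasDerivWithin_le (s := univ)
      (fun u _ => (hderiv Y u).hasDerivWithinAt)
      (fun u _ => hYB Y hY u) convex_univ (mem_univ t) (mem_univ s)
  have hball : ∀ Y ∈ S, ∀ t ∈ Icc (-δ) δ,
      fdeArg π (prim Y) Y t ∈ closedBall (fdeBase P) r := fun Y hY t ht =>
    fdeArg_mem_closedBall (fun u _ => (hderiv Y u).hasDerivWithinAt) (prim_zero _)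
      (fun u _ => hπabs Y hY u) (fun u _ => hYB Y hY u) (fun u _ => hYr Y hY u) hδr hBr ht
  have hcl : ∀ t, clamp δ t ∈ Icc (-δ) δ := fun t => abs_le.1 (abs_clamp_le hδ.le t)
  have hTlip : ∀ Y ∈ S, ∀ s t, ‖H (fdeArg π (prim Y) Y (clamp δ s)) -
      H (fdeArg π (prim Y) Y (clamp δ t))‖ ≤ M * |s - t| := fun Y hY s t => by
    have h := hlip _ (hball Y hY _ (hcl s)) _ (hball Y hY _ (hcl t))
    have hst := abs_clamp_sub_le δ s t
    generalize clamp δ s = s' at *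
    generalize clamp δ t = t' at *
    have h0 := abs_nonneg (s' - t')
    have hp := hπlip Y hY s' t'
    have hv : ‖(fdeArg π (prim Y) Y s').1 - (fdeArg π (prim Y) Y t').1‖ ≤
        (1 + B) * |s' - t'| := by
      have e1 := hprim Y hY s' t'
      have e2 := (hprim Y hY (π (prim Y s')) (π (prim Y t'))).trans
        (mul_le_mul_of_nonneg_left hp hB0)
      simp only [fdeArg, Prod.mk_sub_mk, Prod.norm_mk, max_le_iff, Real.norm_eq_abs]
      exact ⟨by nlinarith, by linarith, by linarith⟩
    have hu : ‖(fdeArg π (prim Y) Y s').2 - (fdeArg π (prim Y) Y t').2‖ ≤ M * |s' - t'| := by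
      simp only [fdeArg, Prod.mk_sub_mk, Prod.norm_mk, max_le_iff]
      exact ⟨hY.1 _ _, (hY.1 _ _).trans (mul_le_mul_of_nonneg_left hp hM0)⟩
    have e1 := mul_le_mul_of_nonneg_left hv hL
    have e2 := mul_le_mul_of_nonneg_left hu hlam
    have e3 : L * ((1 + B) * |s' - t'|) + lam * (M * |s' - t'|) = M * |s' - t'| := by
      linear_combination |s' - t'| * hMeq
    exact (h.trans (by linarith)).trans (mul_le_mul_of_nonneg_left hst hM0)
  have hcl0 : clamp δ 0 = 0 := clamp_of_abs_le (by simpa using hδ.le)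
  have hT0 : ∀ Y ∈ S, H (fdeArg π (prim Y) Y (clamp δ 0)) = P := fun Y hY => by
    rw [hcl0]
    simpa [fdeArg, fdeBase, hY.2.1] using hfix
  have hclcl : ∀ t, clamp δ (clamp δ t) = clamp δ t := fun t =>
    clamp_of_abs_le (abs_clamp_le hδ.le t)
  have hTP : ∀ Y ∈ S, ∀ t, ‖H (fdeArg π (prim Y) Y (clamp δ t)) - P‖ ≤ M * δ := fun Y hY t => by
    have h := hTlip Y hY (clamp δ t) 0
    rw [hT0 Y hY, hclcl, sub_zero] at h
    exact h.trans (mul_le_mul_of_nonneg_left (abs_clamp_le hδ.le t) hM0)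
  -- Clamping the time makes the image a bounded function on the whole line, constant outside [-δ,
  -- δ]. A fixed point therefore solves the equation on [-δ, δ] only.
  let T : S → S := fun Y => ⟨BoundedContinuousFunction.ofNormedAddCommGroup
      (fun t => H (fdeArg π (prim Y.1) Y.1 (clamp δ t)))
      (LipschitzWith.of_dist_le_mul (K := ⟨M, hM0⟩) fun s t => by
        rw [dist_eq_norm, Real.dist_eq]; exact hTlip Y.1 Y.2 s t).continuous (‖P‖ + M * δ)
      (fun t => by
        have := norm_le_norm_add_norm_sub' (H (fdeArg π (prim Y.1) Y.1 (clamp δ t))) P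
        have := hTP Y.1 Y.2 t
        linarith),
    hTlip Y.1 Y.2, hT0 Y.1 Y.2, hTP Y.1 Y.2⟩
  have hcomp : CompleteSpace S := hSc.completeSpace_coe
  have hne : Nonempty S := ⟨⟨BoundedContinuousFunction.const ℝ P, by
    refine ⟨fun s t => ?_, rfl, fun t => ?_⟩ <;> simp <;> positivity⟩⟩
  have hTc : ContractingWith (Real.toNNReal ((1 + lam) / 2)) T := by
    refine ⟨by rw [Real.toNNReal_lt_one]; linarith,
      LipschitzWith.of_dist_le_mul fun Y V => ?_⟩
    rw [Subtype.dist_eq, Subtype.dist_eq, Real.coe_toNNReal _ (by linarith)]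
    refine (BoundedContinuousFunction.dist_le
      (mul_nonneg (by linarith) dist_nonneg)).2 fun t => ?_
    rw [dist_eq_norm]
    have := norm_sub_le_of_fdeArg (D := dist Y.1 V.1) hL hlam hlip
      (fun u _ => (hderiv Y.1 u).hasDerivWithinAt) (fun u _ => (hderiv V.1 u).hasDerivWithinAt)
      (prim_zero _) (prim_zero _)
      (fun u _ => hπabs Y.1 Y.2 u) (fun u _ => hπabs V.1 V.2 u) (fun u _ => hYB Y.1 Y.2 u)
      (fun u _ => hYB V.1 V.2 u) (fun u _ => hYr Y.1 Y.2 u) (fun u _ => hYr V.1 V.2 u) hδr hBr hM0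
      (fun s _ t _ => Y.2.1 s t)
      (fun t _ => by rw [← dist_eq_norm]; exact BoundedContinuousFunction.dist_coe_le_dist t)
      (hcl t)
    exact this.trans (mul_le_mul_of_nonneg_right hcon dist_nonneg)
  obtain ⟨Y, hY⟩ : ∃ Y : S, T Y = Y := ⟨_, hTc.fixedPoint_isFixedPt⟩
  refine ⟨δ, hδ, M, hM0, prim Y.1, Y.1, ⟨fun t _ => (hderiv Y.1 t).hasDerivWithinAt,
    Y.1.continuous.continuousOn, prim_zero _, Y.2.2.1, fun t _ => hπabs Y.1 Y.2 t, fun t ht => ?_⟩,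
    hderiv Y.1, Y.2.1, hYr Y.1 Y.2⟩
  have h := congrArg (fun V : S => V.1 t) hY
  simp only [T, BoundedContinuousFunction.coe_ofNormedAddCommGroup, clamp_of_abs_le (abs_le.2 ht)]
    at h
  exact h.symm

lemma IsFDESolution.mono {H : (ℝ × E × E) × (E × E) → E} {π : E →L[ℝ] ℝ} {P : E} {δ δ' : ℝ}
    {Z Y : ℝ → E} (h : IsFDESolution H π P δ Z Y) (hδ : δ' ≤ δ) : IsFDESolution H π P δ' Z Y := by
  have hs : Icc (-δ') δ' ⊆ Icc (-δ) δ := Icc_subset_Icc (by linarith) hδ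
  exact ⟨fun t ht => (h.hasDeriv t (hs ht)).mono hs, h.cont.mono hs, h.init, h.init_deriv,
    fun t ht => h.abs_le t (hs ht), fun t ht => h.eqn t (hs ht)⟩

/-- Where both velocities stay in the ball, the maximum of their distance is at most a factor less
than 1 times itself, hence zero. The radius is uniform in the competitor although its modulus of
continuity is unknown, because the bootstrap shows that it never leaves the ball. -/
theorem fdeSolution_unique {H : (ℝ × E × E) × (E × E) → E} {π : E →L[ℝ] ℝ}
    {P : E} {r L lam δ₁ M : ℝ} (hr : 0 < r) (hL : 0 ≤ L) (hlam : 0 ≤ lam) (hlam1 : lam < 1)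
    (hlip : ∀ x ∈ closedBall (fdeBase P) r, ∀ y ∈ closedBall (fdeBase P) r,
      ‖H x - H y‖ ≤ L * ‖x.1 - y.1‖ + lam * ‖x.2 - y.2‖) (hδ₁ : 0 < δ₁) (hM : 0 ≤ M)
    {Z Y : ℝ → E} (hZ : IsFDESolution H π P δ₁ Z Y)
    (hY : ∀ s t, ‖Y s - Y t‖ ≤ M * |s - t|) :
    ∃ δ₀ > 0, δ₀ ≤ δ₁ ∧ ∀ δ, 0 < δ → δ ≤ δ₀ → ∀ W V : ℝ → E, IsFDESolution H π P δ W V →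
      EqOn W Z (Icc (-δ) δ) := by
  set B : ℝ := ‖P‖ + r with hBdef
  have hB0 : 0 ≤ B := by positivity
  obtain ⟨δ₀, hδ₀, hδ₀₁, hδr, hBr, hMr, hcon⟩ : ∃ δ > 0, δ ≤ δ₁ ∧ δ ≤ r ∧ B * δ ≤ r ∧
      M * δ < r ∧ δ * (L * (1 + B * ‖π‖) + lam * (M * ‖π‖)) < (1 - lam) := by
    have key : ∀ c b : ℝ, 0 < b → ∀ᶠ δ in 𝓝[>] (0 : ℝ), c * δ < b := fun c b hb => by
      have : Filter.Tendsto (fun δ : ℝ => c * δ) (𝓝[>] 0) (𝓝 (c * 0)) :=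
        (Continuous.tendsto (by fun_prop) 0).mono_left nhdsWithin_le_nhds
      rw [mul_zero] at this
      exact this.eventually_lt_const hb
    have hpos : ∀ᶠ δ in 𝓝[>] (0 : ℝ), 0 < δ := eventually_mem_nhdsWithin
    obtain ⟨δ, h0, h1, h2, h3, h4, h5⟩ := (hpos.and <| (key 1 r hr).and <| (key B r hr).and <|
      (key M r hr).and <| (key 1 δ₁ hδ₁).and
      (key (L * (1 + B * ‖π‖) + lam * (M * ‖π‖)) (1 - lam) (by linarith))).exists
    exact ⟨δ, h0, by linarith, by linarith, h2.le, by linarith, by linarith⟩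
  refine ⟨δ₀, hδ₀, hδ₀₁, fun δ hδ hδδ₀ W V hW => ?_⟩
  have hZδ := hZ.mono (hδδ₀.trans hδ₀₁)
  have hYP : ∀ t ∈ Icc (-δ) δ, ‖Y t - P‖ ≤ M * δ₀ := fun t ht => by
    have := hY t 0
    rw [hZ.init_deriv, sub_zero] at this
    exact this.trans (mul_le_mul_of_nonneg_left ((abs_le.2 ht).trans hδδ₀) hM)
  have hbd : ∀ X : E, ‖X - P‖ ≤ r → ‖X‖ ≤ B := fun X hX => by
    have := norm_le_norm_add_norm_sub' X P
    linarith
  have hVY : ∀ t ∈ Icc (-δ) δ, ‖Y t - V t‖ ≤ 0 := by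
    -- As Y stays within M δ₀ of P, a distance at most r - M δ₀ from Y keeps V in the ball of radius
    -- r; the improved bound is 0.
    refine le_of_bootstrap (r := r - M * δ₀) (hZδ.cont.sub hW.cont).norm (by linarith)
      (by rw [hZ.init_deriv, hW.init_deriv]; simp) fun s hs hsδ hV' => ?_
    have hV : ∀ t ∈ Icc (-s) s, ‖V t - P‖ ≤ r := fun t ht => by
      have e1 := hV' t ht
      have e2 := hYP t ⟨by linarith [ht.1], by linarith [ht.2]⟩
      have e3 := norm_sub_le_norm_sub_add_norm_sub (V t) (Y t) P
      rw [norm_sub_rev (V t) (Y t)] at e3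
      linarith
    have hZs := hZδ.mono hsδ
    have hWs := hW.mono hsδ
    have hsub : Icc (-s) s ⊆ Icc (-δ) δ := Icc_subset_Icc (by linarith) hsδ
    obtain ⟨t₀, ht₀, hmax⟩ := isCompact_Icc.exists_isMaxOn (s := Icc (-s) s)
      ⟨0, by constructor <;> linarith⟩ (hZs.cont.sub hWs.cont).norm
    have hle : ∀ t ∈ Icc (-s) s, ‖Y t - V t‖ ≤ ‖Y t₀ - V t₀‖ := fun t ht => hmax ht
    have := norm_sub_le_of_fdeArg hL hlam hlip hZs.hasDeriv hWs.hasDeriv hZs.init hWs.init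
      hZs.abs_le hWs.abs_le (fun t ht => hbd _ ((hYP t (hsub ht)).trans hMr.le))
      (fun t ht => hbd _ (hV t ht))
      (fun t ht => (hYP t (hsub ht)).trans hMr.le) hV (by linarith)
      ((mul_le_mul_of_nonneg_left (hsδ.trans hδδ₀) hB0).trans hBr) hM
      (fun s _ t _ => hY s t) hle ht₀
    rw [← hZs.eqn t₀ ht₀, ← hWs.eqn t₀ ht₀] at this
    have hc : s * (L * (1 + B * ‖π‖) + lam * (M * ‖π‖)) < 1 - lam :=
      (mul_le_mul_of_nonneg_right (hsδ.trans hδδ₀) (by positivity)).trans_lt hcon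
    have h0 : ‖Y t₀ - V t₀‖ ≤ 0 := by
      by_contra! hpos
      nlinarith
    exact fun t ht => (hle t ht).trans h0
  intro t ht
  have h0m : (0 : ℝ) ∈ Icc (-δ) δ := abs_le_mem_Icc ht (by simp)
  have := norm_sub_le_of_hasDerivWithinAt (Z := fun s => W s - Z s) (Y := fun s => V s - Y s)
    (B := 0) (fun t ht => (hW.hasDeriv t ht).sub (hZδ.hasDeriv t ht))
    (fun t ht => by rw [norm_sub_rev]; exact hVY t ht) ht h0m
  simp only [hW.init, hZ.init, sub_zero, zero_mul] at this
  exact sub_eq_zero.1 (norm_le_zero_iff.1 this)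

/-- Strict differentiability transfers the bound on the partial derivative at one point to a
Lipschitz bound nearby, with an arbitrarily small loss. Keeping the two variables apart is
essential, since only the constant in the second must be below 1. -/
lemma exists_lipschitz_of_hasStrictFDerivAt {V U E : Type*}
    [NormedAddCommGroup V] [NormedSpace ℝ V] [NormedAddCommGroup U] [NormedSpace ℝ U]
    [NormedAddCommGroup E] [NormedSpace ℝ E]
    {H : V × U → E} {H' : V × U →L[ℝ] E} {x₀ : V × U} (h : HasStrictFDerivAt H H' x₀)
    {lam lam' : ℝ} (hH' : ∀ u, ‖H' (0, u)‖ ≤ lam * ‖u‖) (hlam : lam < lam') :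
    ∃ r > 0, ∀ x ∈ closedBall x₀ r, ∀ y ∈ closedBall x₀ r,
      ‖H x - H y‖ ≤ (‖H'‖ + (lam' - lam)) * ‖x.1 - y.1‖ + lam' * ‖x.2 - y.2‖ := by
  have hlo := h.isLittleO.def (sub_pos.2 hlam)
  rw [nhds_prod_eq, Filter.eventually_prod_iff] at hlo
  obtain ⟨p, hp, q, hq, hpq⟩ := hlo
  obtain ⟨r, hr, hball⟩ := nhds_basis_closedBall.mem_iff.1 (hp.and hq)
  refine ⟨r, hr, fun x hx y hy => ?_⟩
  have h1 := hpq (hball hx).1 (hball hy).2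
  simp only at h1
  have e0 : x - y = (x.1 - y.1, 0) + (0, x.2 - y.2) := by ext <;> simp
  have e1 : ‖H' (x - y)‖ ≤ ‖H'‖ * ‖x.1 - y.1‖ + lam * ‖x.2 - y.2‖ := by
    rw [e0, map_add]
    refine (norm_add_le _ _).trans (add_le_add ?_ (hH' _))
    simpa using H'.le_opNorm (x.1 - y.1, (0 : U))
  have e2 : ‖x - y‖ ≤ ‖x.1 - y.1‖ + ‖x.2 - y.2‖ := by
    rw [Prod.norm_def]
    exact max_le (le_add_of_nonneg_right (norm_nonneg _)) (le_add_of_nonneg_left (norm_nonneg _))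
  have e3 := norm_le_norm_add_norm_sub' (H x - H y) (H' (x - y))
  have e4 := mul_le_mul_of_nonneg_left e2 (sub_pos.2 hlam).le
  linarith

end FunctionalEquation

/-! ### One refractive index: regularity, derivatives along curves, values at the origin. -/

section OneColorCalculus

variable {n ρ₀ d₀ : ℝ}

lemma root_radicand_pos (hn : 1 < n) {ζ : Fin 5 → ℝ} (h : 0 < (ζ 1 - ρ₀) ^ 2 + ζ 2 ^ 2) :
    0 < (ζ 1 - ρ₀) ^ 2 + ζ 2 ^ 2 + (n ^ 2 - 1) * (ζ 3 ^ 2 + (ζ 4 + ρ₀) ^ 2) := by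
  have : 0 ≤ (n ^ 2 - 1) * (ζ 3 ^ 2 + (ζ 4 + ρ₀) ^ 2) :=
    mul_nonneg (by nlinarith) (by positivity)
  linarith

lemma rad_pos {ζ : Fin 5 → ℝ} (h : 0 < (ζ 1 - ρ₀) ^ 2 + ζ 2 ^ 2) : 0 < rad ρ₀ ζ :=
  Real.sqrt_pos.2 h

lemma root_pos (hn : 1 < n) {ζ : Fin 5 → ℝ} (h : 0 < (ζ 1 - ρ₀) ^ 2 + ζ 2 ^ 2) :
    0 < root n ρ₀ ζ :=
  Real.sqrt_pos.2 (root_radicand_pos hn h)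

lemma A_neg (hn : 1 < n) {ζ : Fin 5 → ℝ} (h : 0 < (ζ 1 - ρ₀) ^ 2 + ζ 2 ^ 2) :
    A n ρ₀ ζ < 0 :=
  div_neg_of_neg_of_pos (by nlinarith) (add_pos (rad_pos h) (root_pos hn h))

/-! ### Smoothness -/

section Smooth

variable {X : Type*} [NormedAddCommGroup X] [NormedSpace ℝ X] {k : WithTop ℕ∞}
  {t : X → ℝ} {ζ ξ : X → Fin 5 → ℝ} {y : X}

lemma contDiffAt_rad (hζ : ContDiffAt ℝ k ζ y) (h : 0 < (ζ y 1 - ρ₀) ^ 2 + ζ y 2 ^ 2) :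
    ContDiffAt ℝ k (fun z => rad ρ₀ (ζ z)) y := by
  have := contDiffAt_pi.1 hζ
  exact ContDiffAt.sqrt ((((this 1).sub contDiffAt_const).pow 2).add ((this 2).pow 2)) h.ne'

lemma contDiffAt_root (hn : 1 < n) (hζ : ContDiffAt ℝ k ζ y)
    (h : 0 < (ζ y 1 - ρ₀) ^ 2 + ζ y 2 ^ 2) : ContDiffAt ℝ k (fun z => root n ρ₀ (ζ z)) y := by
  have := contDiffAt_pi.1 hζ
  exact ContDiffAt.sqrt (((((this 1).sub contDiffAt_const).pow 2).add ((this 2).pow 2)).add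
    (contDiffAt_const.mul (((this 3).pow 2).add (((this 4).add contDiffAt_const).pow 2))))
    (root_radicand_pos hn h).ne'

lemma contDiffAt_A (hn : 1 < n) (hζ : ContDiffAt ℝ k ζ y)
    (h : 0 < (ζ y 1 - ρ₀) ^ 2 + ζ y 2 ^ 2) : ContDiffAt ℝ k (fun z => A n ρ₀ (ζ z)) y :=
  contDiffAt_const.div ((contDiffAt_rad hζ h).add (contDiffAt_root hn hζ h))
    (add_pos (rad_pos h) (root_pos hn h)).ne'

lemma contDiffAt_mu (hn : 1 < n) (ht : ContDiffAt ℝ k t y) (hζ : ContDiffAt ℝ k ζ y)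
    (h : 0 < (ζ y 1 - ρ₀) ^ 2 + ζ y 2 ^ 2) :
    ContDiffAt ℝ k (fun z => mu n ρ₀ (t z) (ζ z)) y :=
  contDiffAt_const.mul (ht.sin.sub ((contDiffAt_A hn hζ h).mul (contDiffAt_pi.1 hζ 3)))

lemma contDiffAt_tau (hn : 1 < n) (ht : ContDiffAt ℝ k t y) (hζ : ContDiffAt ℝ k ζ y)
    (h : 0 < (ζ y 1 - ρ₀) ^ 2 + ζ y 2 ^ 2) :
    ContDiffAt ℝ k (fun z => tau n ρ₀ (t z) (ζ z)) y :=
  contDiffAt_const.mul (ht.cos.sub ((contDiffAt_A hn hζ h).mul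
    ((contDiffAt_pi.1 hζ 4).add contDiffAt_const)))

lemma contDiffAt_D (hn : 1 < n) (ht : ContDiffAt ℝ k t y) (hζ : ContDiffAt ℝ k ζ y)
    (h : 0 < (ζ y 1 - ρ₀) ^ 2 + ζ y 2 ^ 2) (h' : n - tau n ρ₀ (t y) (ζ y) ≠ 0) :
    ContDiffAt ℝ k (fun z => D n ρ₀ d₀ (t z) (ζ z)) y :=
  (((contDiffAt_const.sub (contDiffAt_rad hζ h)).sub (contDiffAt_pi.1 hζ 1)).add
    contDiffAt_const).div (contDiffAt_const.sub (contDiffAt_tau hn ht hζ h)) h'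

lemma contDiffAt_Lam (hn : 1 < n) (ht : ContDiffAt ℝ k t y) (hζ : ContDiffAt ℝ k ζ y)
    (h : ColorRegular n ρ₀ (t y) (ζ y)) :
    ContDiffAt ℝ k (fun z => Lam n ρ₀ (t z) (ζ z)) y :=
  ContDiffAt.sqrt (contDiffAt_const.sub (contDiffAt_const.mul (contDiffAt_tau hn ht hζ h.1)))
    h.2.2.ne'

lemma contDiffAt_inner (hζ : ContDiffAt ℝ k ζ y) (hξ : ContDiffAt ℝ k ξ y) :
    ContDiffAt ℝ k (fun z => (ζ z 1 - ρ₀) * ξ z 1 + ζ z 2 * ξ z 2) y := by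
  have h1 := contDiffAt_pi.1 hζ
  have h2 := contDiffAt_pi.1 hξ
  exact (((h1 1).sub contDiffAt_const).mul (h2 1)).add ((h1 2).mul (h2 2))

lemma contDiffAt_dA (hn : 1 < n) (hζ : ContDiffAt ℝ k ζ y) (hξ : ContDiffAt ℝ k ξ y)
    (h : 0 < (ζ y 1 - ρ₀) ^ 2 + ζ y 2 ^ 2) :
    ContDiffAt ℝ k (fun z => dA n ρ₀ (ζ z) (ξ z)) y := by
  have h1 := contDiffAt_pi.1 hζ
  have h2 := contDiffAt_pi.1 hξ
  have hq := contDiffAt_inner (ρ₀ := ρ₀) hζ hξ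
  exact (((contDiffAt_A hn hζ h).pow 2).div_const _).mul
    ((hq.div (contDiffAt_rad hζ h) (rad_pos h).ne').add
      ((hq.add (contDiffAt_const.mul (((h1 3).mul (h2 3)).add
        (((h1 4).add contDiffAt_const).mul (h2 4))))).div
          (contDiffAt_root hn hζ h) (root_pos hn h).ne'))

lemma contDiffAt_dmu (hn : 1 < n) (ht : ContDiffAt ℝ k t y) (hζ : ContDiffAt ℝ k ζ y)
    (hξ : ContDiffAt ℝ k ξ y) (h : 0 < (ζ y 1 - ρ₀) ^ 2 + ζ y 2 ^ 2) :
    ContDiffAt ℝ k (fun z => dmu n ρ₀ (t z) (ζ z) (ξ z)) y :=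
  contDiffAt_const.mul ((ht.cos.sub ((contDiffAt_A hn hζ h).mul (contDiffAt_pi.1 hξ 3))).sub
    ((contDiffAt_dA hn hζ hξ h).mul (contDiffAt_pi.1 hζ 3)))

lemma contDiffAt_dtau (hn : 1 < n) (ht : ContDiffAt ℝ k t y) (hζ : ContDiffAt ℝ k ζ y)
    (hξ : ContDiffAt ℝ k ξ y) (h : 0 < (ζ y 1 - ρ₀) ^ 2 + ζ y 2 ^ 2) :
    ContDiffAt ℝ k (fun z => dtau n ρ₀ (t z) (ζ z) (ξ z)) y :=
  contDiffAt_const.mul ((ht.sin.neg.sub ((contDiffAt_A hn hζ h).mul (contDiffAt_pi.1 hξ 4))).sub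
    ((contDiffAt_dA hn hζ hξ h).mul ((contDiffAt_pi.1 hζ 4).add contDiffAt_const)))

lemma contDiffAt_dD (hn : 1 < n) (ht : ContDiffAt ℝ k t y) (hζ : ContDiffAt ℝ k ζ y)
    (hξ : ContDiffAt ℝ k ξ y) (h : 0 < (ζ y 1 - ρ₀) ^ 2 + ζ y 2 ^ 2)
    (h' : n - tau n ρ₀ (t y) (ζ y) ≠ 0) :
    ContDiffAt ℝ k (fun z => dD n ρ₀ d₀ (t z) (ζ z) (ξ z)) y :=
  (((((contDiffAt_inner hζ hξ).div (contDiffAt_rad hζ h) (rad_pos h).ne').neg).sub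
    (contDiffAt_pi.1 hξ 1)).add ((contDiffAt_dtau hn ht hζ hξ h).mul
      (contDiffAt_D hn ht hζ h h'))).div (contDiffAt_const.sub (contDiffAt_tau hn ht hζ h)) h'

lemma contDiffAt_dF1 (hn : 1 < n) (ht : ContDiffAt ℝ k t y) (hζ : ContDiffAt ℝ k ζ y)
    (hξ : ContDiffAt ℝ k ξ y) (h : 0 < (ζ y 1 - ρ₀) ^ 2 + ζ y 2 ^ 2)
    (h' : n - tau n ρ₀ (t y) (ζ y) ≠ 0) :
    ContDiffAt ℝ k (fun z => dF1 n ρ₀ d₀ (t z) (ζ z) (ξ z)) y :=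
  ((contDiffAt_pi.1 hξ 2).add ((contDiffAt_D hn ht hζ h h').mul
    (contDiffAt_dmu hn ht hζ hξ h))).add ((contDiffAt_dD hn ht hζ hξ h h').mul
      (contDiffAt_mu hn ht hζ h))

lemma Lam_pos {t : ℝ} {ζ : Fin 5 → ℝ} (h : ColorRegular n ρ₀ t ζ) : 0 < Lam n ρ₀ t ζ :=
  Real.sqrt_pos.2 h.2.2

lemma contDiffAt_dLam (hn : 1 < n) (ht : ContDiffAt ℝ k t y) (hζ : ContDiffAt ℝ k ζ y)
    (hξ : ContDiffAt ℝ k ξ y) (h : ColorRegular n ρ₀ (t y) (ζ y)) :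
    ContDiffAt ℝ k (fun z => dLam n ρ₀ (t z) (ζ z) (ξ z)) y :=
  ((contDiffAt_const.mul (contDiffAt_dtau hn ht hζ hξ h.1)).div (contDiffAt_Lam hn ht hζ h)
    (Lam_pos h).ne').neg

/-- The right-hand side of the functional system is smooth on its domain. -/
lemma contDiffAt_H {nr nb : ℝ} (hr : 1 < nr) (hb : 1 < nb) {ζ0 ζ1 ξ0 ξ1 : X → Fin 5 → ℝ}
    (ht : ContDiffAt ℝ k t y) (h0 : ContDiffAt ℝ k ζ0 y) (h1 : ContDiffAt ℝ k ζ1 y)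
    (h0' : ContDiffAt ℝ k ξ0 y) (h1' : ContDiffAt ℝ k ξ1 y)
    (hdom : InDomain nr nb ρ₀ d₀ (t y) (ζ0 y) (ζ1 y) (ξ1 y)) :
    ContDiffAt ℝ k (fun z => H nr nb ρ₀ d₀ (t z) (ζ0 z) (ζ1 z) (ξ0 z) (ξ1 z)) y := by
  obtain ⟨htI, hr0, hb1, hF⟩ := hdom
  have a0 := contDiffAt_pi.1 h0
  have b0 := contDiffAt_pi.1 h0'
  have hcos : Real.cos (t y) ≠ 0 := (Real.cos_pos_of_mem_Ioo htI).ne'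
  have htan : ContDiffAt ℝ k (fun z => Real.tan (t z)) y := by
    simp only [Real.tan_eq_sin_div_cos]
    exact ht.sin.div ht.cos hcos
  refine contDiffAt_pi.2 fun i => ?_
  fin_cases i
  · exact (contDiffAt_dF1 hr ht h0 h0' hr0.1 hr0.2.1).div
      (contDiffAt_dF1 hb (a0 0) h1 h1' hb1.1 hb1.2.1) hF
  · exact a0 3
  · exact (a0 4).add contDiffAt_const
  · refine ContDiffAt.neg (ContDiffAt.div ?_ ((contDiffAt_const.mul (contDiffAt_A hr h0 hr0.1)).mul
      (contDiffAt_Lam hb (a0 0) h1 hb1)) ?_)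
    · exact (((b0 0).mul (((contDiffAt_dmu hb (a0 0) h1 h1' hb1.1).mul
        (contDiffAt_Lam hr ht h0 hr0)).sub ((contDiffAt_dLam hb (a0 0) h1 h1' hb1).mul
        (contDiffAt_mu hr ht h0 hr0.1)))).add ((contDiffAt_mu hb (a0 0) h1 hb1.1).mul
        (contDiffAt_dLam hr ht h0 h0' hr0))).sub ((contDiffAt_const.mul (ht.cos.sub
        ((contDiffAt_dA hr h0 h0' hr0.1).mul (a0 3)))).mul (contDiffAt_Lam hb (a0 0) h1 hb1))
    · exact mul_ne_zero (mul_ne_zero (one_div_ne_zero (by linarith)) (A_neg hr hr0.1).ne)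
        (Lam_pos hb1).ne'
  · exact ((htan.neg.mul (b0 3)).sub ((contDiffAt_const.div (ht.cos.pow 2) (pow_ne_zero 2 hcos)).mul
      (a0 3))).sub (((contDiffAt_const.mul ht.sin).div (ht.cos.pow 3) (pow_ne_zero 3 hcos)).mul
      ((a0 1).sub contDiffAt_const))

end Smooth

/-! ### The functions with a tilde are derivatives along curves -/

section Curves

variable {s : Set ℝ} {ζ : ℝ → Fin 5 → ℝ} {ξ : Fin 5 → ℝ} {t : ℝ}

lemma hasDerivWithinAt_rad (hζ : HasDerivWithinAt ζ ξ s t)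
    (h : 0 < (ζ t 1 - ρ₀) ^ 2 + ζ t 2 ^ 2) :
    HasDerivWithinAt (fun u => rad ρ₀ (ζ u))
      (((ζ t 1 - ρ₀) * ξ 1 + ζ t 2 * ξ 2) / rad ρ₀ (ζ t)) s t := by
  have hi := hasDerivWithinAt_pi.1 hζ
  have := ((((hi 1).sub_const ρ₀).pow 2).add ((hi 2).pow 2)).sqrt h.ne'
  refine this.congr_deriv ?_
  have := (rad_pos h).ne'
  simp only [rad, Pi.add_apply, Pi.pow_apply] at this ⊢
  field_simp
  push_cast
  ring

lemma hasDerivWithinAt_root (hn : 1 < n) (hζ : HasDerivWithinAt ζ ξ s t)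
    (h : 0 < (ζ t 1 - ρ₀) ^ 2 + ζ t 2 ^ 2) :
    HasDerivWithinAt (fun u => root n ρ₀ (ζ u))
      (((ζ t 1 - ρ₀) * ξ 1 + ζ t 2 * ξ 2 + (n ^ 2 - 1) * (ζ t 3 * ξ 3 + (ζ t 4 + ρ₀) * ξ 4)) /
        root n ρ₀ (ζ t)) s t := by
  have hi := hasDerivWithinAt_pi.1 hζ
  have := (((((hi 1).sub_const ρ₀).pow 2).add ((hi 2).pow 2)).add
    ((((hi 3).pow 2).add (((hi 4).add_const ρ₀).pow 2)).const_mul (n ^ 2 - 1))).sqrt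
    (root_radicand_pos hn h).ne'
  refine this.congr_deriv ?_
  have := (root_pos hn h).ne'
  simp only [root, Pi.add_apply, Pi.pow_apply] at this ⊢
  field_simp
  push_cast
  ring

lemma hasDerivWithinAt_A (hn : 1 < n) (hζ : HasDerivWithinAt ζ ξ s t)
    (h : 0 < (ζ t 1 - ρ₀) ^ 2 + ζ t 2 ^ 2) :
    HasDerivWithinAt (fun u => A n ρ₀ (ζ u)) (dA n ρ₀ (ζ t) ξ) s t := by
  have hR := rad_pos h
  have hS := root_pos hn h
  refine ((hasDerivWithinAt_const t s (1 - n ^ 2)).div ((hasDerivWithinAt_rad hζ h).add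
    (hasDerivWithinAt_root hn hζ h)) (add_pos hR hS).ne').congr_deriv ?_
  have h1 : n ^ 2 - 1 ≠ 0 := by nlinarith
  have h2 := (add_pos hR hS).ne'
  simp only [dA, A, Pi.add_apply]
  field_simp
  ring

lemma hasDerivWithinAt_mu (hn : 1 < n) (hζ : HasDerivWithinAt ζ ξ s t)
    (h : 0 < (ζ t 1 - ρ₀) ^ 2 + ζ t 2 ^ 2) :
    HasDerivWithinAt (fun u => mu n ρ₀ u (ζ u)) (dmu n ρ₀ t (ζ t) ξ) s t := by
  have hi := hasDerivWithinAt_pi.1 hζ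
  refine (((Real.hasDerivAt_sin t).hasDerivWithinAt.sub
    ((hasDerivWithinAt_A hn hζ h).mul (hi 3))).const_mul (1 / n)).congr_deriv ?_
  rw [dmu]
  ring

lemma hasDerivWithinAt_tau (hn : 1 < n) (hζ : HasDerivWithinAt ζ ξ s t)
    (h : 0 < (ζ t 1 - ρ₀) ^ 2 + ζ t 2 ^ 2) :
    HasDerivWithinAt (fun u => tau n ρ₀ u (ζ u)) (dtau n ρ₀ t (ζ t) ξ) s t := by
  have hi := hasDerivWithinAt_pi.1 hζ
  refine (((Real.hasDerivAt_cos t).hasDerivWithinAt.sub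
    ((hasDerivWithinAt_A hn hζ h).mul ((hi 4).add_const ρ₀))).const_mul (1 / n)).congr_deriv ?_
  rw [dtau]
  ring

lemma hasDerivWithinAt_D (hn : 1 < n) (hζ : HasDerivWithinAt ζ ξ s t)
    (h : 0 < (ζ t 1 - ρ₀) ^ 2 + ζ t 2 ^ 2) (h' : n - tau n ρ₀ t (ζ t) ≠ 0) :
    HasDerivWithinAt (fun u => D n ρ₀ d₀ u (ζ u)) (dD n ρ₀ d₀ t (ζ t) ξ) s t := by
  have hi := hasDerivWithinAt_pi.1 hζ
  refine (((((hasDerivWithinAt_rad hζ h).const_sub ((n - 1) * d₀)).sub (hi 1)).add_const ρ₀).div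
    ((hasDerivWithinAt_tau hn hζ h).const_sub n) h').congr_deriv ?_
  simp only [dD, D, Pi.sub_apply]
  have := (rad_pos h).ne'
  field_simp
  ring

lemma hasDerivWithinAt_F1 (hn : 1 < n) (hζ : HasDerivWithinAt ζ ξ s t)
    (h : 0 < (ζ t 1 - ρ₀) ^ 2 + ζ t 2 ^ 2) (h' : n - tau n ρ₀ t (ζ t) ≠ 0) :
    HasDerivWithinAt (fun u => ζ u 2 + D n ρ₀ d₀ u (ζ u) * mu n ρ₀ u (ζ u))
      (dF1 n ρ₀ d₀ t (ζ t) ξ) s t := by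
  have hi := hasDerivWithinAt_pi.1 hζ
  refine ((hi 2).add ((hasDerivWithinAt_D hn hζ h h').mul
    (hasDerivWithinAt_mu hn hζ h))).congr_deriv ?_
  rw [dF1]
  ring

lemma hasDerivWithinAt_Lam (hn : 1 < n) (hζ : HasDerivWithinAt ζ ξ s t)
    (h : ColorRegular n ρ₀ t (ζ t)) :
    HasDerivWithinAt (fun u => Lam n ρ₀ u (ζ u)) (dLam n ρ₀ t (ζ t) ξ) s t := by
  refine ((((hasDerivWithinAt_tau hn hζ h.1).const_mul (2 / n)).const_sub
    (1 + 1 / n ^ 2)).sqrt h.2.2.ne').congr_deriv ?_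
  rw [dLam, Lam]
  have := (Lam_pos h).ne'
  rw [Lam] at this
  field_simp

end Curves

/-! ### Values at the origin -/

section Origin

lemma rad_zero (hρ : 0 < ρ₀) : rad ρ₀ 0 = ρ₀ := by
  simp [rad, Real.sqrt_sq hρ.le]

lemma root_zero (hn : 1 < n) (hρ : 0 < ρ₀) : root n ρ₀ 0 = n * ρ₀ := by
  rw [root, ← Real.sqrt_sq (show 0 ≤ n * ρ₀ by positivity)]
  congr 1
  simp
  ring

lemma A_zero (hn : 1 < n) (hρ : 0 < ρ₀) : A n ρ₀ 0 = -((n - 1) / ρ₀) := by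
  rw [A, rad_zero hρ, root_zero hn hρ]
  have : ρ₀ + n * ρ₀ ≠ 0 := by positivity
  field_simp
  ring

lemma mu_zero : mu n ρ₀ 0 0 = 0 := by simp [mu]

lemma tau_zero (hn : 1 < n) (hρ : 0 < ρ₀) : tau n ρ₀ 0 0 = 1 := by
  have : n ≠ 0 := by linarith
  rw [tau, A_zero hn hρ]
  simp
  field_simp
  ring

lemma D_zero (hn : 1 < n) (hρ : 0 < ρ₀) : D n ρ₀ d₀ 0 0 = d₀ := by
  rw [D, rad_zero hρ, tau_zero hn hρ]
  have : n - 1 ≠ 0 := by linarith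
  simp
  field_simp

lemma Delta_pos (hn : 1 < n) : 0 < Delta n := div_pos (by linarith) (by linarith)

lemma Lam_zero (hn : 1 < n) (hρ : 0 < ρ₀) : Lam n ρ₀ 0 0 = 1 / Delta n := by
  have : 0 < 1 / Delta n := by have := Delta_pos hn; positivity
  rw [Lam, tau_zero hn hρ, ← Real.sqrt_sq this.le]
  congr 1
  rw [Delta]
  have : n - 1 ≠ 0 := by linarith
  field_simp
  ring

lemma colorRegular_zero (hn : 1 < n) (hρ : 0 < ρ₀) : ColorRegular n ρ₀ 0 0 := by
  have : n - 1 ≠ 0 := by linarith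
  refine ⟨by simp; positivity, by rwa [tau_zero hn hρ], ?_⟩
  rw [tau_zero hn hρ]
  have h : 1 + 1 / n ^ 2 - 2 / n * 1 = ((n - 1) / n) ^ 2 := by field_simp; ring
  rw [h]
  positivity

lemma dmu_zero (hn : 1 < n) (hρ : 0 < ρ₀) (ξ : Fin 5 → ℝ) :
    dmu n ρ₀ 0 0 ξ = 1 / n + ξ 3 / (Delta n * ρ₀) := by
  rw [dmu, A_zero hn hρ, Delta]
  have : n - 1 ≠ 0 := by linarith
  simp
  field_simp

lemma dF1_zero (hn : 1 < n) (hρ : 0 < ρ₀) (ξ : Fin 5 → ℝ) :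
    dF1 n ρ₀ d₀ 0 0 ξ = ξ 2 + d₀ * (1 / n + ξ 3 / (Delta n * ρ₀)) := by
  rw [dF1, D_zero hn hρ, dmu_zero hn hρ, mu_zero]
  ring

end Origin

end OneColorCalculus

/-! ### The constants -/

/-- The bound `C(r,b)` on the ratio `ρ₀ / d₀`. -/
def ratioBound (nr nb : ℝ) : ℝ :=
  threshold nr nb * ((Delta nr - Delta nb) / (4 * Delta nr))

lemma one_lt_Delta {n : ℝ} (hn : 1 < n) : 1 < Delta n := by
  rw [Delta, one_lt_div (by linarith)]
  linarith

lemma Delta_lt {nr nb : ℝ} (hr : 1 < nr) (hrb : nr < nb) : Delta nb < Delta nr := by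
  rw [Delta, Delta, div_lt_div_iff₀ (by linarith) (by linarith)]
  nlinarith

lemma one_div_add_one_div_Delta {n : ℝ} (hn : 1 < n) : 1 / n + 1 / Delta n = 1 := by
  have : n - 1 ≠ 0 := by linarith
  rw [Delta]
  field_simp
  ring

lemma Delta_div {n : ℝ} (hn : 1 < n) : Delta n / n = Delta n - 1 := by
  have : n - 1 ≠ 0 := by linarith
  rw [Delta]
  field_simp
  ring

lemma threshold_pos {nr nb : ℝ} (hr : 1 < nr) (hrb : nr < nb) : 0 < threshold nr nb := by
  have h1 := one_lt_Delta hr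
  have h2 := one_lt_Delta (hr.trans hrb)
  have h3 := sub_pos.2 (Delta_lt hr hrb)
  unfold threshold
  positivity

lemma ratioBound_pos {nr nb : ℝ} (hr : 1 < nr) (hrb : nr < nb) : 0 < ratioBound nr nb := by
  have h1 := one_lt_Delta hr
  have h3 := sub_pos.2 (Delta_lt hr hrb)
  have := threshold_pos hr hrb
  unfold ratioBound
  positivity

lemma ratioBound_lt {nr nb : ℝ} (hr : 1 < nr) (hrb : nr < nb) :
    ratioBound nr nb < threshold nr nb := by
  have h1 := one_lt_Delta hr
  have h2 := one_lt_Delta (hr.trans hrb)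
  refine mul_lt_of_lt_one_right (threshold_pos hr hrb) ?_
  rw [div_lt_one (by linarith)]
  linarith

/-- Admissible data of the problem, where `k = ρ₀ / d₀`, `K` is the larger root of the
characteristic equation `K² - (Δ_r + Δ_b) K + (1 + k) Δ_r Δ_b = 0`, and `p` is the initial velocity
of the first unknown. -/
structure LensData (nr nb ρ₀ d₀ k K p : ℝ) : Prop where
  hr : 1 < nr
  hrb : nr < nb
  hρ : 0 < ρ₀
  hd : 0 < d₀
  hk : ρ₀ = k * d₀
  quad : K ^ 2 - (Delta nr + Delta nb) * K + (1 + k) * Delta nr * Delta nb = 0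
  K_lt : K < Delta nr
  lt_K : Delta nr + Delta nb < 2 * K
  p_eq : p * (K - Delta nb) = K - Delta nr
  contraction : Delta nb + |p| * (Delta nr + K) < K
  velocity : initialVelocity nr nb ρ₀ d₀ = ![p, 0, ρ₀, ρ₀ * (1 - K), 0]

/-- Translates smallness of k into the inequality `contraction`, the only place where the factor
(Δ_r - Δ_b)/(4 Δ_r) in `ratioBound` is used. -/
lemma exists_lensData {nr nb ρ₀ d₀ : ℝ} (hr : 1 < nr) (hrb : nr < nb) (hρ : 0 < ρ₀) (hd : 0 < d₀)
    (h : ρ₀ / d₀ < ratioBound nr nb) : ∃ k K p, LensData nr nb ρ₀ d₀ k K p := by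
  have hDb := one_lt_Delta (hr.trans hrb)
  have hDr := Delta_lt hr hrb
  have hvr := Delta_div hr
  have hvb := Delta_div (hr.trans hrb)
  have hk : 0 < ρ₀ / d₀ := by positivity
  have hdisc : disc nr nb ρ₀ d₀ =
    (Delta nr - Delta nb) ^ 2 - 4 * (ρ₀ / d₀) * Delta nr * Delta nb := rfl
  have hvel : initialVelocity nr nb ρ₀ d₀ = ![(Delta nr - Delta nb - √(disc nr nb ρ₀ d₀)) /
      (Delta nb - Delta nr - √(disc nr nb ρ₀ d₀)), 0, ρ₀,
      (-(Delta nr - 1 + (Delta nb - 1)) - √(disc nr nb ρ₀ d₀)) / 2 * ρ₀, 0] := by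
    rw [initialVelocity, hvr, hvb]
  rw [ratioBound, threshold] at h
  have hk' : ρ₀ = ρ₀ / d₀ * d₀ := by field_simp
  generalize ρ₀ / d₀ = k at *
  clear hvr hvb
  generalize hDr' : Delta nr = Dr at *
  generalize hDb' : Delta nb = Db at *
  generalize disc nr nb ρ₀ d₀ = σ at *
  -- With a = Δ_r - Δ_b and s = √σ one has K - Δ_b = (a + s)/2, Δ_r - K = (a - s)/2 and a² - s² = 4
  -- k Δ_r Δ_b, so the hypothesis reads (a² - s²)·4Δ_r < a³.
  obtain ⟨a, rfl⟩ : ∃ a, Dr = Db + a := ⟨Dr - Db, by ring⟩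
  simp only [add_sub_cancel_left] at *
  have ha : 0 < a := by linarith
  have h4 : 4 * k * (Db + a) * Db * (4 * (Db + a)) < a ^ 3 := by
    rw [div_mul_div_comm, lt_div_iff₀ (by positivity)] at h
    nlinarith
  have hkpos : 0 < 4 * k * (Db + a) * Db := by positivity
  have hσpos : 0 < σ := by
    have : 4 * k * (Db + a) * Db < a ^ 2 := by
      by_contra! hc
      nlinarith
    linarith
  have hs0 := Real.sqrt_pos.2 hσpos
  have hs2 := Real.sq_sqrt hσpos.le
  generalize √σ = s at *
  have hsa : s < a := by nlinarith
  have hsmall : (a - s) * (4 * (Db + a)) < a ^ 2 := by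
    have e : (a - s) * (4 * (Db + a)) * (a + s) < a ^ 2 * (a + s) := by nlinarith
    exact lt_of_mul_lt_mul_right e (by linarith)
  have hp : |(a - s) / (-a - s)| = (a - s) / (a + s) := by
    rw [abs_div, abs_of_pos (sub_pos.2 hsa), abs_of_neg (by linarith)]
    ring
  refine ⟨k, (Db + a + Db + s) / 2, (a - s) / (-a - s), hr, hrb, hρ, hd, hk', ?_, ?_, ?_, ?_, ?_,
    ?_⟩ <;> try simp only [hDr', hDb']
  · nlinarith
  · linarith
  · linarith
  · have : -a - s ≠ 0 := by linarith
    field_simp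
    ring
  · rw [hp]
    -- Since Δ_r + K = 2Δ_r - (a - s)/2, the claim is 4Δ_r (a - s) - (a - s)² < (a + s)², and the
    -- first term is already below a².
    have h5 : (a - s) / (a + s) * (Db + a + (Db + a + Db + s) / 2) < (a + s) / 2 := by
      rw [div_mul_eq_mul_div, div_lt_iff₀ (by linarith)]
      nlinarith [mul_pos (sub_pos.2 hsa) (sub_pos.2 hsa)]
    linarith
  · rw [hvel]
    have e1 : Db - (Db + a) - s = -a - s := by ring
    have e2 : (-(Db + a - 1 + (Db - 1)) - s) / 2 * ρ₀ = ρ₀ * (1 - (Db + a + Db + s) / 2) := by ring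
    rw [e1, e2]

namespace LensData

variable {nr nb ρ₀ d₀ k K p : ℝ} (h : LensData nr nb ρ₀ d₀ k K p)

include h

lemma hb : 1 < nb := h.hr.trans h.hrb

lemma one_lt_Db : 1 < Delta nb := one_lt_Delta h.hb

lemma Db_lt_Dr : Delta nb < Delta nr := Delta_lt h.hr h.hrb

lemma Db_lt_K : Delta nb < K := by linarith [h.Db_lt_Dr, h.lt_K]

lemma K_pos : 0 < K := by linarith [h.Db_lt_K, h.one_lt_Db]

lemma one_lt_Dr : 1 < Delta nr := h.one_lt_Db.trans h.Db_lt_Dr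

lemma abs_p_lt : |p| < 1 := by
  by_contra! hp
  nlinarith [h.contraction, h.one_lt_Dr, h.one_lt_Db, h.K_pos]

/-- The quadratic equation for K turns the horizontal velocity of the upper face into a product.
With `dF1_b` this makes the quotient of the two velocities equal to p. -/
lemma dF1_r {ξ : Fin 5 → ℝ} (h2 : ξ 2 = ρ₀) (h3 : ξ 3 = ρ₀ * (1 - K)) :
    dF1 nr ρ₀ d₀ 0 0 ξ = d₀ * (K * (Delta nr - K) / (Delta nr * Delta nb)) := by
  have e := one_div_add_one_div_Delta h.hr
  have hDr := h.one_lt_Dr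
  have hDb := h.one_lt_Db
  have hρ := h.hρ
  rw [dF1_zero h.hr hρ, h2, h3, eq_sub_of_add_eq e]
  have e2 : ρ₀ * (1 - K) / (Delta nr * ρ₀) = (1 - K) / Delta nr := by field_simp
  rw [e2, h.hk]
  field_simp
  linear_combination d₀ * h.quad

lemma dF1_b {ξ : Fin 5 → ℝ} (h2 : ξ 2 = ρ₀) (h3 : ξ 3 = ρ₀ * (1 - K)) :
    dF1 nb ρ₀ d₀ 0 0 ξ = -(d₀ * (K * (K - Delta nb) / (Delta nr * Delta nb))) := by
  have e := one_div_add_one_div_Delta h.hb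
  have hDr := h.one_lt_Dr
  have hDb := h.one_lt_Db
  have hρ := h.hρ
  rw [dF1_zero h.hb hρ, h2, h3, eq_sub_of_add_eq e]
  have e2 : ρ₀ * (1 - K) / (Delta nb * ρ₀) = (1 - K) / Delta nb := by field_simp
  rw [e2, h.hk]
  field_simp
  linear_combination d₀ * h.quad

lemma neg_dF1_b_pos : 0 < d₀ * (K * (K - Delta nb) / (Delta nr * Delta nb)) := by
  have hDr := h.one_lt_Dr
  have hDb := h.one_lt_Db
  have := sub_pos.2 h.Db_lt_K
  have := h.hd
  have := h.K_pos
  positivity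

lemma inDomain_zero : InDomain nr nb ρ₀ d₀ 0 0 0 (initialVelocity nr nb ρ₀ d₀) := by
  refine ⟨⟨by linarith [Real.pi_pos], by linarith [Real.pi_pos]⟩, colorRegular_zero h.hr h.hρ,
    colorRegular_zero h.hb h.hρ, ?_⟩
  show dF1 nb ρ₀ d₀ 0 0 _ ≠ 0
  rw [h.dF1_b (by rw [h.velocity]; rfl) (by rw [h.velocity]; rfl)]
  exact (neg_neg_of_pos h.neg_dF1_b_pos).ne

lemma H_zero (ξ0 ξ1 : Fin 5 → ℝ) : H nr nb ρ₀ d₀ 0 0 0 ξ0 ξ1 =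
    ![(ξ0 2 + d₀ * (1 / nr + ξ0 3 / (Delta nr * ρ₀))) /
      (ξ1 2 + d₀ * (1 / nb + ξ1 3 / (Delta nb * ρ₀))), 0, ρ₀,
      ξ0 0 * (ξ1 3 + ρ₀ * (Delta nb - 1)) - ρ₀ * (Delta nr - 1), 0] := by
  have hDr := h.one_lt_Dr
  have hDb := h.one_lt_Db
  have hρ := h.hρ
  have hr := h.hr
  have hb := h.hb
  have e0 : h1 nr nb ρ₀ d₀ 0 0 0 ξ0 ξ1 = (ξ0 2 + d₀ * (1 / nr + ξ0 3 / (Delta nr * ρ₀))) /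
      (ξ1 2 + d₀ * (1 / nb + ξ1 3 / (Delta nb * ρ₀))) := by
    rw [h1, dF1_zero hr hρ, Pi.zero_apply, dF1_zero hb hρ]
  have e4 : h4 nr nb ρ₀ 0 0 0 ξ0 ξ1 =
      ξ0 0 * (ξ1 3 + ρ₀ * (Delta nb - 1)) - ρ₀ * (Delta nr - 1) := by
    simp only [h4, Pi.zero_apply, dmu_zero hb hρ, Lam_zero hr hρ, Lam_zero hb hρ, mu_zero,
      A_zero hr hρ, Real.cos_zero, mul_zero, zero_mul, sub_zero, add_zero]
    have : nr - 1 ≠ 0 := by linarith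
    have : nb - 1 ≠ 0 := by linarith
    simp only [Delta]
    field_simp
    ring
  have e5 : h5 ρ₀ 0 0 ξ0 = 0 := by simp [h5]
  rw [H, e0, e4, e5]
  simp

lemma H_fix : H nr nb ρ₀ d₀ 0 0 0 (initialVelocity nr nb ρ₀ d₀) (initialVelocity nr nb ρ₀ d₀) =
    initialVelocity nr nb ρ₀ d₀ := by
  have hv := h.velocity
  have hP2 : initialVelocity nr nb ρ₀ d₀ 2 = ρ₀ := by rw [hv]; rfl
  have hP3 : initialVelocity nr nb ρ₀ d₀ 3 = ρ₀ * (1 - K) := by rw [hv]; rfl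
  have hP0 : initialVelocity nr nb ρ₀ d₀ 0 = p := by rw [hv]; rfl
  have eb := h.dF1_b hP2 hP3
  have er := h.dF1_r hP2 hP3
  rw [dF1_zero h.hb h.hρ] at eb
  rw [dF1_zero h.hr h.hρ] at er
  rw [h.H_zero, eb, er, hP0, hP3, hv]
  have hDr := h.one_lt_Dr
  have hDb := h.one_lt_Db
  have := sub_pos.2 h.Db_lt_K
  have := h.hd
  have := h.K_pos
  congr
  · rw [div_eq_iff (neg_neg_of_pos h.neg_dF1_b_pos).ne]
    field_simp
    linear_combination h.p_eq
  · linear_combination -ρ₀ * h.p_eq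

/-- The two inequalities bound the row sums of h₁ and h₄ after rescaling. A large Θ suppresses the
dependence on ξ₃, while ω trades the dependence of h₁ on ξ₄ against that of h₄ on ξ₁. -/
lemma exists_weights : ∃ ω Θ lam : ℝ, 0 < ω ∧ 0 < Θ ∧ 0 ≤ lam ∧ lam < 1 ∧
    1 / Θ + d₀ / (Delta nr * ω) + |p| * (1 / Θ + d₀ / (Delta nb * ω)) ≤
      lam * (d₀ * (K * (K - Delta nb) / (Delta nr * Delta nb))) ∧
    ω * (K - Delta nb) + |p| ≤ lam := by
  have hDr := h.one_lt_Dr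
  have hDb := h.one_lt_Db
  have hKb := sub_pos.2 h.Db_lt_K
  have hd := h.hd
  have hK := h.K_pos
  have hM := h.neg_dF1_b_pos
  set M := d₀ * (K * (K - Delta nb) / (Delta nr * Delta nb)) with hMdef
  have hp := abs_nonneg p
  have hc := h.contraction
  generalize |p| = q at *
  have hlt : (Delta nb + q * Delta nr) / K < 1 - q := by
    rw [div_lt_iff₀ hK]
    linarith
  -- Here w = ω (K - Δ_b). The row of h₄ needs w + |p| < 1, that of h₁ needs w > (Δ_b + |p| Δ_r)/K,
  -- and `contraction` says precisely that the two are compatible.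
  obtain ⟨w, hw1, hw2⟩ := exists_between hlt
  have hw0 : 0 < w := lt_of_le_of_lt (by positivity) hw1
  set α := (Delta nb + q * Delta nr) / (w * K) with hα
  have hα1 : α < 1 := by
    rw [hα, div_lt_one (by positivity)]
    rwa [div_lt_iff₀ hK] at hw1
  have h1α := sub_pos.2 hα1
  -- In the row of h₁ the ξ₄ terms use up α M; Θ is chosen so that the ξ₃ terms add half of the
  -- remaining margin (1 - α) M.
  refine ⟨w / (K - Delta nb), 2 * (1 + q) / (M * (1 - α)), max ((1 + α) / 2) (w + q),
    by positivity, by positivity, le_max_of_le_right (by positivity), max_lt (by linarith)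
    (by linarith), ?_, ?_⟩
  · refine le_trans (le_of_eq ?_) (mul_le_mul_of_nonneg_right (le_max_left _ _) hM.le)
    have e1 : d₀ / (Delta nr * (w / (K - Delta nb))) + q * (d₀ / (Delta nb * (w / (K - Delta nb))))
        = α * M := by
      rw [hα, hMdef]
      field_simp
    have e2 : 1 / (2 * (1 + q) / (M * (1 - α))) * (1 + q) = M * (1 - α) / 2 := by
      field_simp
    linear_combination e1 + e2
  · rw [div_mul_cancel₀ _ hKb.ne']
    exact le_max_right _ _

end LensData

/-! ### The functional system in weighted coordinates -/

/-- The right-hand side of the functional system in the coordinates `w ζ`. -/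
def weightedH (nr nb ρ₀ d₀ : ℝ) (w : Fin 5 → ℝ)
    (y : (ℝ × (Fin 5 → ℝ) × (Fin 5 → ℝ)) × ((Fin 5 → ℝ) × (Fin 5 → ℝ))) : Fin 5 → ℝ :=
  w * H nr nb ρ₀ d₀ y.1.1 (w⁻¹ * y.1.2.1) (w⁻¹ * y.1.2.2) (w⁻¹ * y.2.1) (w⁻¹ * y.2.2)

namespace LensData

variable {nr nb ρ₀ d₀ k K p : ℝ} (h : LensData nr nb ρ₀ d₀ k K p)

include h

lemma hasStrictFDerivAt_weightedH {w : Fin 5 → ℝ} (hw : ∀ i, w i ≠ 0) :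
    ∃ H' : (ℝ × (Fin 5 → ℝ) × (Fin 5 → ℝ)) × ((Fin 5 → ℝ) × (Fin 5 → ℝ)) →L[ℝ] (Fin 5 → ℝ),
      HasStrictFDerivAt (weightedH nr nb ρ₀ d₀ w) H'
      (fdeBase (w * initialVelocity nr nb ρ₀ d₀)) := by
  have hww : ∀ v : Fin 5 → ℝ, w⁻¹ * (w * v) = v := fun v => by
    ext i; simp [hw i]
  have : ContDiffAt ℝ 1 (weightedH nr nb ρ₀ d₀ w)
      (fdeBase (w * initialVelocity nr nb ρ₀ d₀)) := by
    refine contDiffAt_pi.2 fun i => (contDiffAt_const (c := w i)).mul (contDiffAt_pi.1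
      (contDiffAt_H (X := (ℝ × (Fin 5 → ℝ) × (Fin 5 → ℝ)) × ((Fin 5 → ℝ) × (Fin 5 → ℝ)))
      (t := fun y => y.1.1) (ζ0 := fun y => w⁻¹ * y.1.2.1) (ζ1 := fun y => w⁻¹ * y.1.2.2)
      (ξ0 := fun y => w⁻¹ * y.2.1) (ξ1 := fun y => w⁻¹ * y.2.2) h.hr h.hb (by fun_prop)
      (by fun_prop) (by fun_prop)
      (by fun_prop) (by fun_prop) ?_) i)
    simp only [fdeBase, hww, mul_zero]
    exact h.inDomain_zero
  exact ⟨_, this.hasStrictFDerivAt one_ne_zero⟩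

/-- For maximum norms the operator norm is the largest absolute row sum. At the initial point h₂ and
h₃ contain no velocity and the velocity in h₅ is multiplied by tan 0, so only two rows remain. -/
lemma norm_fderiv_weightedH_le {ω Θ lam : ℝ} (hω : 0 < ω) (hΘ : 0 < Θ) (hlam : 0 ≤ lam)
    (h1 : 1 / Θ + d₀ / (Delta nr * ω) + |p| * (1 / Θ + d₀ / (Delta nb * ω)) ≤
      lam * (d₀ * (K * (K - Delta nb) / (Delta nr * Delta nb))))
    (h2 : ω * (K - Delta nb) + |p| ≤ lam)
    {H' : (ℝ × (Fin 5 → ℝ) × (Fin 5 → ℝ)) × ((Fin 5 → ℝ) × (Fin 5 → ℝ)) →L[ℝ] (Fin 5 → ℝ)}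
    (hH : HasStrictFDerivAt (weightedH nr nb ρ₀ d₀ ![1, 1, Θ, ω / ρ₀, 1]) H'
      (fdeBase (![1, 1, Θ, ω / ρ₀, 1] * initialVelocity nr nb ρ₀ d₀)))
    (u : (Fin 5 → ℝ) × (Fin 5 → ℝ)) : ‖H' (0, u)‖ ≤ lam * ‖u‖ := by
  set w : Fin 5 → ℝ := ![1, 1, Θ, ω / ρ₀, 1] with hw
  have hρ := h.hρ
  have hw0 : ∀ i, w i ≠ 0 := by
    intro i
    fin_cases i <;> simp [hw, hω.ne', hΘ.ne', hρ.ne']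
  obtain ⟨c, d⟩ := u
  -- Along (0, u) time and positions stay at 0, so the derivative can be read off the explicit form
  -- of H in `H_zero`.
  have hline : HasDerivAt (fun s : ℝ => weightedH nr nb ρ₀ d₀ w
      (fdeBase (w * initialVelocity nr nb ρ₀ d₀) + s • (0, (c, d)))) (H' (0, (c, d))) 0 :=
    hH.hasFDerivAt.hasLineDerivAt (0, (c, d))
  have hfun : (fun s : ℝ => weightedH nr nb ρ₀ d₀ w
      (fdeBase (w * initialVelocity nr nb ρ₀ d₀) + s • (0, (c, d)))) = fun s : ℝ =>
      w * H nr nb ρ₀ d₀ 0 0 0 (initialVelocity nr nb ρ₀ d₀ + s • (w⁻¹ * c))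
        (initialVelocity nr nb ρ₀ d₀ + s • (w⁻¹ * d)) := by
    funext s
    have : ∀ v b : Fin 5 → ℝ, w⁻¹ * (w * v + s • b) = v + s • (w⁻¹ * b) := fun v b => by
      ext i
      have := hw0 i
      simp
      field_simp
    simp [weightedH, fdeBase, this]
  rw [hfun, hasDerivAt_pi] at hline
  have hv := h.velocity
  have hP2 : initialVelocity nr nb ρ₀ d₀ 2 = ρ₀ := by rw [hv]; rfl
  have hP3 : initialVelocity nr nb ρ₀ d₀ 3 = ρ₀ * (1 - K) := by rw [hv]; rfl
  have hP0 : initialVelocity nr nb ρ₀ d₀ 0 = p := by rw [hv]; rfl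
  have eb := h.dF1_b hP2 hP3
  have er := h.dF1_r hP2 hP3
  rw [dF1_zero h.hb h.hρ] at eb
  rw [dF1_zero h.hr h.hρ] at er
  generalize initialVelocity nr nb ρ₀ d₀ = P at *
  have hM := h.neg_dF1_b_pos
  set M := d₀ * (K * (K - Delta nb) / (Delta nr * Delta nb)) with hMdef
  have hN : d₀ * (K * (Delta nr - K) / (Delta nr * Delta nb)) = -(p * M) := by
    rw [hMdef]
    linear_combination (d₀ * K / (Delta nr * Delta nb)) * h.p_eq
  rw [hN] at er
  simp only [h.H_zero] at hline
  set m := ‖(c, d)‖ with hm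
  have hm0 : 0 ≤ m := norm_nonneg _
  have hc : ∀ i, |c i| ≤ m := fun i => (norm_le_pi_norm c i).trans (norm_fst_le (c, d))
  have hd : ∀ i, |d i| ≤ m := fun i => (norm_le_pi_norm d i).trans (norm_snd_le (c, d))
  have hlm : 0 ≤ lam * m := by positivity
  have hDr := h.one_lt_Dr
  have hDb := h.one_lt_Db
  have hd₀ := h.hd
  rw [pi_norm_le_iff_of_nonneg hlm]
  have aff : ∀ x y : ℝ, HasDerivAt (fun s : ℝ => x + s * y) y 0 := fun x y => by
    simpa using ((hasDerivAt_id (0 : ℝ)).mul_const y).const_add x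
  intro i
  fin_cases i
  · have h0 := hline 0
    have e : HasDerivAt (fun s : ℝ => ((P 2 + s * (Θ⁻¹ * c 2)) + d₀ * (1 / nr +
        (P 3 + s * ((ω / ρ₀)⁻¹ * c 3)) / (Delta nr * ρ₀))) / ((P 2 + s * (Θ⁻¹ * d 2)) + d₀ *
        (1 / nb + (P 3 + s * ((ω / ρ₀)⁻¹ * d 3)) / (Delta nb * ρ₀))))
        ((1 / Θ * c 2 + d₀ / (Delta nr * ω) * c 3 - p * (1 / Θ * d 2 + d₀ / (Delta nb * ω) * d 3))
          / -M) 0 := by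
      have n1 := (aff (P 2) (Θ⁻¹ * c 2)).add
        ((((aff (P 3) ((ω / ρ₀)⁻¹ * c 3)).div_const (Delta nr * ρ₀)).const_add (1 / nr)).const_mul
          d₀)
      have n2 := (aff (P 2) (Θ⁻¹ * d 2)).add
        ((((aff (P 3) ((ω / ρ₀)⁻¹ * d 3)).div_const (Delta nb * ρ₀)).const_add (1 / nb)).const_mul
          d₀)
      refine (n1.div n2 ?_).congr_deriv ?_
      · simp only [Pi.add_apply, zero_mul, add_zero, eb]
        exact (neg_neg_of_pos hM).ne
      · simp only [Pi.add_apply, zero_mul, add_zero, eb, er]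
        field_simp
        ring
    have h0' : HasDerivAt _ _ (0 : ℝ) := h0
    have hval : H' (0, (c, d)) 0 = _ := HasDerivAt.unique h0 (e.congr_of_eventuallyEq
      (Filter.Eventually.of_forall fun s => by simp [hw]))
    show ‖H' (0, (c, d)) 0‖ ≤ _
    rw [hval, Real.norm_eq_abs, abs_div, abs_neg, abs_of_pos hM, div_le_iff₀ hM]
    have t1 : |1 / Θ * c 2| ≤ 1 / Θ * m := by
      rw [abs_mul, abs_of_pos (by positivity)]; gcongr; exact hc 2
    have t2 : |d₀ / (Delta nr * ω) * c 3| ≤ d₀ / (Delta nr * ω) * m := by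
      rw [abs_mul, abs_of_pos (by positivity)]; gcongr; exact hc 3
    have t3 : |1 / Θ * d 2| ≤ 1 / Θ * m := by
      rw [abs_mul, abs_of_pos (by positivity)]; gcongr; exact hd 2
    have t4 : |d₀ / (Delta nb * ω) * d 3| ≤ d₀ / (Delta nb * ω) * m := by
      rw [abs_mul, abs_of_pos (by positivity)]; gcongr; exact hd 3
    have t5 : |p * (1 / Θ * d 2 + d₀ / (Delta nb * ω) * d 3)| ≤
        |p| * (1 / Θ * m + d₀ / (Delta nb * ω) * m) := by
      rw [abs_mul]
      gcongr
      exact (abs_add_le _ _).trans (add_le_add t3 t4)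
    have t6 := mul_le_mul_of_nonneg_right h1 hm0
    refine (abs_sub _ _).trans ?_
    have := abs_add_le (1 / Θ * c 2) (d₀ / (Delta nr * ω) * c 3)
    linarith
  · have : H' (0, (c, d)) 1 = 0 := HasDerivAt.unique (hline 1)
      ((hasDerivAt_const (0 : ℝ) (0 : ℝ)).congr_of_eventuallyEq
        (Filter.Eventually.of_forall fun s => by simp [hw]))
    show ‖H' (0, (c, d)) 1‖ ≤ _
    rw [this, norm_zero]; exact hlm
  · have : H' (0, (c, d)) 2 = 0 := HasDerivAt.unique (hline 2)
      ((hasDerivAt_const (0 : ℝ) (Θ * ρ₀)).congr_of_eventuallyEq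
        (Filter.Eventually.of_forall fun s => by simp [hw]))
    show ‖H' (0, (c, d)) 2‖ ≤ _
    rw [this, norm_zero]; exact hlm
  · have e : HasDerivAt (fun s : ℝ => ω / ρ₀ * ((P 0 + s * c 0) *
        ((P 3 + s * ((ω / ρ₀)⁻¹ * d 3)) + ρ₀ * (Delta nb - 1)) - ρ₀ * (Delta nr - 1)))
        (ω * (Delta nb - K) * c 0 + p * d 3) 0 := by
      refine ((((aff (P 0) (c 0)).mul ((aff (P 3) ((ω / ρ₀)⁻¹ * d 3)).add_const
        (ρ₀ * (Delta nb - 1)))).sub_const (ρ₀ * (Delta nr - 1))).const_mul (ω / ρ₀)).congr_deriv ?_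
      simp only [zero_mul, add_zero, hP0, hP3]
      field_simp
      ring
    have hval : H' (0, (c, d)) 3 = _ := HasDerivAt.unique (hline 3) (e.congr_of_eventuallyEq
      (Filter.Eventually.of_forall fun s => by simp [hw]))
    show ‖H' (0, (c, d)) 3‖ ≤ _
    rw [hval, Real.norm_eq_abs]
    have hKb := sub_pos.2 h.Db_lt_K
    have t1 : |ω * (Delta nb - K) * c 0| ≤ ω * (K - Delta nb) * m := by
      rw [abs_mul, abs_mul, abs_of_pos hω, abs_sub_comm, abs_of_pos hKb]
      gcongr
      exact hc 0
    have t2 : |p * d 3| ≤ |p| * m := by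
      rw [abs_mul]; gcongr; exact hd 3
    have t3 := mul_le_mul_of_nonneg_right h2 hm0
    refine (abs_add_le _ _).trans ?_
    linarith
  · have : H' (0, (c, d)) 4 = 0 := HasDerivAt.unique (hline 4)
      ((hasDerivAt_const (0 : ℝ) (0 : ℝ)).congr_of_eventuallyEq
        (Filter.Eventually.of_forall fun s => by simp [hw]))
    show ‖H' (0, (c, d)) 4‖ ≤ _
    rw [this, norm_zero]; exact hlm

end LensData

/-! ### Local existence and uniqueness for the functional system. -/

open Filter Topology

lemma derivWithin_Icc_eq {E : Type*} [NormedAddCommGroup E] [NormedSpace ℝ E] {Z : ℝ → E} {Y : E}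
    {δ t : ℝ} (hδ : 0 < δ) (ht : t ∈ Icc (-δ) δ) (h : HasDerivWithinAt Z Y (Icc (-δ) δ) t) :
    derivWithin Z (Icc (-δ) δ) t = Y :=
  h.derivWithin (uniqueDiffOn_Icc (by linarith) t ht)

lemma contDiffOn_one_Icc_iff {E : Type*} [NormedAddCommGroup E] [NormedSpace ℝ E] {Z : ℝ → E}
    {δ : ℝ} (hδ : 0 < δ) : ContDiffOn ℝ 1 Z (Icc (-δ) δ) ↔
      DifferentiableOn ℝ Z (Icc (-δ) δ) ∧
        ContinuousOn (derivWithin Z (Icc (-δ) δ)) (Icc (-δ) δ) :=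
  contDiffOn_one_iff_derivWithin (uniqueDiffOn_Icc (by linarith))

/-- A solution of the functional system, with its derivative, that is regular on the whole line
and solves the system on all sufficiently short intervals. -/
structure IsGermSolution (nr nb ρ₀ d₀ δ₀ : ℝ) (Z Y : ℝ → Fin 5 → ℝ) : Prop where
  deriv : ∀ t, HasDerivAt Z (Y t) t
  cont : Continuous Y
  init : Z 0 = 0
  init_deriv : Y 0 = initialVelocity nr nb ρ₀ d₀
  sol : ∀ δ, 0 < δ → δ ≤ δ₀ → IsSystemSolution nr nb ρ₀ d₀ δ Z

/-- The points at which the formulas make sense form a neighbourhood of the initial data. -/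
lemma LensData.eventually_inDomain {nr nb ρ₀ d₀ k K p : ℝ} (h : LensData nr nb ρ₀ d₀ k K p)
    {ζ0 ζ1 ξ1 : ℝ → Fin 5 → ℝ} (h0 : ContinuousAt ζ0 0) (h1 : ContinuousAt ζ1 0)
    (hξ : ContinuousAt ξ1 0) (hz0 : ζ0 0 = 0) (hz1 : ζ1 0 = 0)
    (hzξ : ξ1 0 = initialVelocity nr nb ρ₀ d₀) :
    ∀ᶠ t in 𝓝 0, InDomain nr nb ρ₀ d₀ t (ζ0 t) (ζ1 t) (ξ1 t) := by
  obtain ⟨htI, hr0, hb1, hF⟩ := h.inDomain_zero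
  have reg : ∀ (n : ℝ) (s : ℝ → ℝ) (ζ : ℝ → Fin 5 → ℝ), 1 < n → ContinuousAt s 0 →
      ContinuousAt ζ 0 → s 0 = 0 → ζ 0 = 0 → ∀ᶠ t in 𝓝 0, ColorRegular n ρ₀ (s t) (ζ t) := by
    intro n s ζ hn hs hζ hs0 hζ0
    have hR : ColorRegular n ρ₀ (s 0) (ζ 0) := by rw [hs0, hζ0]; exact colorRegular_zero hn h.hρ
    have hi := continuousAt_pi.1 hζ
    have hτ : ContinuousAt (fun t => tau n ρ₀ (s t) (ζ t)) 0 := by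
      have := (contDiffAt_tau (k := 0) (t := fun y : ℝ × (Fin 5 → ℝ) => y.1)
        (ζ := fun y => y.2) (y := (s 0, ζ 0)) hn (by fun_prop) (by fun_prop) hR.1).continuousAt
      exact this.comp (f := fun t => (s t, ζ t)) (hs.prodMk hζ)
    refine (continuousAt_const.eventually_lt ((((hi 1).sub continuousAt_const).pow 2).add
      ((hi 2).pow 2)) hR.1).and (((continuousAt_const.sub hτ).eventually_ne hR.2.1).and
      (continuousAt_const.eventually_lt (continuousAt_const.sub (continuousAt_const.mul hτ))
        hR.2.2))
  have hFc : ContinuousAt (fun t => dF1 nb ρ₀ d₀ (ζ0 t 0) (ζ1 t) (ξ1 t)) 0 := by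
    have := (contDiffAt_dF1 (k := 0) (d₀ := d₀)
      (t := fun y : ℝ × (Fin 5 → ℝ) × (Fin 5 → ℝ) => y.1)
      (ζ := fun y => y.2.1) (ξ := fun y => y.2.2) (y := (ζ0 0 0, ζ1 0, ξ1 0)) h.hb (by fun_prop)
      (by fun_prop) (by fun_prop) (by rw [hz1]; exact hb1.1)
      (by rw [hz0, hz1]; exact hb1.2.1)).continuousAt
    exact this.comp (f := fun t => (ζ0 t 0, ζ1 t, ξ1 t))
      ((continuousAt_pi.1 h0 0).prodMk (h1.prodMk hξ))
  exact (isOpen_Ioo.eventually_mem htI).and ((reg nr id ζ0 h.hr continuousAt_id h0 rfl hz0).and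
    ((reg nb (fun t => ζ0 t 0) ζ1 h.hb (continuousAt_pi.1 h0 0) h1 (by simp [hz0]) hz1).and
      (hFc.eventually_ne (by rw [hz0, hz1, hzξ]; exact hF))))

/-- Existence and uniqueness for the functional system. -/
theorem LensData.exists_germSolution {nr nb ρ₀ d₀ k K p : ℝ} (h : LensData nr nb ρ₀ d₀ k K p) :
    ∃ δ₀ > 0, δ₀ < Real.pi / 2 ∧ ∃ Z Y, IsGermSolution nr nb ρ₀ d₀ δ₀ Z Y ∧
      ∀ δ, 0 < δ → δ ≤ δ₀ → ∀ W, IsSystemSolution nr nb ρ₀ d₀ δ W → EqOn W Z (Icc (-δ) δ) := by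
  obtain ⟨ω, Θ, lam, hω, hΘ, hlam0, hlam1, hw1, hw2⟩ := h.exists_weights
  set w : Fin 5 → ℝ := ![1, 1, Θ, ω / ρ₀, 1] with hw
  have hρ := h.hρ
  have hw0 : ∀ i, w i ≠ 0 := by
    intro i
    fin_cases i <;> simp [hw, hω.ne', hΘ.ne', hρ.ne']
  have hww : ∀ v : Fin 5 → ℝ, w⁻¹ * (w * v) = v := fun v => by
    ext i; simp [hw0 i]
  obtain ⟨H', hH'⟩ := h.hasStrictFDerivAt_weightedH hw0
  have hnorm := h.norm_fderiv_weightedH_le hω hΘ hlam0 hw1 hw2 hH'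
  obtain ⟨r, hr, hlip⟩ := exists_lipschitz_of_hasStrictFDerivAt hH' hnorm
    (show lam < (lam + 1) / 2 by linarith)
  have hL : 0 ≤ ‖H'‖ + ((lam + 1) / 2 - lam) := add_nonneg (norm_nonneg _) (by linarith)
  set π : (Fin 5 → ℝ) →L[ℝ] ℝ := ContinuousLinearMap.proj 0 with hπ
  -- The first weight is 1, so the deviated argument is unaffected by the rescaling.
  have hπw : ∀ v : Fin 5 → ℝ, π (w * v) = v 0 := fun v => by simp [hπ, hw]
  have hπw' : ∀ v : Fin 5 → ℝ, (w⁻¹ * v) 0 = π v := fun v => by simp [hπ, hw]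
  have hfix : weightedH nr nb ρ₀ d₀ w (fdeBase (w * initialVelocity nr nb ρ₀ d₀)) =
      w * initialVelocity nr nb ρ₀ d₀ := by
    simp only [weightedH, fdeBase, hww, mul_zero]
    rw [h.H_fix]
  have hP0 : |π (w * initialVelocity nr nb ρ₀ d₀)| < 1 := by
    rw [hπw, h.velocity]
    exact h.abs_p_lt
  obtain ⟨δ₁, hδ₁, M, hM, Z, Y, hsol, hZd, hYlip, -⟩ := exists_fdeSolution hr hL
    (by linarith) (by linarith) hP0 hfix hlip
  obtain ⟨δ₂, hδ₂, hδ₂₁, huniq⟩ := fdeSolution_unique hr hL (by linarith) (by linarith) hlip hδ₁ hM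
    hsol hYlip
  have hYc : Continuous Y := by
    refine (LipschitzWith.of_dist_le_mul (K := ⟨M, hM⟩) fun s t => ?_).continuous
    rw [dist_eq_norm, Real.dist_eq]
    exact hYlip s t
  have hd : ∀ t, HasDerivAt (fun s => w⁻¹ * Z s) (w⁻¹ * Y t) t := fun t =>
    hasDerivAt_pi.2 fun i => (hasDerivAt_pi.1 (hZd t) i).const_mul (w⁻¹ i)
  have hcont : Continuous fun s => w⁻¹ * Z s :=
    continuous_iff_continuousAt.2 fun t => (hd t).continuousAt
  have hcontY : Continuous fun s => w⁻¹ * Y s := continuous_const.mul hYc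
  have hZ0 : w⁻¹ * Z 0 = 0 := by rw [hsol.init, mul_zero]
  have hY0 : w⁻¹ * Y 0 = initialVelocity nr nb ρ₀ d₀ := by rw [hsol.init_deriv, hww]
  have hc0 : Continuous fun s => (w⁻¹ * Z s) 0 := (continuous_apply 0).comp hcont
  have hzz : (w⁻¹ * Z 0) 0 = 0 := by rw [hZ0]; rfl
  have hdom := h.eventually_inDomain (ζ0 := fun s => w⁻¹ * Z s)
    (ζ1 := fun s => w⁻¹ * Z ((w⁻¹ * Z s) 0)) (ξ1 := fun s => w⁻¹ * Y ((w⁻¹ * Z s) 0))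
    hcont.continuousAt (hcont.comp hc0).continuousAt (hcontY.comp hc0).continuousAt hZ0
    (by simp only [hzz, hZ0]) (by simp only [hzz, hY0])
  obtain ⟨ε, hε, hdom⟩ := Metric.eventually_nhds_iff.1 hdom
  refine ⟨min δ₂ (min (ε / 2) 1), by positivity, ?_, fun s => w⁻¹ * Z s, fun s => w⁻¹ * Y s,
    ⟨hd, hcontY, hZ0, hY0, fun δ hδ hle => ?_⟩, fun δ hδ hle W hW => ?_⟩
  · exact ((min_le_right _ _).trans (min_le_right _ _)).trans_lt
      (by linarith [Real.pi_gt_three])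
  · simp only [le_min_iff] at hle
    have hs := hsol.mono (hle.1.trans hδ₂₁)
    have hdw : ∀ t ∈ Icc (-δ) δ, derivWithin (fun s => w⁻¹ * Z s) (Icc (-δ) δ) t = w⁻¹ * Y t :=
      fun t ht => derivWithin_Icc_eq hδ ht (hd t).hasDerivWithinAt
    have hmem : ∀ t ∈ Icc (-δ) δ, (w⁻¹ * Z t) 0 ∈ Icc (-δ) δ := fun t ht => by
      rw [hπw']; exact abs_le_mem_Icc ht (hs.abs_le t ht)
    refine ⟨(contDiffOn_one_Icc_iff hδ).2
      ⟨fun t _ => (hd t).differentiableAt.differentiableWithinAt,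
        hcontY.continuousOn.congr hdw⟩, hZ0, ?_, fun t ht => ?_, fun t ht => ?_, fun t ht => ?_⟩
    · rw [hdw 0 (by constructor <;> linarith), hY0]
    · rw [hπw']; exact hs.abs_le t ht
    · rw [hdw _ (hmem t ht)]
      refine hdom ?_
      rw [dist_zero_right, Real.norm_eq_abs]
      linarith [abs_le.2 ht]
    · rw [hdw _ (hmem t ht), hdw t ht]
      have e := congrArg (fun v => w⁻¹ * v) (hs.eqn t ht)
      simp only [weightedH, hww, fdeArg] at e
      simpa only [hπw'] using e
  · simp only [le_min_iff] at hle
    have hWd := (contDiffOn_one_Icc_iff hδ).1 hW.contDiffOn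
    have hWd' : ∀ t ∈ Icc (-δ) δ, HasDerivWithinAt W (derivWithin W (Icc (-δ) δ) t)
      (Icc (-δ) δ) t := fun t ht => (hWd.1 t ht).hasDerivWithinAt
    have hfde : IsFDESolution (weightedH nr nb ρ₀ d₀ w) π (w * initialVelocity nr nb ρ₀ d₀) δ
        (fun s => w * W s) (fun s => w * derivWithin W (Icc (-δ) δ) s) := by
      refine ⟨fun t ht => hasDerivWithinAt_pi.2 fun i =>
        (hasDerivWithinAt_pi.1 (hWd' t ht) i).const_mul (w i), continuousOn_const.mul hWd.2,
        by rw [hW.init, mul_zero], by rw [hW.init_deriv], fun t ht => ?_, fun t ht => ?_⟩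
      · rw [hπw]; exact hW.abs_le t ht
      · simp only [weightedH, fdeArg, hww, hπw]
        rw [← hW.eqn t ht]
    intro t ht
    show W t = w⁻¹ * Z t
    rw [← huniq δ hδ hle.1 _ _ hfde ht, hww]

/-! ### Curves of data coming from a lower face -/

lemma hasDerivWithinAt_plane {γ : ℝ → Plane} {γ' : Plane} {s : Set ℝ} {t : ℝ} :
    HasDerivWithinAt γ γ' s t ↔ ∀ i, HasDerivWithinAt (fun u => γ u i) (γ' i) s t := by
  rw [hasDerivWithinAt_iff_hasFDerivWithinAt, hasFDerivWithinAt_euclidean]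
  refine forall_congr' fun i => ?_
  rw [hasDerivWithinAt_iff_hasFDerivWithinAt]
  refine iff_of_eq (congrArg (fun L => HasFDerivWithinAt (fun u => γ u i) L s t) ?_)
  ext
  simp

/-- The vector `ζ` attached to a lower face with `ρ(t) = r` and `ρ'(t) = w`. -/
def lensVec (ρ₀ z t r w : ℝ) : Fin 5 → ℝ :=
  ![z, ρ₀ - r * Real.cos t, r * Real.sin t, -(w * Real.cos t - r * Real.sin t),
    w * Real.sin t + r * Real.cos t - ρ₀]

section LensVec

variable {n ρ₀ d₀ z t r w : ℝ}

@[simp] lemma lensVec_1 : lensVec ρ₀ z t r w 1 = ρ₀ - r * Real.cos t := rfl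
@[simp] lemma lensVec_2 : lensVec ρ₀ z t r w 2 = r * Real.sin t := rfl
@[simp] lemma lensVec_3 :
    lensVec ρ₀ z t r w 3 = -(w * Real.cos t - r * Real.sin t) := rfl
@[simp] lemma lensVec_4 :
    lensVec ρ₀ z t r w 4 = w * Real.sin t + r * Real.cos t - ρ₀ := rfl

lemma lensVec_radicand :
    (lensVec ρ₀ z t r w 1 - ρ₀) ^ 2 + lensVec ρ₀ z t r w 2 ^ 2 = r ^ 2 := by
  simp only [lensVec_1, lensVec_2]
  linear_combination r ^ 2 * Real.sin_sq_add_cos_sq t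

lemma lensVec_radicand_pos (hr : 0 < r) :
    0 < (lensVec ρ₀ z t r w 1 - ρ₀) ^ 2 + lensVec ρ₀ z t r w 2 ^ 2 := by
  rw [lensVec_radicand]; positivity

lemma rad_lensVec (hr : 0 < r) : rad ρ₀ (lensVec ρ₀ z t r w) = r := by
  rw [rad, lensVec_radicand, Real.sqrt_sq hr.le]

lemma root_lensVec :
    root n ρ₀ (lensVec ρ₀ z t r w) = √(r ^ 2 + (n ^ 2 - 1) * (w ^ 2 + r ^ 2)) := by
  rw [root, lensVec_radicand]
  simp only [lensVec_3, lensVec_4]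
  congr 1
  linear_combination (n ^ 2 - 1) * (w ^ 2 + r ^ 2) * Real.sin_sq_add_cos_sq t

/-- Rationalization: the square of `root` exceeds r² by (n² - 1)(w² + r²). The right-hand side is,
up to the length of the normal, the function Φ of Snell's law. -/
lemma A_lensVec_mul (hn : 1 < n) (hr : 0 < r) : A n ρ₀ (lensVec ρ₀ z t r w) * (w ^ 2 + r ^ 2) =
    r - root n ρ₀ (lensVec ρ₀ z t r w) := by
  have h := lensVec_radicand_pos (ρ₀ := ρ₀) (z := z) (t := t) (w := w) hr
  have hS := root_pos hn h
  have hS2 : root n ρ₀ (lensVec ρ₀ z t r w) ^ 2 = r ^ 2 + (n ^ 2 - 1) * (w ^ 2 + r ^ 2) := by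
    rw [root_lensVec, Real.sq_sqrt]
    have : 0 ≤ (n ^ 2 - 1) * (w ^ 2 + r ^ 2) := mul_nonneg (by nlinarith) (by positivity)
    positivity
  rw [A, rad_lensVec hr]
  field_simp
  linear_combination hS2

/-- If N is the normal of length √(w² + r²), so that x·N = r, the left-hand side is |x - 𝒜 N|². It
being n² makes the refracted direction a unit vector. -/
lemma A_lensVec_quad (hn : 1 < n) (hr : 0 < r) :
    A n ρ₀ (lensVec ρ₀ z t r w) ^ 2 * (w ^ 2 + r ^ 2) -
      2 * A n ρ₀ (lensVec ρ₀ z t r w) * r + 1 = n ^ 2 := by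
  have h1 := A_lensVec_mul (ρ₀ := ρ₀) (z := z) (t := t) (w := w) hn hr
  have hS2 : root n ρ₀ (lensVec ρ₀ z t r w) ^ 2 = r ^ 2 + (n ^ 2 - 1) * (w ^ 2 + r ^ 2) := by
    rw [root_lensVec, Real.sq_sqrt]
    have : 0 ≤ (n ^ 2 - 1) * (w ^ 2 + r ^ 2) := mul_nonneg (by nlinarith) (by positivity)
    positivity
  have hN : w ^ 2 + r ^ 2 ≠ 0 := by positivity
  apply mul_right_cancel₀ hN
  generalize A n ρ₀ (lensVec ρ₀ z t r w) = a at *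
  generalize root n ρ₀ (lensVec ρ₀ z t r w) = S at *
  have hS : S = r - a * (w ^ 2 + r ^ 2) := by linarith
  rw [hS] at hS2
  linear_combination hS2

lemma mu_lensVec : mu n ρ₀ t (lensVec ρ₀ z t r w) =
    1 / n * (Real.sin t - A n ρ₀ (lensVec ρ₀ z t r w) *
      (r * Real.sin t - w * Real.cos t)) := by
  rw [mu, lensVec_3]; ring

lemma tau_lensVec : tau n ρ₀ t (lensVec ρ₀ z t r w) =
    1 / n * (Real.cos t - A n ρ₀ (lensVec ρ₀ z t r w) *
      (r * Real.cos t + w * Real.sin t)) := by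
  rw [tau, lensVec_4]; ring

lemma mu_sq_add_tau_sq (hn : 1 < n) (hr : 0 < r) :
    mu n ρ₀ t (lensVec ρ₀ z t r w) ^ 2 + tau n ρ₀ t (lensVec ρ₀ z t r w) ^ 2 = 1 := by
  have h := A_lensVec_quad (ρ₀ := ρ₀) (z := z) (t := t) (w := w) hn hr
  rw [mu_lensVec, tau_lensVec]
  generalize A n ρ₀ (lensVec ρ₀ z t r w) = a at *
  have := Real.sin_sq_add_cos_sq t
  have hn0 : n ≠ 0 := by linarith
  field_simp
  linear_combination h + (a ^ 2 * (w ^ 2 + r ^ 2) - 2 * a * r + 1) * this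

lemma tau_lensVec_le_one (hn : 1 < n) (hr : 0 < r) : tau n ρ₀ t (lensVec ρ₀ z t r w) ≤ 1 := by
  nlinarith [mu_sq_add_tau_sq (ρ₀ := ρ₀) (z := z) (t := t) (w := w) hn hr,
    sq_nonneg (mu n ρ₀ t (lensVec ρ₀ z t r w))]

/-- A unit direction has τ ≤ 1, whence n - τ > 0, and the radicand is at least (1 - 1/n)². -/
lemma colorRegular_lensVec (hn : 1 < n) (hr : 0 < r) :
    ColorRegular n ρ₀ t (lensVec ρ₀ z t r w) := by
  have h := tau_lensVec_le_one (ρ₀ := ρ₀) (z := z) (t := t) (w := w) hn hr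
  refine ⟨lensVec_radicand_pos hr, by linarith, ?_⟩
  have hn0 : n ≠ 0 := by linarith
  have h1 : 0 < (1 - 1 / n) ^ 2 := by
    have : n - 1 ≠ 0 := by linarith
    have e : 1 - 1 / n = (n - 1) / n := by field_simp
    rw [e]; positivity
  have h2 : 2 / n * tau n ρ₀ t (lensVec ρ₀ z t r w) ≤ 2 / n * 1 :=
    mul_le_mul_of_nonneg_left h (by positivity)
  have h3 : (1 - 1 / n) ^ 2 = 1 + 1 / n ^ 2 - 2 / n * 1 := by ring
  linarith

/-- `n m - x` is orthogonal to the lower face. -/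
lemma mul_mu_add_mul_tau (hn : 1 < n) :
    n * ((w * Real.sin t + r * Real.cos t) * mu n ρ₀ t (lensVec ρ₀ z t r w) +
      (w * Real.cos t - r * Real.sin t) * tau n ρ₀ t (lensVec ρ₀ z t r w)) = w := by
  rw [mu_lensVec, tau_lensVec]
  have := Real.sin_sq_add_cos_sq t
  have hn0 : n ≠ 0 := by linarith
  generalize A n ρ₀ (lensVec ρ₀ z t r w) = a at *
  field_simp
  linear_combination w * this

end LensVec

/-- `Z`, with derivative `Y`, is the curve of data of the lower face `ρ` on `[-δ, δ]`. -/
structure IsLensCurve (ρ₀ δ : ℝ) (ρ w : ℝ → ℝ) (Z Y : ℝ → Fin 5 → ℝ) : Prop where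
  pos : 0 < δ
  deriv : ∀ t ∈ Icc (-δ) δ, HasDerivWithinAt Z (Y t) (Icc (-δ) δ) t
  rho_deriv : ∀ t ∈ Icc (-δ) δ, HasDerivWithinAt ρ (w t) (Icc (-δ) δ) t
  rho_pos : ∀ t ∈ Icc (-δ) δ, 0 < ρ t
  eq : ∀ t ∈ Icc (-δ) δ, Z t = lensVec ρ₀ (Z t 0) t (ρ t) (w t)

/-- The derivative of the vertical component of the upper face. -/
def dF2 (n ρ₀ d₀ t : ℝ) (ζ ξ : Fin 5 → ℝ) : ℝ :=
  -ξ 1 + (dD n ρ₀ d₀ t ζ ξ * tau n ρ₀ t ζ + D n ρ₀ d₀ t ζ * dtau n ρ₀ t ζ ξ)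

namespace IsLensCurve

variable {n ρ₀ δ C : ℝ} {ρ w : ℝ → ℝ} {Z Y : ℝ → Fin 5 → ℝ} (h : IsLensCurve ρ₀ δ ρ w Z Y) {t : ℝ}
  (ht : t ∈ Icc (-δ) δ)

include h ht

lemma regular (hn : 1 < n) : ColorRegular n ρ₀ t (Z t) := by
  rw [h.eq t ht]; exact colorRegular_lensVec hn (h.rho_pos t ht)

lemma norm_m (hn : 1 < n) : mu n ρ₀ t (Z t) ^ 2 + tau n ρ₀ t (Z t) ^ 2 = 1 := by
  rw [h.eq t ht]; exact mu_sq_add_tau_sq hn (h.rho_pos t ht)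

lemma Z1 : Z t 1 = ρ₀ - ρ t * Real.cos t := by rw [h.eq t ht]; rfl

lemma Z2 : Z t 2 = ρ t * Real.sin t := by rw [h.eq t ht]; rfl

lemma tangent_eq : tangent (Icc (-δ) δ) (fun s => ρ s • x s) t =
    !₂[w t * Real.sin t + ρ t * Real.cos t, w t * Real.cos t - ρ t * Real.sin t] := by
  refine derivWithin_Icc_eq h.pos ht (hasDerivWithinAt_plane.2 fun i => ?_)
  have hρ := h.rho_deriv t ht
  fin_cases i
  · have : HasDerivWithinAt (fun u => ρ u * Real.sin u) _ (Icc (-δ) δ) t :=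
      hρ.mul (Real.hasDerivAt_sin t).hasDerivWithinAt
    simpa [x] using this
  · have : HasDerivWithinAt (fun u => ρ u * Real.cos u) _ (Icc (-δ) δ) t :=
      hρ.mul (Real.hasDerivAt_cos t).hasDerivWithinAt
    simpa [x, sub_eq_add_neg] using this

lemma m_eq (hn : 1 < n) : m n (Icc (-δ) δ) ρ t = !₂[mu n ρ₀ t (Z t), tau n ρ₀ t (Z t)] := by
  have hr := h.rho_pos t ht
  have hn0 : n ≠ 0 := by linarith
  have hν : nu (Icc (-δ) δ) ρ t = (√(w t ^ 2 + ρ t ^ 2))⁻¹ •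
      !₂[-(w t * Real.cos t - ρ t * Real.sin t), w t * Real.sin t + ρ t * Real.cos t] := by
    rw [nu, h.tangent_eq ht, EuclideanSpace.norm_eq]
    simp only [Fin.sum_univ_two, Real.norm_eq_abs, sq_abs]
    congr 3
    simp
    linear_combination (w t ^ 2 + ρ t ^ 2) * Real.sin_sq_add_cos_sq t
  have hN : 0 < w t ^ 2 + ρ t ^ 2 := by positivity
  have hN0 := Real.sqrt_pos.2 hN
  have hN2 := Real.sq_sqrt hN.le
  have hA := A_lensVec_mul (ρ₀ := ρ₀) (z := Z t 0) (t := t) (w := w t) hn hr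
  rw [root_lensVec] at hA
  have hin : inner ℝ (x t) (nu (Icc (-δ) δ) ρ t) = ρ t / √(w t ^ 2 + ρ t ^ 2) := by
    rw [hν]
    simp only [PiLp.inner_apply, x, Fin.sum_univ_two]
    simp
    field_simp
    linear_combination ρ t * Real.sin_sq_add_cos_sq t
  have hΦ : Phi n (inner ℝ (x t) (nu (Icc (-δ) δ) ρ t)) * (√(w t ^ 2 + ρ t ^ 2))⁻¹ =
      A n ρ₀ (lensVec ρ₀ (Z t 0) t (ρ t) (w t)) := by
    rw [hin, Phi]
    have e : n ^ 2 - 1 + (ρ t / √(w t ^ 2 + ρ t ^ 2)) ^ 2 =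
        (ρ t ^ 2 + (n ^ 2 - 1) * (w t ^ 2 + ρ t ^ 2)) / (w t ^ 2 + ρ t ^ 2) := by
      rw [div_pow, hN2]
      field_simp
      ring
    rw [e, Real.sqrt_div' _ hN.le]
    apply mul_right_cancel₀ hN.ne'
    rw [hA]
    generalize √(ρ t ^ 2 + (n ^ 2 - 1) * (w t ^ 2 + ρ t ^ 2)) = S
    rw [← hN2, Real.sqrt_sq hN0.le]
    field_simp
  rw [h.eq t ht, m]
  ext i
  fin_cases i
  · rw [hν] at hΦ ⊢
    simp only [mu_lensVec, ← hΦ]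
    simp [x]
    left
    ring
  · rw [hν] at hΦ ⊢
    simp only [tau_lensVec, ← hΦ]
    simp [x]
    left
    ring

lemma inner_e_m (hn : 1 < n) : inner ℝ e (m n (Icc (-δ) δ) ρ t) = tau n ρ₀ t (Z t) := by
  rw [h.m_eq ht hn]
  simp [PiLp.inner_apply, e, Fin.sum_univ_two]

lemma d_eq (hn : 1 < n) : d n C (Icc (-δ) δ) ρ t = D n ρ₀ (C / (n - 1)) t (Z t) := by
  have hn1 : n - 1 ≠ 0 := by linarith
  rw [d, h.inner_e_m ht hn, D, mul_div_cancel₀ _ hn1]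
  congr 1
  have : rad ρ₀ (Z t) = ρ t := by rw [h.eq t ht, rad_lensVec (h.rho_pos t ht)]
  rw [this, h.Z1 ht]
  simp [PiLp.inner_apply, e, x, Fin.sum_univ_two]
  ring

lemma f_eq (hn : 1 < n) : f n C (Icc (-δ) δ) ρ t =
    !₂[Z t 2 + D n ρ₀ (C / (n - 1)) t (Z t) * mu n ρ₀ t (Z t),
      ρ₀ - Z t 1 + D n ρ₀ (C / (n - 1)) t (Z t) * tau n ρ₀ t (Z t)] := by
  rw [f, h.d_eq ht hn, h.m_eq ht hn, h.Z1 ht, h.Z2 ht]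
  ext i
  fin_cases i <;> simp [x]

lemma hasDerivWithinAt_f (hn : 1 < n) : HasDerivWithinAt (f n C (Icc (-δ) δ) ρ)
    !₂[dF1 n ρ₀ (C / (n - 1)) t (Z t) (Y t), dF2 n ρ₀ (C / (n - 1)) t (Z t) (Y t)]
    (Icc (-δ) δ) t := by
  have hreg := h.regular ht hn
  refine HasDerivWithinAt.congr (f := fun t => !₂[Z t 2 + D n ρ₀ (C / (n - 1)) t (Z t) *
    mu n ρ₀ t (Z t), ρ₀ - Z t 1 + D n ρ₀ (C / (n - 1)) t (Z t) * tau n ρ₀ t (Z t)])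
    (hasDerivWithinAt_plane.2 fun i => ?_) (fun s hs => h.f_eq hs hn) (h.f_eq ht hn)
  have hZ := h.deriv t ht
  fin_cases i
  · exact hasDerivWithinAt_F1 hn hZ hreg.1 hreg.2.1
  · exact ((hasDerivWithinAt_pi.1 hZ 1).const_sub ρ₀).add
      ((hasDerivWithinAt_D hn hZ hreg.1 hreg.2.1).mul (hasDerivWithinAt_tau hn hZ hreg.1))

lemma tangent_f (hn : 1 < n) : tangent (Icc (-δ) δ) (f n C (Icc (-δ) δ) ρ) t =
    !₂[dF1 n ρ₀ (C / (n - 1)) t (Z t) (Y t), dF2 n ρ₀ (C / (n - 1)) t (Z t) (Y t)] :=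
  derivWithin_Icc_eq h.pos ht (h.hasDerivWithinAt_f ht hn)

omit ht in
lemma zero_mem : (0 : ℝ) ∈ Icc (-δ) δ := ⟨by linarith [h.pos], h.pos.le⟩

lemma deriv_Z1 : Y t 1 = Z t 3 := by
  have h1 := (hasDerivWithinAt_pi.1 (h.deriv t ht) 1)
  have h2 := ((h.rho_deriv t ht).mul (Real.hasDerivAt_cos t).hasDerivWithinAt).const_sub ρ₀
  have h3 := (uniqueDiffOn_Icc (by linarith [h.pos]) t ht).eq_deriv _ h1
    (h2.congr (fun s hs => h.Z1 hs) (h.Z1 ht))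
  rw [h3, h.eq t ht, lensVec_3]
  ring

lemma deriv_Z2 : Y t 2 = Z t 4 + ρ₀ := by
  have h1 := (hasDerivWithinAt_pi.1 (h.deriv t ht) 2)
  have h2 := (h.rho_deriv t ht).mul (Real.hasDerivAt_sin t).hasDerivWithinAt
  have h3 := (uniqueDiffOn_Icc (by linarith [h.pos]) t ht).eq_deriv _ h1
    (h2.congr (fun s hs => h.Z2 hs) (h.Z2 ht))
  rw [h3, h.eq t ht, lensVec_4]
  ring

/-- The upper face is orthogonal to `n m - e`. -/
lemma tangent_f_orthogonal (hn : 1 < n) (d₀ : ℝ) :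
    dF1 n ρ₀ d₀ t (Z t) (Y t) * (n * mu n ρ₀ t (Z t)) +
      dF2 n ρ₀ d₀ t (Z t) (Y t) * (n * tau n ρ₀ t (Z t) - 1) = 0 := by
  have hreg := h.regular ht hn
  have hZ := h.deriv t ht
  have hud := uniqueDiffOn_Icc (show -δ < δ by linarith [h.pos]) t ht
  -- The derivative of |m|² = 1.
  have hm : 2 * (mu n ρ₀ t (Z t) * dmu n ρ₀ t (Z t) (Y t) +
      tau n ρ₀ t (Z t) * dtau n ρ₀ t (Z t) (Y t)) = 0 := by
    have h1 := ((hasDerivWithinAt_mu hn hZ hreg.1).pow 2).add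
      ((hasDerivWithinAt_tau hn hZ hreg.1).pow 2)
    have h2 := hud.eq_deriv _ h1 ((hasDerivWithinAt_const t _ (1 : ℝ)).congr
      (fun s hs => h.norm_m hs hn) (h.norm_m ht hn))
    rw [← h2]
    push_cast
    ring
  have hD := hreg.2.1
  -- The derivative of the optical path identity ρ + n d = C + e·f, which is the defining formula of
  -- d cleared of its denominator.
  have hopt : w t + n * dD n ρ₀ d₀ t (Z t) (Y t) = dF2 n ρ₀ d₀ t (Z t) (Y t) := by
    have hr : ((Z t 1 - ρ₀) * Y t 1 + Z t 2 * Y t 2) / rad ρ₀ (Z t) = w t := by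
      refine hud.eq_deriv _ (hasDerivWithinAt_rad hZ hreg.1) ((h.rho_deriv t ht).congr
        (fun s hs => ?_) ?_)
      · rw [h.eq s hs, rad_lensVec (h.rho_pos s hs)]
      · rw [h.eq t ht, rad_lensVec (h.rho_pos t ht)]
    have : dD n ρ₀ d₀ t (Z t) (Y t) * (n - tau n ρ₀ t (Z t)) =
        -w t - Y t 1 + dtau n ρ₀ t (Z t) (Y t) * D n ρ₀ d₀ t (Z t) := by
      rw [dD, div_mul_cancel₀ _ hD, hr]
    rw [dF2]
    linear_combination this
  have hlow := mul_mu_add_mul_tau (n := n) (ρ₀ := ρ₀) (z := Z t 0) (t := t) (r := ρ t)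
    (w := w t) hn
  rw [← h.eq t ht] at hlow
  have e1 : Y t 2 = w t * Real.sin t + ρ t * Real.cos t := by
    rw [h.deriv_Z2 ht, h.eq t ht, lensVec_4]; ring
  have e2 : Y t 1 = -(w t * Real.cos t - ρ t * Real.sin t) := by
    rw [h.deriv_Z1 ht, h.eq t ht, lensVec_3]
  have hn' := h.norm_m ht hn
  rw [dF1]
  rw [dF2] at hopt ⊢
  linear_combination n * mu n ρ₀ t (Z t) * e1 - n * tau n ρ₀ t (Z t) * e2 + hlow + hopt +
    n * D n ρ₀ d₀ t (Z t) * hm / 2 +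
    n * dD n ρ₀ d₀ t (Z t) (Y t) * hn'

end IsLensCurve

lemma eq_zero_of_hasDerivWithinAt_zero {g : ℝ → ℝ} {δ : ℝ} (h0 : g 0 = 0)
    (hg : ∀ t ∈ Icc (-δ) δ, HasDerivWithinAt g 0 (Icc (-δ) δ) t) {t : ℝ} (ht : t ∈ Icc (-δ) δ) :
    g t = 0 := by
  have := norm_sub_le_of_hasDerivWithinAt (Z := g) (Y := fun _ => 0) (B := 0) hg
    (fun _ _ => norm_zero.le) ht
    (abs_le_mem_Icc (s := 0) ht (by simp))
  rw [h0, sub_zero, zero_mul] at this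
  exact norm_le_zero_iff.1 this

/-- For a unit vector m, Λ is the length of m - e/n, so (μ, τ - 1/n)/Λ is a unit normal of the upper
face. -/
lemma Lam_sq {n ρ₀ t : ℝ} {ζ : Fin 5 → ℝ} (h : ColorRegular n ρ₀ t ζ)
    (hm : mu n ρ₀ t ζ ^ 2 + tau n ρ₀ t ζ ^ 2 = 1) :
    Lam n ρ₀ t ζ ^ 2 = mu n ρ₀ t ζ ^ 2 + (tau n ρ₀ t ζ - 1 / n) ^ 2 := by
  rw [Lam, Real.sq_sqrt h.2.2.le]
  linear_combination -hm

/-! ### From the functional system to the lens. -/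

namespace IsGermSolution

variable {nr nb ρ₀ d₀ δ₀ k K p : ℝ} {Z Y : ℝ → Fin 5 → ℝ}
  (h : IsGermSolution nr nb ρ₀ d₀ δ₀ Z Y)

include h

lemma derivWithin_eq {δ t : ℝ} (hδ : 0 < δ) (ht : t ∈ Icc (-δ) δ) :
    derivWithin Z (Icc (-δ) δ) t = Y t :=
  derivWithin_Icc_eq hδ ht (h.deriv t).hasDerivWithinAt

lemma continuous : Continuous Z := continuous_iff_continuousAt.2 fun t => (h.deriv t).continuousAt

lemma eqn {δ t : ℝ} (hδ : 0 < δ) (hδδ₀ : δ ≤ δ₀) (ht : t ∈ Icc (-δ) δ) :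
    Y t = H nr nb ρ₀ d₀ t (Z t) (Z (Z t 0)) (Y t) (Y (Z t 0)) := by
  have hs := h.sol δ hδ hδδ₀
  have := hs.eqn t ht
  rwa [h.derivWithin_eq hδ ht, h.derivWithin_eq hδ (abs_le_mem_Icc ht (hs.abs_le t ht))] at this

lemma inDomain {δ t : ℝ} (hδ : 0 < δ) (hδδ₀ : δ ≤ δ₀) (ht : t ∈ Icc (-δ) δ) :
    InDomain nr nb ρ₀ d₀ t (Z t) (Z (Z t 0)) (Y (Z t 0)) := by
  have hs := h.sol δ hδ hδδ₀
  have := hs.inDomain t ht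
  rwa [h.derivWithin_eq hδ (abs_le_mem_Icc ht (hs.abs_le t ht))] at this

/-- The lower face determined by the solution of the system. -/
lemma isLensCurve {δ : ℝ} (hδ : 0 < δ) (hδδ₀ : δ ≤ δ₀)
    (hpos : ∀ t ∈ Icc (-δ) δ, 0 < ρ₀ - Z t 1) :
    IsLensCurve ρ₀ δ (fun t => (ρ₀ - Z t 1) / Real.cos t)
      (fun t => (-Z t 3 * Real.cos t + (ρ₀ - Z t 1) * Real.sin t) / Real.cos t ^ 2) Z Y := by
  have hcos : ∀ t ∈ Icc (-δ) δ, 0 < Real.cos t := fun t ht =>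
    Real.cos_pos_of_mem_Ioo (h.inDomain hδ hδδ₀ ht).1
  have hi : ∀ t i, HasDerivAt (fun s => Z s i) (Y t i) t := fun t => hasDerivAt_pi.1 (h.deriv t)
  have hY1 : ∀ t ∈ Icc (-δ) δ, Y t 1 = Z t 3 := fun t ht => by rw [h.eqn hδ hδδ₀ ht]; rfl
  have hY2 : ∀ t ∈ Icc (-δ) δ, Y t 2 = Z t 4 + ρ₀ := fun t ht => by rw [h.eqn hδ hδδ₀ ht]; rfl
  have hY4 : ∀ t ∈ Icc (-δ) δ, Y t 4 = h5 ρ₀ t (Z t) (Y t) := fun t ht => by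
    conv_lhs => rw [h.eqn hδ hδδ₀ ht]
    rfl
  -- Compatibility of ζ₄, ζ₅ with a single function ρ, once ζ₂ = ρ₀ - ρ cos t. The equation with h₅
  -- says that its derivative vanishes.
  have hG : ∀ t ∈ Icc (-δ) δ,
      Z t 4 + ρ₀ + Real.tan t * Z t 3 - (ρ₀ - Z t 1) / Real.cos t ^ 2 = 0 := by
    intro t ht
    refine eq_zero_of_hasDerivWithinAt_zero (g := fun t => Z t 4 + ρ₀ + Real.tan t * Z t 3 -
      (ρ₀ - Z t 1) / Real.cos t ^ 2) (by simp [h.init]) (fun t ht => ?_) ht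
    have hc := (hcos t ht).ne'
    have e := (((hi t 4).add_const ρ₀).add ((Real.hasDerivAt_tan hc).mul (hi t 3))).sub
      (((hi t 1).const_sub ρ₀).div ((Real.hasDerivAt_cos t).pow 2) (pow_ne_zero 2 hc))
    refine (e.congr_deriv ?_).hasDerivWithinAt
    rw [hY4 t ht, h5, hY1 t ht, Real.tan_eq_sin_div_cos]
    simp only [Pi.pow_apply]
    push_cast
    field_simp
    ring
  -- The point of the lower face lies on the line spanned by x(t); by `hG` the derivative of this
  -- relation is zero.
  have hF : ∀ t ∈ Icc (-δ) δ, Z t 2 - Real.tan t * (ρ₀ - Z t 1) = 0 := by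
    intro t ht
    refine eq_zero_of_hasDerivWithinAt_zero (g := fun t => Z t 2 - Real.tan t * (ρ₀ - Z t 1))
      (by simp [h.init]) (fun t ht => ?_) ht
    have hc := (hcos t ht).ne'
    have e := (hi t 2).sub ((Real.hasDerivAt_tan hc).mul ((hi t 1).const_sub ρ₀))
    refine (e.congr_deriv ?_).hasDerivWithinAt
    rw [hY2 t ht, hY1 t ht, ← hG t ht]
    field_simp
    ring
  refine ⟨hδ, fun t _ => (h.deriv t).hasDerivWithinAt, fun t ht => ?_,
    fun t ht => div_pos (hpos t ht) (hcos t ht), fun t ht => ?_⟩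
  · have e := ((hi t 1).const_sub ρ₀).div (Real.hasDerivAt_cos t) (hcos t ht).ne'
    refine (e.congr_deriv ?_).hasDerivWithinAt
    rw [hY1 t ht]
    ring
  · have hc := (hcos t ht).ne'
    have g := hG t ht
    have f := hF t ht
    rw [Real.tan_eq_sin_div_cos] at f g
    have hsc := Real.sin_sq_add_cos_sq t
    ext i
    fin_cases i
    · rfl
    · simp only [Fin.mk_one, lensVec_1]
      field_simp
      ring
    · simp only [Fin.reduceFinMk, lensVec_2]
      linear_combination f
    · simp only [Fin.reduceFinMk, lensVec_3]
      field_simp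
      ring
    · simp only [Fin.reduceFinMk, lensVec_4]
      have e : (-Z t 3 * Real.cos t + (ρ₀ - Z t 1) * Real.sin t) / Real.cos t ^ 2 * Real.sin t +
          (ρ₀ - Z t 1) / Real.cos t * Real.cos t =
          -(Real.sin t / Real.cos t * Z t 3) + (ρ₀ - Z t 1) / Real.cos t ^ 2 := by
        field_simp
        linear_combination (ρ₀ - Z t 1) * hsc
      rw [e]
      linear_combination g

/-- The two parametrizations of the upper face agree. -/
lemma faces_eq (hr : 1 < nr) (hb : 1 < nb) (hρ : 0 < ρ₀) {δ : ℝ} {ρ w : ℝ → ℝ}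
    (hδδ₀ : δ ≤ δ₀) (hc : IsLensCurve ρ₀ δ ρ w Z Y)
    (hτr : ∀ t ∈ Icc (-δ) δ, 1 / nr < tau nr ρ₀ t (Z t))
    (hτb : ∀ t ∈ Icc (-δ) δ, 1 / nb < tau nb ρ₀ t (Z t)) {t : ℝ} (ht : t ∈ Icc (-δ) δ) :
    f nr ((nr - 1) * d₀) (Icc (-δ) δ) ρ t = f nb ((nb - 1) * d₀) (Icc (-δ) δ) ρ (Z t 0) := by
  have hs := h.sol δ hc.pos hδδ₀
  have hmap : MapsTo (fun t => Z t 0) (Icc (-δ) δ) (Icc (-δ) δ) := fun t ht =>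
    abs_le_mem_Icc ht (hs.abs_le t ht)
  have hz0 : Z 0 0 = 0 := by rw [h.init]; rfl
  have hφ : ∀ t, HasDerivWithinAt (fun t => Z t 0) (Y t 0) (Icc (-δ) δ) t := fun t =>
    (hasDerivAt_pi.1 (h.deriv t) 0).hasDerivWithinAt
  have hY0 : ∀ t ∈ Icc (-δ) δ, dF1 nr ρ₀ d₀ t (Z t) (Y t) =
      Y t 0 * dF1 nb ρ₀ d₀ (Z t 0) (Z (Z t 0)) (Y (Z t 0)) := fun t ht => by
    have e : Y t 0 = h1 nr nb ρ₀ d₀ t (Z t) (Z (Z t 0)) (Y t) (Y (Z t 0)) := by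
      conv_lhs => rw [h.eqn hc.pos hδδ₀ ht]
      rfl
    rw [e, h1, div_mul_cancel₀ _ (h.inDomain hc.pos hδδ₀ ht).2.2.2]
  -- horizontal components of the unit normals
  have hnormal : ∀ t ∈ Icc (-δ) δ, mu nb ρ₀ (Z t 0) (Z (Z t 0)) * Lam nr ρ₀ t (Z t) -
      mu nr ρ₀ t (Z t) * Lam nb ρ₀ (Z t 0) (Z (Z t 0)) = 0 := by
    intro t ht
    refine eq_zero_of_hasDerivWithinAt_zero (g := fun t => mu nb ρ₀ (Z t 0) (Z (Z t 0)) *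
      Lam nr ρ₀ t (Z t) - mu nr ρ₀ t (Z t) * Lam nb ρ₀ (Z t 0) (Z (Z t 0))) ?_
      (fun t ht => ?_) ht
    · simp only [hz0]
      simp only [h.init, mu_zero]
      ring
    · have hrr := hc.regular ht hr
      have hrb := hc.regular (hmap ht) hb
      have d1 := (hasDerivWithinAt_mu hb (hc.deriv _ (hmap ht)) hrb.1).comp t (hφ t) hmap
      have d2 := (hasDerivWithinAt_Lam hb (hc.deriv _ (hmap ht)) hrb).comp t (hφ t) hmap
      have d3 := hasDerivWithinAt_mu hr (hc.deriv t ht) hrr.1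
      have d4 := hasDerivWithinAt_Lam hr (hc.deriv t ht) hrr
      refine ((d1.mul d4).sub (d3.mul d2)).congr_deriv ?_
      -- The fourth equation is the vanishing of the derivative computed above, solved for the ξ₄
      -- that occurs in the factor μ~ of the first color.
      have e : Y t 3 = h4 nr nb ρ₀ t (Z t) (Z (Z t 0)) (Y t) (Y (Z t 0)) := by
        conv_lhs => rw [h.eqn hc.pos hδδ₀ ht]
        rfl
      have hA := (A_neg hr hrr.1).ne
      have hL := (Lam_pos hrb).ne'
      have hnr : nr ≠ 0 := by linarith
      rw [h4, ← neg_eq_iff_eq_neg, eq_div_iff (by positivity)] at e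
      simp only [Function.comp_apply]
      have e' : dmu nr ρ₀ t (Z t) (Y t) =
        1 / nr * (Real.cos t - A nr ρ₀ (Z t) * Y t 3 - dA nr ρ₀ (Z t) (Y t) * Z t 3) := rfl
      linear_combination -e - Lam nb ρ₀ (Z t 0) (Z (Z t 0)) * e'
  -- Two unit normals with equal horizontal components have vertical components equal up to sign; τ
  -- > 1/n makes both positive.
  have hvert : ∀ t ∈ Icc (-δ) δ,
      (tau nr ρ₀ t (Z t) - 1 / nr) * Lam nb ρ₀ (Z t 0) (Z (Z t 0)) =
        (tau nb ρ₀ (Z t 0) (Z (Z t 0)) - 1 / nb) * Lam nr ρ₀ t (Z t) := by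
    intro t ht
    have hrr := hc.regular ht hr
    have hrb := hc.regular (hmap ht) hb
    have l1 := Lam_sq hrr (hc.norm_m ht hr)
    have l2 := Lam_sq hrb (hc.norm_m (hmap ht) hb)
    have p1 := sub_pos.2 (hτr t ht)
    have p2 := sub_pos.2 (hτb _ (hmap ht))
    have q1 := Lam_pos hrr
    have q2 := Lam_pos hrb
    refine (pow_left_inj₀ (by positivity) (by positivity) two_ne_zero).1 ?_
    have e := hnormal t ht
    linear_combination (Lam nr ρ₀ t (Z t) ^ 2) * l2 -
      Lam nb ρ₀ (Z t 0) (Z (Z t 0)) ^ 2 * l1 +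
      (mu nb ρ₀ (Z t 0) (Z (Z t 0)) * Lam nr ρ₀ t (Z t) +
        mu nr ρ₀ t (Z t) * Lam nb ρ₀ (Z t 0) (Z (Z t 0))) * e
  -- Both tangents are orthogonal to the same non-horizontal normal, so their horizontal components
  -- determine the vertical ones.
  have hF2 : ∀ t ∈ Icc (-δ) δ, dF2 nr ρ₀ d₀ t (Z t) (Y t) =
      Y t 0 * dF2 nb ρ₀ d₀ (Z t 0) (Z (Z t 0)) (Y (Z t 0)) := by
    intro t ht
    have hnr : nr ≠ 0 := by linarith
    have hnb : nb ≠ 0 := by linarith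
    have o1 : dF1 nr ρ₀ d₀ t (Z t) (Y t) * mu nr ρ₀ t (Z t) +
        dF2 nr ρ₀ d₀ t (Z t) (Y t) * (tau nr ρ₀ t (Z t) - 1 / nr) = 0 := by
      have := hc.tangent_f_orthogonal ht hr d₀
      apply mul_left_cancel₀ hnr
      rw [mul_zero, ← this]
      field_simp
    have o2 : dF1 nb ρ₀ d₀ (Z t 0) (Z (Z t 0)) (Y (Z t 0)) * mu nb ρ₀ (Z t 0) (Z (Z t 0)) +
        dF2 nb ρ₀ d₀ (Z t 0) (Z (Z t 0)) (Y (Z t 0)) *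
          (tau nb ρ₀ (Z t 0) (Z (Z t 0)) - 1 / nb) = 0 := by
      have := hc.tangent_f_orthogonal (hmap ht) hb d₀
      apply mul_left_cancel₀ hnb
      rw [mul_zero, ← this]
      field_simp
    have p1 := sub_pos.2 (hτr t ht)
    have q2 := Lam_pos (hc.regular (hmap ht) hb)
    have e1 := hnormal t ht
    have e2 := hvert t ht
    have e3 := hY0 t ht
    apply mul_right_cancel₀ (mul_pos p1 q2).ne'
    generalize dF1 nb ρ₀ d₀ (Z t 0) (Z (Z t 0)) (Y (Z t 0)) = a at *
    generalize dF2 nb ρ₀ d₀ (Z t 0) (Z (Z t 0)) (Y (Z t 0)) = b at *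
    rw [e3] at o1
    linear_combination Lam nb ρ₀ (Z t 0) (Z (Z t 0)) * o1 - Y t 0 * Lam nr ρ₀ t (Z t) * o2 +
      Y t 0 * a * e1 - Y t 0 * b * e2
  have hCr : (nr - 1) * d₀ / (nr - 1) = d₀ := mul_div_cancel_left₀ _ (by linarith)
  have hCb : (nb - 1) * d₀ / (nb - 1) = d₀ := mul_div_cancel_left₀ _ (by linarith)
  have hd := fun (t : ℝ) (ht : t ∈ Icc (-δ) δ) =>
    hasDerivWithinAt_plane.1 (hc.hasDerivWithinAt_f (C := (nr - 1) * d₀) ht hr)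
  have hd' := fun (t : ℝ) (ht : t ∈ Icc (-δ) δ) =>
    hasDerivWithinAt_plane.1 (hc.hasDerivWithinAt_f (C := (nb - 1) * d₀) (hmap ht) hb)
  simp only [hCr, hCb] at hd hd'
  ext i
  refine sub_eq_zero.1 (eq_zero_of_hasDerivWithinAt_zero (g := fun t =>
    f nr ((nr - 1) * d₀) (Icc (-δ) δ) ρ t i - f nb ((nb - 1) * d₀) (Icc (-δ) δ) ρ (Z t 0) i)
    ?_ (fun t ht => ?_) ht)
  -- At t = 0 both faces pass through (0, ρ₀ + d₀), since the rays are vertical and both thicknesses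
  -- are d₀.
  · simp only [hz0]
    rw [hc.f_eq hc.zero_mem hr, hc.f_eq hc.zero_mem hb, hCr, hCb, h.init, D_zero hr hρ,
      D_zero hb hρ, mu_zero, mu_zero, tau_zero hr hρ, tau_zero hb hρ, sub_self]
  · refine ((hd t ht i).sub ((hd' t ht i).comp t (hφ t) hmap)).congr_deriv ?_
    fin_cases i
    · show dF1 nr ρ₀ d₀ t (Z t) (Y t) -
        dF1 nb ρ₀ d₀ (Z t 0) (Z (Z t 0)) (Y (Z t 0)) * Y t 0 = 0
      rw [hY0 t ht, mul_comm, sub_self]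
    · show dF2 nr ρ₀ d₀ t (Z t) (Y t) -
        dF2 nb ρ₀ d₀ (Z t 0) (Z (Z t 0)) (Y (Z t 0)) * Y t 0 = 0
      rw [hF2 t ht, mul_comm, sub_self]

/-- Existence for the lens problem. -/
theorem exists_lensSolution (hL : LensData nr nb ρ₀ d₀ k K p) (hδ₀ : 0 < δ₀) :
    ∃ δ₁ > 0, δ₁ ≤ δ₀ ∧ ∀ δ, 0 < δ → δ ≤ δ₁ → ∃ ρ φ, IsLensSolution nr nb ρ₀ d₀ δ ρ φ := by
  have hr := hL.hr
  have hb := hL.hb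
  have hρ := hL.hρ
  have hZc := h.continuous
  have hprod : Continuous fun t => (t, Z t, Y t) := by
    have := h.cont
    fun_prop
  have hnear : ∀ n, 1 < n → dF1 n ρ₀ d₀ 0 0 (initialVelocity nr nb ρ₀ d₀) ≠ 0 →
      ∀ᶠ t in 𝓝 (0 : ℝ), 0 < D n ρ₀ d₀ t (Z t) ∧ 1 / n < tau n ρ₀ t (Z t) ∧
        dF1 n ρ₀ d₀ t (Z t) (Y t) ≠ 0 := by
    intro n hn hF
    have hreg := colorRegular_zero hn hρ
    have c1 := (contDiffAt_D (k := 0) (d₀ := d₀) (t := fun y : ℝ × (Fin 5 → ℝ) × (Fin 5 → ℝ) => y.1)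
      (ζ := fun y => y.2.1) (y := (0, 0, initialVelocity nr nb ρ₀ d₀)) hn (by fun_prop)
      (by fun_prop) hreg.1 hreg.2.1).continuousAt
    have c2 := (contDiffAt_tau (k := 0) (t := fun y : ℝ × (Fin 5 → ℝ) × (Fin 5 → ℝ) => y.1)
      (ζ := fun y => y.2.1) (y := (0, 0, initialVelocity nr nb ρ₀ d₀)) hn (by fun_prop)
      (by fun_prop) hreg.1).continuousAt
    have c3 := (contDiffAt_dF1 (k := 0) (d₀ := d₀)
      (t := fun y : ℝ × (Fin 5 → ℝ) × (Fin 5 → ℝ) => y.1)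
      (ζ := fun y => y.2.1) (ξ := fun y => y.2.2) (y := (0, 0, initialVelocity nr nb ρ₀ d₀)) hn
      (by fun_prop) (by fun_prop) (by fun_prop) hreg.1 hreg.2.1).continuousAt
    have hlim : Tendsto (fun t => (t, Z t, Y t)) (𝓝 0) (𝓝 (0, 0, initialVelocity nr nb ρ₀ d₀)) := by
      have := hprod.tendsto 0
      rwa [h.init, h.init_deriv] at this
    refine (hlim.eventually (continuousAt_const.eventually_lt c1 ?_)).and
      ((hlim.eventually (continuousAt_const.eventually_lt c2 ?_)).and
        (hlim.eventually (c3.eventually_ne hF)))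
    · rw [D_zero hn hρ]; exact hL.hd
    · rw [tau_zero hn hρ, div_lt_one (by linarith)]; exact hn
  have hv := hL.velocity
  have hFr : dF1 nr ρ₀ d₀ 0 0 (initialVelocity nr nb ρ₀ d₀) ≠ 0 := by
    rw [hL.dF1_r (by rw [hv]; rfl) (by rw [hv]; rfl)]
    have := hL.hd
    have := hL.K_pos
    have := sub_pos.2 hL.K_lt
    have := hL.one_lt_Dr
    have := hL.one_lt_Db
    positivity
  have hFb : dF1 nb ρ₀ d₀ 0 0 (initialVelocity nr nb ρ₀ d₀) ≠ 0 := hL.inDomain_zero.2.2.2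
  have hpos : ∀ᶠ t in 𝓝 (0 : ℝ), 0 < ρ₀ - Z t 1 :=
    continuousAt_const.eventually_lt (continuous_const.sub
      ((continuous_apply 1).comp hZc)).continuousAt (by simp [h.init, hρ])
  obtain ⟨ε, hε, hev⟩ := Metric.eventually_nhds_iff.1
    (((hnear nr hr hFr).and (hnear nb hb hFb)).and hpos)
  refine ⟨min δ₀ (ε / 2), by positivity, min_le_left _ _, fun δ hδ hle => ?_⟩
  simp only [le_min_iff] at hle
  have hall : ∀ t ∈ Icc (-δ) δ, _ := fun t ht =>
    hev (y := t) (by rw [dist_zero_right, Real.norm_eq_abs]; linarith [abs_le.2 ht])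
  have hc := h.isLensCurve hδ hle.1 fun t ht => (hall t ht).2
  have hcos : ∀ t ∈ Icc (-δ) δ, Real.cos t ≠ 0 := fun t ht =>
    (Real.cos_pos_of_mem_Ioo (h.inDomain hδ hle.1 ht).1).ne'
  have hs := h.sol δ hδ hle.1
  have hmap : MapsTo (fun t => Z t 0) (Icc (-δ) δ) (Icc (-δ) δ) := fun t ht =>
    abs_le_mem_Icc ht (hs.abs_le t ht)
  have hud := uniqueDiffOn_Icc (show -δ < δ by linarith)
  have hCr : (nr - 1) * d₀ / (nr - 1) = d₀ := mul_div_cancel_left₀ _ (by linarith)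
  have hCb : (nb - 1) * d₀ / (nb - 1) = d₀ := mul_div_cancel_left₀ _ (by linarith)
  have hZi := fun i => contDiffOn_pi.1 hs.contDiffOn i
  have hadm : ∀ n, 1 < n → (∀ t ∈ Icc (-δ) δ, 0 < D n ρ₀ d₀ t (Z t) ∧ 1 / n < tau n ρ₀ t (Z t) ∧
      dF1 n ρ₀ d₀ t (Z t) (Y t) ≠ 0) → Admissible n ((n - 1) * d₀) (Icc (-δ) δ)
        (fun t => (ρ₀ - Z t 1) / Real.cos t) := by
    intro n hn hall
    have hC : (n - 1) * d₀ / (n - 1) = d₀ := mul_div_cancel_left₀ _ (by linarith)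
    refine ⟨fun t ht => ?_, fun t ht => ?_, fun t ht h0 => ?_⟩
    · rw [hc.d_eq ht hn, hC]; exact (hall t ht).1
    · rw [hc.inner_e_m ht hn]; exact (hall t ht).2.1.le
    · rw [hc.tangent_f ht hn, hC] at h0
      exact (hall t ht).2.2 (congrArg (fun v : Plane => v 0) h0)
  refine ⟨_, fun t => Z t 0, ?_, hc.rho_pos, hZi 0, hmap, ?_,
    (nr - 1) * d₀, (nb - 1) * d₀, hadm nr hr fun t ht => (hall t ht).1.1,
    hadm nb hb fun t ht => (hall t ht).1.2, ?_, ?_, fun t ht => ?_⟩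
  · have h2 : (2 : WithTop ℕ∞) = 1 + 1 := by norm_num
    rw [h2, contDiffOn_succ_iff_derivWithin hud]
    refine ⟨fun t ht => (hc.rho_deriv t ht).differentiableWithinAt, by simp, ?_⟩
    refine ContDiffOn.congr ?_ fun t ht => derivWithin_Icc_eq hδ ht (hc.rho_deriv t ht)
    exact (((hZi 3).neg.mul Real.contDiff_cos.contDiffOn).add
      ((contDiffOn_const.sub (hZi 1)).mul Real.contDiff_sin.contDiffOn)).div
      (Real.contDiff_cos.contDiffOn.pow 2) fun t ht => pow_ne_zero 2 (hcos t ht)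
  · simp [h.init]
  · rw [hc.d_eq hc.zero_mem hr, hCr, h.init, D_zero hr hρ]
  · rw [hc.d_eq hc.zero_mem hb, hCb, h.init, D_zero hb hρ]
  · exact h.faces_eq hr hb hρ hle.1 hc (fun t ht => (hall t ht).1.1.2.1)
      (fun t ht => (hall t ht).1.2.2.1) ht

end IsGermSolution

/-- The curve of data attached to a pair `(ρ, φ)`. -/
def lensCurve (ρ₀ δ : ℝ) (ρ φ : ℝ → ℝ) (t : ℝ) : Fin 5 → ℝ :=
  lensVec ρ₀ (φ t) t (ρ t) (derivWithin ρ (Icc (-δ) δ) t)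

@[simp] lemma lensVec_zero (ρ₀ : ℝ) : lensVec ρ₀ 0 0 ρ₀ 0 = 0 := by
  ext i
  fin_cases i <;> simp [lensVec]

/-! ### Consequences of the lens equations: parallel normals and the fixed point of φ. -/

namespace IsLensSolution

variable {nr nb ρ₀ d₀ δ : ℝ} {ρ φ : ℝ → ℝ} (h : IsLensSolution nr nb ρ₀ d₀ δ ρ φ) (hδ : 0 < δ)

include h hδ

lemma contDiffOn_derivWithin :
    ContDiffOn ℝ 1 (derivWithin ρ (Icc (-δ) δ)) (Icc (-δ) δ) := by
  have h2 : (2 : WithTop ℕ∞) = 1 + 1 := by norm_num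
  have := h.rho_contDiffOn
  rw [h2, contDiffOn_succ_iff_derivWithin (uniqueDiffOn_Icc (by linarith))] at this
  exact this.2.2

lemma contDiffOn_lensCurve : ContDiffOn ℝ 1 (lensCurve ρ₀ δ ρ φ) (Icc (-δ) δ) := by
  have h1 : ContDiffOn ℝ 1 ρ (Icc (-δ) δ) := h.rho_contDiffOn.of_le (by norm_num)
  have h2 := h.contDiffOn_derivWithin hδ
  have hs : ContDiffOn ℝ 1 Real.sin (Icc (-δ) δ) := Real.contDiff_sin.contDiffOn
  have hc : ContDiffOn ℝ 1 Real.cos (Icc (-δ) δ) := Real.contDiff_cos.contDiffOn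
  refine contDiffOn_pi.2 fun i => ?_
  fin_cases i
  · exact h.phi_contDiffOn
  · exact contDiffOn_const.sub (h1.mul hc)
  · exact h1.mul hs
  · exact ((h2.mul hc).sub (h1.mul hs)).neg
  · exact ((h2.mul hs).add (h1.mul hc)).sub contDiffOn_const

lemma isLensCurve : IsLensCurve ρ₀ δ ρ (derivWithin ρ (Icc (-δ) δ)) (lensCurve ρ₀ δ ρ φ)
    (derivWithin (lensCurve ρ₀ δ ρ φ) (Icc (-δ) δ)) := by
  have hZ := (contDiffOn_one_Icc_iff hδ).1 (h.contDiffOn_lensCurve hδ)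
  have hρ : DifferentiableOn ℝ ρ (Icc (-δ) δ) := h.rho_contDiffOn.differentiableOn (by norm_num)
  exact ⟨hδ, fun t ht => (hZ.1 t ht).hasDerivWithinAt, fun t ht => (hρ t ht).hasDerivWithinAt,
    h.rho_pos, fun t _ => rfl⟩

lemma hasDerivWithinAt_phi {t : ℝ} (ht : t ∈ Icc (-δ) δ) : HasDerivWithinAt φ
    (derivWithin (lensCurve ρ₀ δ ρ φ) (Icc (-δ) δ) t 0) (Icc (-δ) δ) t :=
  hasDerivWithinAt_pi.1 ((h.isLensCurve hδ).deriv t ht) 0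

omit hδ in
/-- The normals of the two parametrizations of the upper face are parallel. -/
lemma normals_parallel_aux {Cr Cb : ℝ} {Z Y : ℝ → Fin 5 → ℝ} {w : ℝ → ℝ}
    (hr : 1 < nr) (hb : 1 < nb)
    (hc : IsLensCurve ρ₀ δ ρ w Z Y) (hφ : ∀ t, Z t 0 = φ t)
    (har : Admissible nr Cr (Icc (-δ) δ) ρ)
    (hf : ∀ t ∈ Icc (-δ) δ, f nr Cr (Icc (-δ) δ) ρ t = f nb Cb (Icc (-δ) δ) ρ (φ t))
    {t : ℝ} (ht : t ∈ Icc (-δ) δ) :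
    dF1 nr ρ₀ (Cr / (nr - 1)) t (Z t) (Y t) =
      Y t 0 * dF1 nb ρ₀ (Cb / (nb - 1)) (φ t) (Z (φ t)) (Y (φ t)) ∧
    nr * mu nr ρ₀ t (Z t) * (nb * tau nb ρ₀ (φ t) (Z (φ t)) - 1) =
      nb * mu nb ρ₀ (φ t) (Z (φ t)) * (nr * tau nr ρ₀ t (Z t) - 1) := by
  have hmap := h.phi_mapsTo
  have hd : HasDerivWithinAt φ (Y t 0) (Icc (-δ) δ) t := by
    have := hasDerivWithinAt_pi.1 (hc.deriv t ht) 0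
    simpa only [hφ] using this
  have e1 := hasDerivWithinAt_plane.1 (hc.hasDerivWithinAt_f (C := Cr) ht hr)
  have e2 := hasDerivWithinAt_plane.1 (hc.hasDerivWithinAt_f (C := Cb) (hmap ht) hb)
  have hud := uniqueDiffOn_Icc (show -δ < δ by linarith [hc.pos]) t ht
  have e3 := fun i => hud.eq_deriv _ (e1 i) (((e2 i).comp t hd hmap).congr
    (fun s hs => by rw [Function.comp_apply, ← hf s hs]) (by rw [Function.comp_apply, ← hf t ht]))
  have a1 : dF1 nr ρ₀ (Cr / (nr - 1)) t (Z t) (Y t) =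
      dF1 nb ρ₀ (Cb / (nb - 1)) (φ t) (Z (φ t)) (Y (φ t)) * Y t 0 := e3 0
  have a2 : dF2 nr ρ₀ (Cr / (nr - 1)) t (Z t) (Y t) =
      dF2 nb ρ₀ (Cb / (nb - 1)) (φ t) (Z (φ t)) (Y (φ t)) * Y t 0 := e3 1
  refine ⟨by rw [a1, mul_comm], ?_⟩
  have o1 := hc.tangent_f_orthogonal ht hr (Cr / (nr - 1))
  have o2 := hc.tangent_f_orthogonal (hmap ht) hb (Cb / (nb - 1))
  have hne := har.normal t ht
  rw [hc.tangent_f ht hr] at hne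
  -- The tangent of the first face is a multiple of the second tangent, hence orthogonal to both
  -- normals. It is nonzero by admissibility, so in the plane the normals are parallel.
  have o3 : dF1 nr ρ₀ (Cr / (nr - 1)) t (Z t) (Y t) * (nb * mu nb ρ₀ (φ t) (Z (φ t))) +
      dF2 nr ρ₀ (Cr / (nr - 1)) t (Z t) (Y t) * (nb * tau nb ρ₀ (φ t) (Z (φ t)) - 1) = 0 := by
    rw [a1, a2]
    linear_combination Y t 0 * o2
  generalize dF1 nr ρ₀ (Cr / (nr - 1)) t (Z t) (Y t) = a at *
  generalize dF2 nr ρ₀ (Cr / (nr - 1)) t (Z t) (Y t) = b at *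
  by_cases ha : a = 0
  · have hb0 : b ≠ 0 := by
      rintro rfl
      apply hne
      ext i
      fin_cases i <;> simp [ha]
    apply mul_left_cancel₀ hb0
    rw [ha] at o1 o3
    linear_combination (nr * mu nr ρ₀ t (Z t)) * o3 - nb * mu nb ρ₀ (φ t) (Z (φ t)) * o1
  · apply mul_left_cancel₀ ha
    linear_combination (nb * tau nb ρ₀ (φ t) (Z (φ t)) - 1) * o1 -
      (nr * tau nr ρ₀ t (Z t) - 1) * o3

/-- The map `φ` fixes `0`, where the lower face is horizontal. -/
lemma origin (hr : 1 < nr) (hrb : nr < nb) (hδπ : δ < Real.pi / 2) :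
    φ 0 = 0 ∧ derivWithin ρ (Icc (-δ) δ) 0 = 0 := by
  have hb := hr.trans hrb
  have hc := h.isLensCurve hδ
  obtain ⟨Cr, Cb, har, hab, -, -, hf⟩ := h.faces
  -- At a fixed point both colors travel between the same two points, so lengths and unit directions
  -- coincide.
  obtain ⟨t, ht, hfix⟩ := exists_mem_Icc_isFixedPt_of_mapsTo h.phi_contDiffOn.continuousOn
    (by linarith) h.phi_mapsTo
  have hfix : φ t = t := hfix
  have hpar := (h.normals_parallel_aux hr hb hc (fun _ => rfl) har hf ht).2
  have hft := hf t ht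
  have dr := har.d_pos t ht
  have db := hab.d_pos t ht
  rw [hfix] at hpar hft
  have hmr := hc.norm_m ht hr
  have hmb := hc.norm_m ht hb
  rw [f, f, hc.m_eq ht hr, hc.m_eq ht hb] at hft
  have f0 := congrArg (fun v : Plane => v 0) hft
  have f1 := congrArg (fun v : Plane => v 1) hft
  simp at f0 f1
  have lr := mul_mu_add_mul_tau (n := nr) (ρ₀ := ρ₀) (z := φ t) (t := t) (r := ρ t)
    (w := derivWithin ρ (Icc (-δ) δ) t) hr
  have lb := mul_mu_add_mul_tau (n := nb) (ρ₀ := ρ₀) (z := φ t) (t := t) (r := ρ t)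
    (w := derivWithin ρ (Icc (-δ) δ) t) hb
  change nr * (_ * mu nr ρ₀ t (lensCurve ρ₀ δ ρ φ t) +
    _ * tau nr ρ₀ t (lensCurve ρ₀ δ ρ φ t)) = _ at lr
  change nb * (_ * mu nb ρ₀ t (lensCurve ρ₀ δ ρ φ t) +
    _ * tau nb ρ₀ t (lensCurve ρ₀ δ ρ φ t)) = _ at lb
  generalize d nr Cr (Icc (-δ) δ) ρ t = Dr at *
  generalize d nb Cb (Icc (-δ) δ) ρ t = Db at *
  generalize mu nr ρ₀ t (lensCurve ρ₀ δ ρ φ t) = mr at *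
  generalize mu nb ρ₀ t (lensCurve ρ₀ δ ρ φ t) = mb at *
  generalize tau nr ρ₀ t (lensCurve ρ₀ δ ρ φ t) = τr at *
  generalize tau nb ρ₀ t (lensCurve ρ₀ δ ρ φ t) = τb at *
  have hD : Dr = Db := by
    refine (pow_left_inj₀ dr.le db.le two_ne_zero).1 ?_
    linear_combination -Dr ^ 2 * hmr + Db ^ 2 * hmb + (Dr * mr + Db * mb) * f0 +
      (Dr * τr + Db * τb) * f1
  rw [hD] at f0 f1
  have hm := mul_left_cancel₀ db.ne' f0
  have hτ := mul_left_cancel₀ db.ne' f1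
  subst hm hτ
  -- With a common m, the vectors n_r m - e and n_b m - e are parallel only if m is vertical.
  have hm0 : mr = 0 := by
    have : (nb - nr) * mr = 0 := by linear_combination hpar
    rcases mul_eq_zero.1 this with h0 | h0
    · linarith
    · exact h0
  have hτ0 : τr ≠ 0 := by
    rintro rfl
    rw [hm0] at hmr
    norm_num at hmr
  -- The tangential part of Snell's law reads n (m·T) = ρ' for both indices with the same m, so m·T
  -- = 0 and the tangent T is horizontal.
  have hw : derivWithin ρ (Icc (-δ) δ) t * Real.cos t - ρ t * Real.sin t = 0 := by
    have : (nb - nr) *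
        ((derivWithin ρ (Icc (-δ) δ) t * Real.cos t - ρ t * Real.sin t) * τr) = 0 := by
      rw [hm0] at lr lb
      linear_combination lb - lr
    rcases mul_eq_zero.1 this with h0 | h0
    · linarith
    · exact (mul_eq_zero.1 h0).resolve_right hτ0
  have hw0 : derivWithin ρ (Icc (-δ) δ) t = 0 := by
    rw [hw, hm0] at lr
    linarith
  have hsin : Real.sin t = 0 := by
    rw [hw0, zero_mul, zero_sub, neg_eq_zero] at hw
    exact (mul_eq_zero.1 hw).resolve_left (h.rho_pos t ht).ne'
  have ht0 : t = 0 := by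
    have := Real.pi_pos
    exact (Real.sin_eq_zero_iff_of_lt_of_lt (by linarith [ht.1]) (by linarith [ht.2])).1 hsin
  subst ht0
  exact ⟨hfix, hw0⟩

lemma lensCurve_zero (hr : 1 < nr) (hrb : nr < nb) (hδπ : δ < Real.pi / 2) :
    lensCurve ρ₀ δ ρ φ 0 = 0 := by
  obtain ⟨h1, h2⟩ := h.origin hδ hr hrb hδπ
  rw [lensCurve, h1, h2, h.rho_zero, lensVec_zero]

/-- The equations satisfied by the curve of data of a solution of the lens problem. -/
lemma equations (hr : 1 < nr) (hrb : nr < nb) (hρ : 0 < ρ₀) (hδπ : δ < Real.pi / 2)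
    {Z Y : ℝ → Fin 5 → ℝ} (hZ : Z = lensCurve ρ₀ δ ρ φ)
    (hY : Y = derivWithin (lensCurve ρ₀ δ ρ φ) (Icc (-δ) δ)) {t : ℝ} (ht : t ∈ Icc (-δ) δ) :
    dF1 nr ρ₀ d₀ t (Z t) (Y t) = Y t 0 * dF1 nb ρ₀ d₀ (φ t) (Z (φ t)) (Y (φ t)) ∧
    nr * mu nr ρ₀ t (Z t) * (nb * tau nb ρ₀ (φ t) (Z (φ t)) - 1) =
      nb * mu nb ρ₀ (φ t) (Z (φ t)) * (nr * tau nr ρ₀ t (Z t) - 1) ∧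
    Z t 2 + D nr ρ₀ d₀ t (Z t) * mu nr ρ₀ t (Z t) =
      Z (φ t) 2 + D nb ρ₀ d₀ (φ t) (Z (φ t)) * mu nb ρ₀ (φ t) (Z (φ t)) ∧
    (1 < nb * tau nb ρ₀ t (Z t) → dF1 nb ρ₀ d₀ t (Z t) (Y t) ≠ 0) := by
  have hb := hr.trans hrb
  have hc := h.isLensCurve hδ
  have hZ0 := h.lensCurve_zero hδ hr hrb hδπ
  rw [← hZ] at hZ0
  rw [← hY, ← hZ] at hc
  obtain ⟨Cr, Cb, har, hab, hdr, hdb, hf⟩ := h.faces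
  -- The thickness at the origin determines the constants: C = (n - 1) d₀ for each color.
  rw [hc.d_eq hc.zero_mem hr, hZ0, D_zero hr hρ] at hdr
  rw [hc.d_eq hc.zero_mem hb, hZ0, D_zero hb hρ] at hdb
  have hpar := h.normals_parallel_aux hr hb hc (fun t => by rw [hZ]; rfl) har hf ht
  rw [hdr, hdb] at hpar
  have hft := hf t ht
  rw [hc.f_eq ht hr, hc.f_eq (h.phi_mapsTo ht) hb, hdr, hdb] at hft
  refine ⟨hpar.1, hpar.2, congrArg (fun v : Plane => v 0) hft, fun hτ h0 => ?_⟩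
  -- A vertical tangent is incompatible with a normal whose vertical component n τ - 1 is positive,
  -- unless it is zero, which admissibility forbids.
  have o := hc.tangent_f_orthogonal ht hb d₀
  rw [h0, zero_mul, zero_add] at o
  have h2 : dF2 nb ρ₀ d₀ t (Z t) (Y t) = 0 :=
    (mul_eq_zero.1 o).resolve_right (by linarith)
  apply hab.normal t ht
  rw [hc.tangent_f ht hb, hdb, h0, h2]
  ext i
  fin_cases i <;> rfl

end IsLensSolution

/-! ### Estimates near the origin -/

/-- Strict differentiability is applied to (t, r, q) and (0, r, 0), where G vanishes. Thus the error
involves |t| and |q| but not |r - ρ₀|. -/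
lemma eventually_almost_linear {G : ℝ × ℝ × ℝ → ℝ} {ρ₀ α β ε : ℝ} (hρ : 0 < ρ₀)
    (hG : ContDiffAt ℝ 1 G (0, ρ₀, 0)) (h0 : ∀ r, 0 < r → G (0, r, 0) = 0)
    (hd : ∀ c, HasDerivAt (fun s => G (s, ρ₀, c * s)) (α + β * c) 0) (hε : 0 < ε) :
    ∀ᶠ x in 𝓝 ((0, ρ₀, 0) : ℝ × ℝ × ℝ),
      |G x - (α * x.1 + β * x.2.2)| ≤ ε * (|x.1| + |x.2.2|) := by
  have hs := hG.hasStrictFDerivAt one_ne_zero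
  set L := fderiv ℝ G (0, ρ₀, 0)
  -- Derivatives along the lines of slope c, for all c, determine both partial derivatives in t and
  -- q.
  have hL : ∀ c, L (1, 0, c) = α + β * c := by
    intro c
    refine HasDerivAt.unique (f := fun s : ℝ => G (s, ρ₀, c * s)) (x := 0) ?_ (hd c)
    have hγ : HasDerivAt (fun s : ℝ => ((s, ρ₀, c * s) : ℝ × ℝ × ℝ)) (1, 0, c) 0 :=
      (hasDerivAt_id _).prodMk ((hasDerivAt_const _ _).prodMk
        (by simpa using (hasDerivAt_id (0 : ℝ)).const_mul c))
    have : HasFDerivAt G L ((0 : ℝ), ρ₀, c * 0) := by rw [mul_zero]; exact hs.hasFDerivAt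
    exact this.comp_hasDerivAt 0 hγ
  have hL' : ∀ t q, L (t, 0, q) = α * t + β * q := by
    intro t q
    have e : ((t, 0, q) : ℝ × ℝ × ℝ) = (t - q) • (1, 0, 0) + q • (1, 0, 1) := by
      ext <;> simp
    rw [e, map_add, map_smul, map_smul, hL, hL]
    simp only [smul_eq_mul]
    ring
  have ho := (hasStrictFDerivAt_iff_isLittleO.1 hs).def hε
  have hlim : Tendsto (fun x : ℝ × ℝ × ℝ => (x, ((0, x.2.1, 0) : ℝ × ℝ × ℝ))) (𝓝 (0, ρ₀, 0))
      (𝓝 ((0, ρ₀, 0), (0, ρ₀, 0))) := by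
    have : Continuous (fun x : ℝ × ℝ × ℝ => (x, ((0, x.2.1, 0) : ℝ × ℝ × ℝ))) := by fun_prop
    exact this.tendsto _
  have hpos : ∀ᶠ x in 𝓝 ((0, ρ₀, 0) : ℝ × ℝ × ℝ), 0 < x.2.1 :=
    continuousAt_const.eventually_lt (by fun_prop) hρ
  filter_upwards [hlim.eventually ho, hpos] with x hx hx0
  obtain ⟨t, r, q⟩ := x
  have e : ((t, r, q) : ℝ × ℝ × ℝ) - (0, r, 0) = (t, 0, q) := by simp
  simp only [h0 r hx0, sub_zero, e, hL'] at hx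
  refine hx.trans (mul_le_mul_of_nonneg_left ?_ hε.le)
  have : ‖((t, 0, q) : ℝ × ℝ × ℝ)‖ = max |t| (max |(0:ℝ)| |q|) := rfl
  rw [this, abs_zero]
  have := abs_nonneg t
  have := abs_nonneg q
  exact max_le (by linarith) (max_le (by linarith) (by linarith))

/-- At the point with parameter `t`, distance `r` to the origin and slope `ρ₀ q`, the upper face
and its normal agree with their linearizations up to a relative error `ε`. -/
structure IsAlmostLinear (n ρ₀ d₀ k ε t r q : ℝ) : Prop where
  one_lt : 1 < n * tau n ρ₀ t (lensVec ρ₀ 0 t r (ρ₀ * q))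
  face : |(r * Real.sin t + D n ρ₀ d₀ t (lensVec ρ₀ 0 t r (ρ₀ * q)) *
    mu n ρ₀ t (lensVec ρ₀ 0 t r (ρ₀ * q))) / d₀ - ((1 + k) * t + -(1 / Delta n) * q)| ≤
      ε * (|t| + |q|)
  normal : |n * mu n ρ₀ t (lensVec ρ₀ 0 t r (ρ₀ * q)) /
    (n * tau n ρ₀ t (lensVec ρ₀ 0 t r (ρ₀ * q)) - 1) - (Delta n * t + -1 * q)| ≤ ε * (|t| + |q|)

lemma contDiff_lensVec (ρ₀ : ℝ) : ContDiff ℝ 1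
    (fun x : ℝ × ℝ × ℝ => lensVec ρ₀ 0 x.1 x.2.1 (ρ₀ * x.2.2)) := by
  refine contDiff_pi.2 fun i => ?_
  fin_cases i
  · exact contDiff_const
  · show ContDiff ℝ 1 fun x : ℝ × ℝ × ℝ => ρ₀ - x.2.1 * Real.cos x.1
    fun_prop
  · show ContDiff ℝ 1 fun x : ℝ × ℝ × ℝ => x.2.1 * Real.sin x.1
    fun_prop
  · show ContDiff ℝ 1 fun x : ℝ × ℝ × ℝ =>
      -(ρ₀ * x.2.2 * Real.cos x.1 - x.2.1 * Real.sin x.1)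
    fun_prop
  · show ContDiff ℝ 1 fun x : ℝ × ℝ × ℝ =>
      ρ₀ * x.2.2 * Real.sin x.1 + x.2.1 * Real.cos x.1 - ρ₀
    fun_prop

lemma hasDerivAt_lensVec (ρ₀ c : ℝ) : HasDerivAt (fun s => lensVec ρ₀ 0 s ρ₀ (ρ₀ * (c * s)))
    ![0, 0, ρ₀, ρ₀ * (1 - c), 0] 0 := by
  have hs := Real.hasDerivAt_sin 0
  have hc := Real.hasDerivAt_cos 0
  have hw : HasDerivAt (fun s : ℝ => ρ₀ * (c * s)) (ρ₀ * c) 0 := by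
    simpa using ((hasDerivAt_id (0 : ℝ)).const_mul c).const_mul ρ₀
  refine hasDerivAt_pi.2 fun i => ?_
  fin_cases i
  · exact hasDerivAt_const _ _
  · exact ((hc.const_mul ρ₀).const_sub ρ₀).congr_deriv (by simp)
  · exact (hs.const_mul ρ₀).congr_deriv (by simp)
  · exact ((hw.mul hc).sub (hs.const_mul ρ₀)).neg.congr_deriv (by simp; ring)
  · exact (((hw.mul hs).add (hc.const_mul ρ₀)).sub_const ρ₀).congr_deriv (by simp)

lemma eventually_isAlmostLinear {n ρ₀ d₀ k ε : ℝ} (hn : 1 < n) (hρ : 0 < ρ₀) (hd : 0 < d₀)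
    (hk : ρ₀ = k * d₀) (hε : 0 < ε) : ∀ᶠ x in 𝓝 ((0, ρ₀, 0) : ℝ × ℝ × ℝ),
      IsAlmostLinear n ρ₀ d₀ k ε x.1 x.2.1 x.2.2 := by
  have hΔ := Delta_pos hn
  have hV := (contDiff_lensVec ρ₀).contDiffAt (x := (0, ρ₀, 0))
  have hV0 : lensVec ρ₀ 0 0 ρ₀ (ρ₀ * 0) = 0 := by rw [mul_zero, lensVec_zero]
  have hreg := colorRegular_zero hn hρ
  have hτ := contDiffAt_tau (ρ₀ := ρ₀) (y := ((0, ρ₀, 0) : ℝ × ℝ × ℝ)) hn contDiffAt_fst hV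
    (by rw [hV0]; exact hreg.1)
  have hμ := contDiffAt_mu (ρ₀ := ρ₀) (y := ((0, ρ₀, 0) : ℝ × ℝ × ℝ)) hn contDiffAt_fst hV
    (by rw [hV0]; exact hreg.1)
  have hD := contDiffAt_D (ρ₀ := ρ₀) (d₀ := d₀) (y := ((0, ρ₀, 0) : ℝ × ℝ × ℝ)) hn contDiffAt_fst
    hV (by rw [hV0]; exact hreg.1) (by rw [hV0]; exact hreg.2.1)
  have hτ0 : 1 < n * tau n ρ₀ 0 (lensVec ρ₀ 0 0 ρ₀ (ρ₀ * 0)) := by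
    rw [hV0, tau_zero hn hρ, mul_one]; exact hn
  have hμ0 : ∀ r, mu n ρ₀ 0 (lensVec ρ₀ 0 0 r (ρ₀ * 0)) = 0 := fun r => by simp [mu]
  have hpath := fun c => (hasDerivAt_lensVec ρ₀ c).hasDerivWithinAt (s := univ)
  have hz : ∀ c : ℝ, lensVec ρ₀ 0 0 ρ₀ (ρ₀ * (c * 0)) = 0 := fun c => by rw [mul_zero, hV0]
  have e1 : ∀ᶠ x in 𝓝 ((0, ρ₀, 0) : ℝ × ℝ × ℝ),
      1 < n * tau n ρ₀ x.1 (lensVec ρ₀ 0 x.1 x.2.1 (ρ₀ * x.2.2)) :=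
    continuousAt_const.eventually_lt (continuousAt_const.mul hτ.continuousAt) hτ0
  have e2 := eventually_almost_linear (ε := ε) (α := 1 + k) (β := -(1 / Delta n))
    (G := fun x : ℝ × ℝ × ℝ => (x.2.1 * Real.sin x.1 +
      D n ρ₀ d₀ x.1 (lensVec ρ₀ 0 x.1 x.2.1 (ρ₀ * x.2.2)) *
      mu n ρ₀ x.1 (lensVec ρ₀ 0 x.1 x.2.1 (ρ₀ * x.2.2))) / d₀) hρ
    ((ContDiffAt.add (by fun_prop) (hD.mul hμ)).div_const _)
    (fun r _ => by simp only [hμ0]; simp) (fun c => by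
      have h := hasDerivWithinAt_univ.1 (hasDerivWithinAt_F1 (d₀ := d₀) hn (hpath c)
        (by rw [hz]; exact hreg.1) (by rw [hz]; exact hreg.2.1))
      refine (h.div_const d₀).congr_deriv ?_
      rw [hz, dF1_zero hn hρ]
      have e := one_div_add_one_div_Delta hn
      simp
      field_simp at e ⊢
      rw [hk]
      linear_combination d₀ * e) hε
  have e3 := eventually_almost_linear (ε := ε) (α := Delta n) (β := -1)
    (G := fun x : ℝ × ℝ × ℝ => n * mu n ρ₀ x.1 (lensVec ρ₀ 0 x.1 x.2.1 (ρ₀ * x.2.2)) /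
      (n * tau n ρ₀ x.1 (lensVec ρ₀ 0 x.1 x.2.1 (ρ₀ * x.2.2)) - 1)) hρ
    ((contDiffAt_const.mul hμ).div ((contDiffAt_const.mul hτ).sub contDiffAt_const)
      (sub_pos.2 hτ0).ne')
    (fun r _ => by simp only [hμ0]; simp) (fun c => by
      have hm := hasDerivWithinAt_univ.1 (hasDerivWithinAt_mu hn (hpath c)
        (by rw [hz]; exact hreg.1))
      have ht := hasDerivWithinAt_univ.1 (hasDerivWithinAt_tau hn (hpath c)
        (by rw [hz]; exact hreg.1))
      have hn1 : n - 1 ≠ 0 := by linarith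
      refine ((hm.const_mul n).div ((ht.const_mul n).sub_const 1)
        (by rw [hz, tau_zero hn hρ, mul_one]; exact hn1)).congr_deriv ?_
      simp only [hz, mu_zero, tau_zero hn hρ, dmu_zero hn hρ, Delta]
      simp
      field_simp
      ring) hε
  filter_upwards [e1, e2, e3] with x h1 h2 h3
  exact ⟨h1, h2, h3⟩

/-- The linearized equations, in coordinates that diagonalize them. -/
lemma LensData.exists_bound {nr nb ρ₀ d₀ k K p : ℝ} (h : LensData nr nb ρ₀ d₀ k K p) :
    ∃ M > 0, ∀ ε t₀ r₀ q₀ t₁ r₁ q₁, 0 ≤ ε → IsAlmostLinear nr ρ₀ d₀ k ε t₀ r₀ q₀ →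
      IsAlmostLinear nb ρ₀ d₀ k ε t₁ r₁ q₁ →
      r₀ * Real.sin t₀ + D nr ρ₀ d₀ t₀ (lensVec ρ₀ 0 t₀ r₀ (ρ₀ * q₀)) *
        mu nr ρ₀ t₀ (lensVec ρ₀ 0 t₀ r₀ (ρ₀ * q₀)) =
      r₁ * Real.sin t₁ + D nb ρ₀ d₀ t₁ (lensVec ρ₀ 0 t₁ r₁ (ρ₀ * q₁)) *
        mu nb ρ₀ t₁ (lensVec ρ₀ 0 t₁ r₁ (ρ₀ * q₁)) →
      nr * mu nr ρ₀ t₀ (lensVec ρ₀ 0 t₀ r₀ (ρ₀ * q₀)) *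
        (nb * tau nb ρ₀ t₁ (lensVec ρ₀ 0 t₁ r₁ (ρ₀ * q₁)) - 1) =
      nb * mu nb ρ₀ t₁ (lensVec ρ₀ 0 t₁ r₁ (ρ₀ * q₁)) *
        (nr * tau nr ρ₀ t₀ (lensVec ρ₀ 0 t₀ r₀ (ρ₀ * q₀)) - 1) →
      |(K - Delta nb) * (q₀ - K * t₀) + (Delta nr - K) * (q₁ - K * t₁)| ≤ M * ε *
        (|q₀ - K * t₀| + |q₀ - (Delta nr + Delta nb - K) * t₀| +
          |q₁ - K * t₁| + |q₁ - (Delta nr + Delta nb - K) * t₁|) ∧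
      |(Delta nr - K) * (q₀ - (Delta nr + Delta nb - K) * t₀) +
        (K - Delta nb) * (q₁ - (Delta nr + Delta nb - K) * t₁)| ≤ M * ε *
        (|q₀ - K * t₀| + |q₀ - (Delta nr + Delta nb - K) * t₀| +
          |q₁ - K * t₁| + |q₁ - (Delta nr + Delta nb - K) * t₁|) := by
  have hDr := h.one_lt_Dr
  have hDb := h.one_lt_Db
  have hK := h.K_pos
  have hKr := h.K_lt
  have hKb := h.Db_lt_K
  have hθ : 0 < 2 * K - (Delta nr + Delta nb) := by linarith [h.lt_K]
  have hquad := h.quad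
  have hd := h.hd
  set θ := 2 * K - (Delta nr + Delta nb) with hθdef
  refine ⟨(Delta nr * Delta nb + Delta nr) * ((1 + K) / θ + 1), by positivity, ?_⟩
  intro ε t₀ r₀ q₀ t₁ r₁ q₁ hε h0 h1 hF hN
  have f0 := h0.face
  have f1 := h1.face
  have n0 := h0.normal
  have n1 := h1.normal
  rw [hF] at f0
  rw [(div_eq_div_iff (sub_pos.2 h0.one_lt).ne' (sub_pos.2 h1.one_lt).ne').2 hN] at n0
  generalize (r₁ * Real.sin t₁ + D nb ρ₀ d₀ t₁ (lensVec ρ₀ 0 t₁ r₁ (ρ₀ * q₁)) *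
        mu nb ρ₀ t₁ (lensVec ρ₀ 0 t₁ r₁ (ρ₀ * q₁))) / d₀ = a at f0 f1
  generalize nb * mu nb ρ₀ t₁ (lensVec ρ₀ 0 t₁ r₁ (ρ₀ * q₁)) /
    (nb * tau nb ρ₀ t₁ (lensVec ρ₀ 0 t₁ r₁ (ρ₀ * q₁)) - 1) = a' at n0 n1
  clear hF hN h0 h1
  set m := |t₀| + |q₀| + (|t₁| + |q₁|) with hm
  have hm0 : 0 ≤ m := by positivity
  have e1 : |((1 + k) * t₀ + -(1 / Delta nr) * q₀) - ((1 + k) * t₁ + -(1 / Delta nb) * q₁)| ≤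
      ε * m := by
    rw [abs_le] at *
    constructor <;> rw [hm, mul_add] <;> linarith
  have e2 : |(Delta nr * t₀ + -1 * q₀) - (Delta nb * t₁ + -1 * q₁)| ≤ ε * m := by
    rw [abs_le] at *
    constructor <;> rw [hm, mul_add] <;> linarith
  generalize hx : ((1 + k) * t₀ + -(1 / Delta nr) * q₀) - ((1 + k) * t₁ + -(1 / Delta nb) * q₁) = x
    at e1
  generalize hy : (Delta nr * t₀ + -1 * q₀) - (Delta nb * t₁ + -1 * q₁) = y at e2
  have hx' : Delta nr * Delta nb * x = (1 + k) * Delta nr * Delta nb * (t₀ - t₁) -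
      Delta nb * q₀ + Delta nr * q₁ := by
    rw [← hx]
    field_simp
    ring
  -- For κ equal to either root of the quadratic, this combination of the face and normal equations
  -- involves only the coordinate q - κ t at the two points.
  have hcomb : ∀ κ, 0 ≤ κ → κ ≤ Delta nr → |Delta nr * Delta nb * x - κ * y| ≤
      (Delta nr * Delta nb + Delta nr) * (ε * m) := by
    intro κ h0 h1
    have hDD : 0 ≤ Delta nr * Delta nb := by positivity
    refine (abs_sub _ _).trans ?_
    rw [abs_mul (_ * _), abs_mul κ, abs_of_nonneg h0, abs_of_nonneg hDD, add_mul]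
    gcongr
  -- The roots are distinct, with difference θ, so t and q can be recovered from the two diagonal
  -- coordinates.
  have htq : ∀ t q : ℝ, |t| + |q| ≤ ((1 + K) / θ + 1) *
      (|q - K * t| + |q - (Delta nr + Delta nb - K) * t|) := by
    intro t q
    generalize hu : q - K * t = u
    generalize hv : q - (Delta nr + Delta nb - K) * t = v
    have ht : t = (v - u) / θ := by
      rw [eq_div_iff hθ.ne', ← hu, ← hv]
      ring
    have ht' : |t| ≤ (|u| + |v|) / θ := by
      rw [ht, abs_div, abs_of_pos hθ]
      gcongr
      rw [add_comm]
      exact abs_sub _ _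
    have hq : |q| ≤ |u| + K * |t| := by
      have : q = u + K * t := by linarith
      rw [this]
      refine (abs_add_le _ _).trans ?_
      rw [abs_mul, abs_of_pos hK]
    have : K * |t| ≤ K * ((|u| + |v|) / θ) := by gcongr
    have e : ((1 + K) / θ + 1) * (|u| + |v|) =
        (|u| + |v|) / θ + K * ((|u| + |v|) / θ) + (|u| + |v|) := by ring
    rw [e]
    linarith [abs_nonneg v]
  have hmb : (Delta nr * Delta nb + Delta nr) * (ε * m) ≤
      (Delta nr * Delta nb + Delta nr) * ((1 + K) / θ + 1) * ε *
      (|q₀ - K * t₀| + |q₀ - (Delta nr + Delta nb - K) * t₀| +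
          |q₁ - K * t₁| + |q₁ - (Delta nr + Delta nb - K) * t₁|) := by
    have := add_le_add (htq t₀ q₀) (htq t₁ q₁)
    rw [← hm, ← mul_add] at this
    have h2 := mul_le_mul_of_nonneg_left this
      (show 0 ≤ (Delta nr * Delta nb + Delta nr) * ε by positivity)
    refine le_trans (le_of_eq (by ring)) (h2.trans (le_of_eq (by ring)))
  constructor
  · refine le_trans (le_of_eq (congrArg _ ?_)) ((hcomb K hK.le hKr.le).trans hmb)
    rw [hx', ← hy]
    linear_combination (t₁ - t₀) * hquad
  · refine le_trans (le_of_eq (congrArg _ ?_))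
      ((hcomb (Delta nr + Delta nb - K) (by linarith) (by linarith)).trans hmb)
    rw [hx', ← hy]
    linear_combination (t₁ - t₀) * hquad

/-- Up to the error, |u| grows by b/c and |v| shrinks by c/b, so |u| - η|v| must increase strictly
unless both coordinates vanish. -/
lemma eq_zero_of_hyperbolic {b c η ε u₀ v₀ u₁ v₁ : ℝ} (hc : 0 < c) (hcb : c < b) (hη : 0 < η)
    (hη1 : η ≤ 1 / 2) (hε : 0 ≤ ε) (hε1 : 16 * ε ≤ c * η * (b - c) / b)
    (h1 : |b * u₀ + c * u₁| ≤ ε * (|u₀| + |v₀| + |u₁| + |v₁|))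
    (h2 : |c * v₀ + b * v₁| ≤ ε * (|u₀| + |v₀| + |u₁| + |v₁|))
    (h : |u₁| - η * |v₁| ≤ |u₀| - η * |v₀|) : u₀ = 0 ∧ v₀ = 0 := by
  have hb : 0 < b := hc.trans hcb
  have h1' : b * |u₀| ≤ c * |u₁| + ε * (|u₀| + |v₀| + |u₁| + |v₁|) := by
    have := abs_sub (b * u₀ + c * u₁) (c * u₁)
    rw [add_sub_cancel_right, abs_mul, abs_mul, abs_of_pos hb, abs_of_pos hc] at this
    linarith
  have h2' : b * |v₁| ≤ c * |v₀| + ε * (|u₀| + |v₀| + |u₁| + |v₁|) := by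
    have := abs_sub (c * v₀ + b * v₁) (c * v₀)
    rw [add_sub_cancel_left, abs_mul, abs_mul, abs_of_pos hb, abs_of_pos hc] at this
    linarith
  rw [← abs_eq_zero, ← abs_eq_zero (a := v₀)]
  have a0 := abs_nonneg u₀
  have a1 := abs_nonneg u₁
  have b0 := abs_nonneg v₀
  have b1 := abs_nonneg v₁
  generalize |u₀| = x at *
  generalize |u₁| = y at *
  generalize |v₀| = z at *
  generalize |v₁| = w at *
  clear h1 h2
  set κ := c * η / b with hκ
  have hκ0 : 0 < κ := by positivity
  have hκ1 : κ ≤ 1 / 2 := by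
    rw [hκ, div_le_iff₀ hb]
    nlinarith
  have hεκ : 16 * ε ≤ κ * (b - c) := by
    rw [hκ]
    refine hε1.trans (le_of_eq (by ring))
  have hεθ : 32 * ε ≤ b - c := by nlinarith
  have hηw : η * w ≤ w := by nlinarith
  have hηz : 0 ≤ η * z := by positivity
  have hy : y ≤ x + w := by linarith
  have hw : w ≤ x + z := by
    have e1 : ε * (x + z + y + w) ≤ ε * (2 * x + z + 2 * w) :=
      mul_le_mul_of_nonneg_left (by linarith) hε
    have e2 : (b - 2 * ε) * w ≤ (b - 2 * ε) * (x + z) := by nlinarith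
    exact le_of_mul_le_mul_left e2 (by linarith)
  have hM : ε * (x + z + y + w) ≤ ε * (4 * (x + z)) :=
    mul_le_mul_of_nonneg_left (by linarith) hε
  -- Sum of `h1'`, κ times `h2'` and c times `h`; κ b = c η is chosen so that |v₁| cancels.
  have e : (b - c) * x + κ * (b - c) * z ≤ (1 + κ) * (ε * (x + z + y + w)) := by
    have hκb : κ * b = c * η := by rw [hκ]; field_simp
    have e3 := mul_le_mul_of_nonneg_left h2' hκ0.le
    have e4 := mul_le_mul_of_nonneg_left h hc.le
    have e5 : κ * (b * w) = c * η * w := by rw [← hκb]; ring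
    have e6 : κ * (b - c) * z = c * η * z - κ * (c * z) := by rw [← hκb]; ring
    rw [e6]
    nlinarith
  have e' : (1 + κ) * (ε * (x + z + y + w)) ≤ 2 * (ε * (4 * (x + z))) := by
    refine mul_le_mul (by linarith) hM (by positivity) (by norm_num)
  have hεκ2 : κ * (b - c) ≤ b - c := by nlinarith
  have hpos : 0 < κ * (b - c) := mul_pos hκ0 (sub_pos.2 hcb)
  have hsum : κ * (b - c) * (x + z) ≤ 0 := by nlinarith
  have : x + z ≤ 0 := by
    by_contra! hc
    nlinarith
  exact ⟨by linarith, by linarith⟩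

/-- In the cone |u| ≤ η|v| the difference v - u is comparable to v, which contracts. In the
application v - u is a positive multiple of t. -/
lemma abs_sub_le_of_hyperbolic {b c η ε u₀ v₀ u₁ v₁ : ℝ} (hc : 0 < c) (hcb : c < b) (hη : 0 < η)
    (hηbc : 2 * (b + c) * η = b - c) (hε : 0 ≤ ε) (hε1 : 32 * ε ≤ b - c)
    (h2 : |c * v₀ + b * v₁| ≤ ε * (|u₀| + |v₀| + |u₁| + |v₁|))
    (h0 : |u₀| ≤ η * |v₀|) (h1 : |u₁| ≤ η * |v₁|) : |v₁ - u₁| ≤ |v₀ - u₀| := by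
  have hb : 0 < b := hc.trans hcb
  have h2' : b * |v₁| ≤ c * |v₀| + ε * (|u₀| + |v₀| + |u₁| + |v₁|) := by
    have := abs_sub (c * v₀ + b * v₁) (c * v₀)
    rw [add_sub_cancel_left, abs_mul, abs_mul, abs_of_pos hb, abs_of_pos hc] at this
    linarith
  have l1 := abs_sub v₁ u₁
  have l0 := abs_sub_abs_le_abs_sub v₀ u₀
  have b0 := abs_nonneg v₀
  have b1 := abs_nonneg v₁
  generalize |u₀| = x at *
  generalize |u₁| = y at *
  generalize |v₀| = z at *
  generalize |v₁| = w at *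
  have hη1 : η ≤ 1 / 2 := by nlinarith
  refine l1.trans (le_trans ?_ l0)
  have e1 : ε * (x + z + y + w) ≤ ε * (2 * z + 2 * w) := by gcongr <;> nlinarith
  have e2 : (b - 2 * ε) * w ≤ (c + 2 * ε) * z := by linarith
  have e3 : (b - 2 * ε) * ((1 + η) * w) ≤ (b - 2 * ε) * ((1 - η) * z) := by
    calc (b - 2 * ε) * ((1 + η) * w) = (1 + η) * ((b - 2 * ε) * w) := by ring
      _ ≤ (1 + η) * ((c + 2 * ε) * z) := by gcongr
      _ ≤ _ := by
        have : (1 + η) * (c + 2 * ε) ≤ (b - 2 * ε) * (1 - η) := by nlinarith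
        nlinarith
  have e4 := le_of_mul_le_mul_left e3 (by linarith)
  linarith

/-- The matrix with rows (b, c) and (c, b) acts on q₀ + q₁ and q₀ - q₁ by b + c and b - c. -/
lemma abs_add_abs_le_of_symmetric {b c q₀ q₁ : ℝ} (hcb : c < b) (hc : 0 < c) :
    (b - c) * (|q₀| + |q₁|) ≤ |b * q₀ + c * q₁| + |c * q₀ + b * q₁| := by
  have h1 : (b - c) * |q₀ + q₁| ≤ |b * q₀ + c * q₁| + |c * q₀ + b * q₁| := by
    have := abs_add_le (b * q₀ + c * q₁) (c * q₀ + b * q₁)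
    have e : b * q₀ + c * q₁ + (c * q₀ + b * q₁) = (b + c) * (q₀ + q₁) := by ring
    rw [e, abs_mul, abs_of_pos (by linarith)] at this
    nlinarith [abs_nonneg (q₀ + q₁)]
  have h2 : (b - c) * |q₀ - q₁| ≤ |b * q₀ + c * q₁| + |c * q₀ + b * q₁| := by
    have := abs_sub (b * q₀ + c * q₁) (c * q₀ + b * q₁)
    have e : b * q₀ + c * q₁ - (c * q₀ + b * q₁) = (b - c) * (q₀ - q₁) := by ring
    rwa [e, abs_mul, abs_of_pos (by linarith)] at this
  have : |q₀| + |q₁| ≤ max |q₀ + q₁| |q₀ - q₁| := by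
    rcases abs_cases q₀ with ⟨h, _⟩ | ⟨h, _⟩ <;> rcases abs_cases q₁ with ⟨h', _⟩ | ⟨h', _⟩ <;>
      rw [h, h', le_max_iff]
    · left; rw [le_abs]; left; linarith
    · right; rw [le_abs]; left; linarith
    · right; rw [le_abs]; right; linarith
    · left; rw [le_abs]; right; linarith
  rcases le_max_iff.1 this with h | h
  · exact (mul_le_mul_of_nonneg_left h (by linarith)).trans h1
  · exact (mul_le_mul_of_nonneg_left h (by linarith)).trans h2

/-- Treating the terms in t and t' as perturbations of size K δ leaves an invertible symmetric
system for the slopes. This gives the a priori slope bound that closes the bootstrap. -/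
lemma abs_add_abs_le_of_near_symmetric {b c ε K K' δ q₀ q₁ t t' : ℝ} (hcb : c < b) (hc : 0 < c)
    (hε : 0 ≤ ε) (hε2 : 32 * ε ≤ b - c) (hK' : 0 ≤ K') (hKK' : K' ≤ K) (hδ : 0 ≤ δ)
    (ht : |t| ≤ δ) (ht' : |t'| ≤ δ)
    (h1 : |b * (q₀ - K * t) + c * (q₁ - K * t')| ≤
      ε * (|q₀ - K * t| + |q₀ - K' * t| + |q₁ - K * t'| + |q₁ - K' * t'|))
    (h2 : |c * (q₀ - K' * t) + b * (q₁ - K' * t')| ≤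
      ε * (|q₀ - K * t| + |q₀ - K' * t| + |q₁ - K * t'| + |q₁ - K' * t'|)) :
    (b - c) * (|q₀| + |q₁|) ≤ 6 * (b * (K * δ)) := by
  have hb : 0 < b := hc.trans hcb
  have hK : 0 ≤ K := hK'.trans hKK'
  have tri : ∀ κ q y : ℝ, 0 ≤ κ → κ ≤ K → |y| ≤ δ → |q - κ * y| ≤ |q| + K * δ := by
    intro κ q y h0 h1 hy
    refine (abs_sub _ _).trans ?_
    rw [abs_mul, abs_of_nonneg h0]
    gcongr
  have lin : ∀ α β κ y z : ℝ, 0 ≤ κ → κ ≤ K → |y| ≤ δ → |z| ≤ δ → 0 ≤ α → 0 ≤ β → α ≤ b → β ≤ b →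
      |α * q₀ + β * q₁| ≤ |α * (q₀ - κ * y) + β * (q₁ - κ * z)| + 2 * (b * (K * δ)) := by
    intro α β κ y z k0 k1 hy hz α0 β0 α1 β1
    have e : α * q₀ + β * q₁ = (α * (q₀ - κ * y) + β * (q₁ - κ * z)) + α * (κ * y) +
      β * (κ * z) := by ring
    rw [e]
    refine (abs_add_three _ _ _).trans ?_
    rw [abs_mul α, abs_mul κ, abs_mul β, abs_mul κ, abs_of_nonneg k0, abs_of_nonneg α0,
      abs_of_nonneg β0]
    have : α * (κ * |y|) ≤ b * (K * δ) := by gcongr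
    have : β * (κ * |z|) ≤ b * (K * δ) := by gcongr
    linarith
  have l1 := lin b c K t t' hK le_rfl ht ht' hb.le hc.le le_rfl hcb.le
  have l2 := lin c b K' t t' hK' hKK' ht ht' hc.le hb.le hcb.le le_rfl
  have hsym := abs_add_abs_le_of_symmetric (q₀ := q₀) (q₁ := q₁) hcb hc
  have hKδ : 0 ≤ K * δ := by positivity
  have hm : ε * (|q₀ - K * t| + |q₀ - K' * t| + |q₁ - K * t'| + |q₁ - K' * t'|) ≤
      ε * (4 * (|q₀| + |q₁| + K * δ)) := by
    refine mul_le_mul_of_nonneg_left ?_ hε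
    have := tri K q₀ t hK le_rfl ht
    have := tri K' q₀ t hK' hKK' ht
    have := tri K q₁ t' hK le_rfl ht'
    have := tri K' q₁ t' hK' hKK' ht'
    have := abs_nonneg q₀
    have := abs_nonneg q₁
    linarith
  have x1 : 32 * ε * (|q₀| + |q₁| + K * δ) ≤ (b - c) * (|q₀| + |q₁| + K * δ) := by gcongr
  have x2 : (b - c) * (K * δ) ≤ b * (K * δ) := by gcongr; linarith
  have x3 : 0 ≤ b * (K * δ) := by positivity
  rw [mul_add (b - c)] at x1
  have x4 : ε * (4 * (|q₀| + |q₁| + K * δ)) = (32 * ε * (|q₀| + |q₁| + K * δ)) / 8 := by ring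
  linarith

/-- A bound for a function at `φ t` from a bound of its derivative on `φ([-s, s])`. -/
lemma abs_sub_le_of_comp {ρ w φ : ℝ → ℝ} {δ s B : ℝ}
    (hρ : ∀ t ∈ Icc (-δ) δ, HasDerivWithinAt ρ (w t) (Icc (-δ) δ) t)
    (hφ : ContinuousOn φ (Icc (-δ) δ)) (hmap : MapsTo φ (Icc (-δ) δ) (Icc (-δ) δ)) (hφ0 : φ 0 = 0)
    (hs : s ≤ δ) (hB : ∀ t ∈ Icc (-s) s, |w (φ t)| ≤ B) {t : ℝ} (ht : t ∈ Icc (-s) s) :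
    |ρ (φ t) - ρ 0| ≤ B * |φ t| := by
  have hsub : Icc (-s) s ⊆ Icc (-δ) δ := Icc_subset_Icc (by linarith) hs
  have h0 : (0 : ℝ) ∈ Icc (-s) s := abs_le_mem_Icc ht (by simp)
  have hu : uIcc 0 t ⊆ Icc (-s) s := uIcc_subset_Icc h0 ht
  have himg : uIcc 0 (φ t) ⊆ φ '' uIcc 0 t := by
    have := intermediate_value_uIcc (hφ.mono (hu.trans hsub))
    rwa [hφ0] at this
  have hI : uIcc 0 (φ t) ⊆ Icc (-δ) δ := uIcc_subset_Icc (hsub h0) (hmap (hsub ht))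
  have := (convex_uIcc 0 (φ t)).norm_image_sub_le_of_norm_hasDerivWithin_le (f := ρ) (f' := w)
    (C := B) (x := 0) (y := φ t) (fun y hy => (hρ y (hI hy)).mono hI) (fun y hy => ?_)
    left_mem_uIcc right_mem_uIcc
  · simpa [Real.norm_eq_abs] using this
  · obtain ⟨v, hv, rfl⟩ := himg hy
    exact hB v (hu hv)

/-- The map `φ` of a solution of the lens problem does not increase absolute values. -/
theorem LensData.exists_abs_phi_le {nr nb ρ₀ d₀ k K p : ℝ} (h : LensData nr nb ρ₀ d₀ k K p) :
    ∃ δ₂ > 0, δ₂ < Real.pi / 2 ∧ ∀ δ, 0 < δ → δ ≤ δ₂ → ∀ ρ φ, IsLensSolution nr nb ρ₀ d₀ δ ρ φ →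
      ∀ t ∈ Icc (-δ) δ, |φ t| ≤ |t| ∧ 1 < nr * tau nr ρ₀ t (lensCurve ρ₀ δ ρ φ t) ∧
        1 < nb * tau nb ρ₀ t (lensCurve ρ₀ δ ρ φ t) := by
  obtain ⟨M, hM, hbound⟩ := h.exists_bound
  have hρ := h.hρ
  have hK := h.K_pos
  have hDb := h.one_lt_Db
  generalize hK' : Delta nr + Delta nb - K = K' at hbound
  have hc : 0 < Delta nr - K := sub_pos.2 h.K_lt
  have hcb : Delta nr - K < K - Delta nb := by linarith [h.lt_K]
  have hKK' : K' < K := by linarith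
  have hK'0 : 0 < K' := by linarith
  have hθ : K - Delta nb - (Delta nr - K) = K - K' := by linarith
  generalize K - Delta nb = b at *
  generalize Delta nr - K = c at *
  have hb : 0 < b := hc.trans hcb
  -- This opening leaves the margin (1 - η) b - (1 + η) c = (b - c)/2 to absorb the errors.
  set η := (b - c) / (2 * (b + c)) with hη
  have hθ0 : 0 < b - c := sub_pos.2 hcb
  have hη0 : 0 < η := by positivity
  have hηbc : 2 * (b + c) * η = b - c := by rw [hη]; field_simp
  have hη1 : η ≤ 1 / 2 := by nlinarith
  set ε := c * η * (b - c) / b / 16 with hε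
  have hε0 : 0 < ε := by positivity
  have hε1 : 16 * ε ≤ c * η * (b - c) / b := le_of_eq (by rw [hε]; ring)
  have hε2 : 32 * ε ≤ b - c := by
    have : c * η * (b - c) / b ≤ (b - c) / 2 := by
      rw [div_le_iff₀ hb]
      have : c * η ≤ b * (1 / 2) := by gcongr
      nlinarith
    linarith
  have hMε : M * (ε / M) = ε := by field_simp
  have hεM : 0 < ε / M := by positivity
  obtain ⟨r₁, hr₁, hbox⟩ := Metric.eventually_nhds_iff.1
    ((eventually_isAlmostLinear h.hr hρ h.hd h.hk hεM).and
      (eventually_isAlmostLinear h.hb hρ h.hd h.hk hεM))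
  obtain ⟨r₀, hr₀, hbox⟩ : ∃ r₀ > 0, ∀ t r q : ℝ, |t| ≤ r₀ → |r - ρ₀| ≤ r₀ → |q| ≤ r₀ →
      IsAlmostLinear nr ρ₀ d₀ k (ε / M) t r q ∧ IsAlmostLinear nb ρ₀ d₀ k (ε / M) t r q := by
    refine ⟨r₁ / 2, by positivity, fun t r q ht hr hq => hbox (y := (t, r, q)) ?_⟩
    have e : dist (t, r, q) ((0, ρ₀, 0) : ℝ × ℝ × ℝ) =
      max |t - 0| (max |r - ρ₀| |q - 0|) := rfl
    rw [e, sub_zero, sub_zero]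
    exact max_lt (by linarith) (max_lt (by linarith) (by linarith))
  -- The bound 1/ρ₀ keeps |ρ - ρ₀| ≤ r₀ while |q| ≤ r₀; the last one turns the a priori slope bound
  -- 6 b K δ/(b - c) into r₀/2.
  refine ⟨min (min 1 r₀) (min (1 / ρ₀) (r₀ * (b - c) / (12 * K * b))), by positivity, ?_, ?_⟩
  · exact ((min_le_left _ _).trans (min_le_left _ _)).trans_lt (by linarith [Real.pi_gt_three])
  intro δ hδ hδ₂ ρ φ hs
  simp only [le_min_iff] at hδ₂
  obtain ⟨⟨hδ1, hδr⟩, hδρ, hδb⟩ := hδ₂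
  rw [le_div_iff₀ hρ] at hδρ
  rw [le_div_iff₀ (by positivity)] at hδb
  have hδπ : δ < Real.pi / 2 := by linarith [Real.pi_gt_three]
  have hcurve := hs.isLensCurve hδ
  obtain ⟨hφ0, hw0⟩ := hs.origin hδ h.hr h.hrb hδπ
  have hwc := (hs.contDiffOn_derivWithin hδ).continuousOn
  have hφc := hs.phi_contDiffOn.continuousOn
  have hmap := hs.phi_mapsTo
  have hρd := hcurve.rho_deriv
  have heq := fun t (ht : t ∈ Icc (-δ) δ) => hs.equations hδ h.hr h.hrb hρ hδπ rfl rfl ht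
  have hρ0 := hs.rho_zero
  set w := derivWithin ρ (Icc (-δ) δ) with hw
  set q : ℝ → ℝ := fun t => w t / ρ₀ with hq
  have hqw : ∀ t, ρ₀ * q t = w t := fun t => by simp only [hq]; field_simp
  have hwq : ∀ t r, |q t| ≤ r → |w t| ≤ ρ₀ * r := fun t r ht => by
    rw [← hqw, abs_mul, abs_of_pos hρ]
    gcongr
  have hqc : ContinuousOn q (Icc (-δ) δ) := hwc.div_const _
  have hmem : ∀ t ∈ Icc (-δ) δ, |t| ≤ r₀ := fun t ht => (abs_le.2 ht).trans hδr
  have hE : ∀ t ∈ Icc (-δ) δ, |ρ t - ρ₀| ≤ r₀ → |q t| ≤ r₀ → |ρ (φ t) - ρ₀| ≤ r₀ →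
      |q (φ t)| ≤ r₀ →
      |b * (q t - K * t) + c * (q (φ t) - K * φ t)| ≤ ε *
        (|q t - K * t| + |q t - K' * t| + |q (φ t) - K * φ t| + |q (φ t) - K' * φ t|) ∧
      |c * (q t - K' * t) + b * (q (φ t) - K' * φ t)| ≤ ε *
        (|q t - K * t| + |q t - K' * t| + |q (φ t) - K * φ t| + |q (φ t) - K' * φ t|) := by
    intro t ht a1 a2 a3 a4
    obtain ⟨-, e3, e1, -⟩ := heq t ht
    have := hbound (ε / M) t (ρ t) (q t) (φ t) (ρ (φ t)) (q (φ t)) hεM.le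
      (hbox _ _ _ (hmem t ht) a1 a2).1 (hbox _ _ _ (hmem _ (hmap ht)) a3 a4).2
    rw [hqw, hqw, hMε] at this
    exact this e1 e3
  have hρclose : ∀ s, s ≤ δ → (∀ t ∈ Icc (-s) s, max |q t| |q (φ t)| ≤ r₀) → ∀ t ∈ Icc (-s) s,
      |ρ t - ρ₀| ≤ r₀ ∧ |ρ (φ t) - ρ₀| ≤ r₀ := by
    intro s hsδ hb t ht
    have hsub : Icc (-s) s ⊆ Icc (-δ) δ := Icc_subset_Icc (by linarith) hsδ
    have hfin : ∀ y ∈ Icc (-δ) δ, ρ₀ * r₀ * |y| ≤ r₀ := fun y hy => by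
      have : ρ₀ * r₀ * |y| ≤ ρ₀ * r₀ * δ := by gcongr; exact abs_le.2 hy
      nlinarith
    have h1 := abs_sub_le_of_comp (φ := id) hρd continuousOn_id (mapsTo_id _) rfl hsδ
      (fun t ht => hwq t r₀ ((le_max_left _ _).trans (hb t ht))) ht
    have h2 := abs_sub_le_of_comp hρd hφc hmap hφ0 hsδ
      (fun t ht => hwq _ r₀ ((le_max_right _ _).trans (hb t ht))) ht
    rw [hρ0] at h1 h2
    exact ⟨h1.trans (hfin _ (hsub ht)), h2.trans (hfin _ (hmap (hsub ht)))⟩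
  -- The length of the interval may not depend on the solution, for which no slope bound is given.
  -- The bootstrap follows q and q ∘ φ together because φ(t) may still leave [-s, s].
  have hsmall : ∀ t ∈ Icc (-δ) δ, max |q t| |q (φ t)| ≤ r₀ / 2 := by
    refine le_of_bootstrap (r := r₀) ?_ (by linarith) ?_ ?_
    · exact ContinuousOn.sup hqc.abs (hqc.comp hφc hmap).abs
    · simp only [hφ0, hq, hw0]
      simp
      positivity
    intro s hs0 hsδ hb' t ht
    have hsub : Icc (-s) s ⊆ Icc (-δ) δ := Icc_subset_Icc (by linarith) hsδ
    obtain ⟨c1, c2⟩ := hρclose s hsδ hb' t ht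
    obtain ⟨g1, g2⟩ := max_le_iff.1 (hb' t ht)
    obtain ⟨b1, b2⟩ := hE t (hsub ht) c1 g1 c2 g2
    have ht' := abs_le.2 (hsub ht)
    have hφt' := abs_le.2 (hmap (hsub ht))
    generalize q t = q₀ at *
    generalize q (φ t) = q₁ at *
    have := abs_add_abs_le_of_near_symmetric hcb hc hε0.le hε2 hK'0.le hKK'.le hδ.le
      ht' hφt' b1 b2
    have hfin : (b - c) * (|q₀| + |q₁|) ≤ (b - c) * (r₀ / 2) := by linarith
    have := le_of_mul_le_mul_left hfin hθ0
    have a0 := abs_nonneg q₀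
    have a1 := abs_nonneg q₁
    exact max_le (by linarith) (by linarith)
  have hlarge : ∀ t ∈ Icc (-δ) δ, max |q t| |q (φ t)| ≤ r₀ := fun t ht =>
    (hsmall t ht).trans (by linarith)
  have hclose := hρclose δ le_rfl hlarge
  have hE' := fun t ht => hE t ht (hclose t ht).1 ((le_max_left _ _).trans (hlarge t ht))
    (hclose t ht).2 ((le_max_right _ _).trans (hlarge t ht))
  -- At a maximum point of |u| - η|v| on the compact interval, φ cannot increase this quantity, so u
  -- = v = 0 there and the maximum is 0.
  have hcone : ∀ t ∈ Icc (-δ) δ, |q t - K * t| ≤ η * |q t - K' * t| := by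
    obtain ⟨x, hx, hmax⟩ := isCompact_Icc.exists_isMaxOn (s := Icc (-δ) δ)
      ⟨0, hcurve.zero_mem⟩ (f := fun t => |q t - K * t| - η * |q t - K' * t|)
      (((hqc.sub (by fun_prop)).abs).sub (continuousOn_const.mul (hqc.sub (by fun_prop)).abs))
    obtain ⟨z1, z2⟩ := eq_zero_of_hyperbolic hc hcb hη0 hη1 hε0.le hε1 (hE' x hx).1 (hE' x hx).2
      (hmax (hmap hx))
    intro t ht
    have := hmax ht
    simp only [mem_ofPred_eq, z1, z2, abs_zero, mul_zero, sub_zero] at this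
    linarith
  intro t ht
  refine ⟨?_, ?_⟩
  · have := abs_sub_le_of_hyperbolic hc hcb hη0 hηbc hε0.le hε2 (hE' t ht).2 (hcone t ht)
      (hcone _ (hmap ht))
    have e : ∀ q y : ℝ, |q - K' * y - (q - K * y)| = (K - K') * |y| := fun q y => by
      have : q - K' * y - (q - K * y) = (K - K') * y := by ring
      rw [this, abs_mul, abs_of_pos (sub_pos.2 hKK')]
    rw [e, e] at this
    exact le_of_mul_le_mul_left this (sub_pos.2 hKK')
  · have := hbox _ _ _ (hmem t ht) (hclose t ht).1 ((le_max_left _ _).trans (hlarge t ht))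
    have h1 := this.1.one_lt
    have h2 := this.2.one_lt
    rw [hqw] at h1 h2
    exact ⟨h1, h2⟩

lemma abs_le_one_of_hasDerivWithinAt {φ : ℝ → ℝ} {φ' δ : ℝ} (hδ : 0 < δ)
    (h : HasDerivWithinAt φ φ' (Icc (-δ) δ) 0) (hφ : ∀ t ∈ Icc (-δ) δ, |φ t| ≤ |t|) :
    |φ'| ≤ 1 := by
  have h0 : φ 0 = 0 := by
    have := hφ 0 ⟨by linarith, hδ.le⟩
    rwa [abs_zero, abs_nonpos_iff] at this
  have hs := (hasDerivWithinAt_iff_tendsto_slope.1 (h.mono (Ioc_subset_Icc_self.trans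
    (Icc_subset_Icc_left (by linarith)) : Ioc 0 δ ⊆ Icc (-δ) δ))).abs
  have hne : (𝓝[Ioc 0 δ \ {0}] (0 : ℝ)).NeBot := by
    have : Ioc 0 δ \ {0} = Ioc 0 δ := sdiff_singleton_eq_self (by simp)
    rw [this]
    exact left_nhdsWithin_Ioc_neBot hδ
  refine le_of_tendsto hs (eventually_nhdsWithin_of_forall fun t ht => ?_)
  have ht0 : 0 < t := ht.1.1
  rw [slope_def_field, h0, sub_zero, sub_zero, abs_div, div_le_one (abs_pos.2 ht0.ne')]
  exact hφ t ⟨by linarith, ht.1.2⟩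

/-! ### From the lens to the functional system. -/

namespace IsLensCurve

variable {ρ₀ δ : ℝ} {ρ w : ℝ → ℝ} {Z Y : ℝ → Fin 5 → ℝ} (h : IsLensCurve ρ₀ δ ρ w Z Y)

include h

/-- Differentiation of ζ₅ + ρ₀ + ζ₄ tan t = (ρ₀ - ζ₂)/cos² t, an identity satisfied by all data
vectors of a lower face. -/
lemma deriv_Z4 (hδπ : δ < Real.pi / 2) {t : ℝ} (ht : t ∈ Icc (-δ) δ) :
    Y t 4 = h5 ρ₀ t (Z t) (Y t) := by
  have hcos : ∀ t ∈ Icc (-δ) δ, 0 < Real.cos t := fun t ht =>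
    Real.cos_pos_of_mem_Ioo ⟨by linarith [ht.1], by linarith [ht.2]⟩
  have hc := (hcos t ht).ne'
  have hi := hasDerivWithinAt_pi.1 (h.deriv t ht)
  have e := (((hi 4).add_const ρ₀).add ((Real.hasDerivAt_tan hc).hasDerivWithinAt.mul (hi 3))).sub
    (((hi 1).const_sub ρ₀).div ((Real.hasDerivAt_cos t).hasDerivWithinAt.pow 2)
      (pow_ne_zero 2 hc))
  have hzero : ∀ t ∈ Icc (-δ) δ,
      0 = Z t 4 + ρ₀ + Real.tan t * Z t 3 - (ρ₀ - Z t 1) / Real.cos t ^ 2 := by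
    intro t ht
    have hc := (hcos t ht).ne'
    rw [h.eq t ht]
    simp only [lensVec_1, lensVec_3, lensVec_4, Real.tan_eq_sin_div_cos]
    field_simp
    linear_combination -(ρ t * Real.cos t) * Real.sin_sq_add_cos_sq t
  have := (uniqueDiffOn_Icc (show -δ < δ by linarith [h.pos]) t ht).eq_deriv _ e
    ((hasDerivWithinAt_const t _ (0 : ℝ)).congr (fun s hs => (hzero s hs).symm) (hzero t ht).symm)
  rw [h5, ← h.deriv_Z1 ht]
  simp only [Real.tan_eq_sin_div_cos, Pi.pow_apply] at this ⊢
  rw [← h.deriv_Z1 ht] at this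
  have e2 : Y t 4 = Y t 4 - 0 := (sub_zero _).symm
  rw [e2, ← this]
  push_cast
  field_simp
  ring

end IsLensCurve

namespace IsLensSolution

variable {nr nb ρ₀ d₀ δ k K p : ℝ} {ρ φ : ℝ → ℝ} (h : IsLensSolution nr nb ρ₀ d₀ δ ρ φ)

include h

/-- The initial velocity of a solution of the lens problem. -/
lemma derivWithin_lensCurve_zero (hδ : 0 < δ) (hL : LensData nr nb ρ₀ d₀ k K p)
    (hδπ : δ < Real.pi / 2) (hφ : ∀ t ∈ Icc (-δ) δ, |φ t| ≤ |t|) :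
    derivWithin (lensCurve ρ₀ δ ρ φ) (Icc (-δ) δ) 0 = initialVelocity nr nb ρ₀ d₀ := by
  have hr := hL.hr
  have hb := hL.hb
  have hρ := hL.hρ
  have hd := hL.hd
  have hc := h.isLensCurve hδ
  have hZ0 := h.lensCurve_zero hδ hr hL.hrb hδπ
  have heq := fun t (ht : t ∈ Icc (-δ) δ) => h.equations hδ hr hL.hrb hρ hδπ rfl rfl ht
  have h0 := hc.zero_mem
  have hφ0 := (h.origin hδ hr hL.hrb hδπ).1
  have hp' := abs_le_one_of_hasDerivWithinAt hδ (h.hasDerivWithinAt_phi hδ h0) hφ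
  have hdφ := h.hasDerivWithinAt_phi hδ h0
  have hY1 := hc.deriv_Z1 h0
  have hY2 := hc.deriv_Z2 h0
  have hY4 := hc.deriv_Z4 hδπ h0
  have hud := uniqueDiffOn_Icc (show -δ < δ by linarith) 0 h0
  obtain ⟨e1, -⟩ := heq 0 h0
  have hZφ : lensCurve ρ₀ δ ρ φ (φ 0) = 0 := by rw [hφ0, hZ0]
  have hE : ∀ t ∈ Icc (-δ) δ, nr * mu nr ρ₀ t (lensCurve ρ₀ δ ρ φ t) *
        (nb * tau nb ρ₀ (φ t) (lensCurve ρ₀ δ ρ φ (φ t)) - 1) -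
      nb * mu nb ρ₀ (φ t) (lensCurve ρ₀ δ ρ φ (φ t)) *
        (nr * tau nr ρ₀ t (lensCurve ρ₀ δ ρ φ t) - 1) = 0 := fun t ht =>
    sub_eq_zero.2 (heq t ht).2.1
  have hmap := h.phi_mapsTo
  have hdb := hc.deriv (φ 0) (hmap h0)
  have hrr := hc.regular h0 hr
  have hrb := hc.regular (hmap h0) hb
  have m1 := (hasDerivWithinAt_mu hr (hc.deriv 0 h0) hrr.1).const_mul nr
  have m2 := ((hasDerivWithinAt_mu hb hdb hrb.1).comp 0 hdφ hmap).const_mul nb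
  have m3 := ((hasDerivWithinAt_tau hr (hc.deriv 0 h0) hrr.1).const_mul nr).sub_const 1
  have m4 := (((hasDerivWithinAt_tau hb hdb hrb.1).comp 0 hdφ hmap).const_mul nb).sub_const 1
  -- Parallelism of the normals, differentiated at 0, is the second equation for φ'(0) and ξ₄; the
  -- first is `e1`.
  have e2 := hud.eq_deriv _ ((m1.mul m4).sub (m2.mul m3))
    ((hasDerivWithinAt_const (0 : ℝ) _ (0 : ℝ)).congr hE (hE 0 h0))
  simp only [Function.comp_apply] at e2
  rw [hZφ, hφ0] at e1 e2
  rw [hZ0] at e1 e2 hY1 hY2 hY4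
  generalize derivWithin (lensCurve ρ₀ δ ρ φ) (Icc (-δ) δ) 0 = ξ at *
  have hY4 : ξ 4 = 0 := by rw [hY4]; simp [h5]
  simp only [Pi.zero_apply, zero_add] at hY1 hY2
  rw [dF1_zero hr hρ, dF1_zero hb hρ, hY2] at e1
  rw [mu_zero, mu_zero, tau_zero hr hρ, tau_zero hb hρ, dmu_zero hr hρ, dmu_zero hb hρ] at e2
  obtain ⟨q, hq⟩ : ∃ q, ξ 3 = ρ₀ * (1 - q) := ⟨1 - ξ 3 / ρ₀, by field_simp; ring⟩
  have hDr := hL.one_lt_Dr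
  have hDb := hL.one_lt_Db
  have hquot : ∀ Δ, 0 < Δ → ρ₀ * (1 - q) / (Δ * ρ₀) = 1 / Δ - q / Δ := fun Δ hΔ => by
    field_simp
  have fr := one_div_add_one_div_Delta hr
  have fb := one_div_add_one_div_Delta hb
  rw [hq, hquot _ (by linarith), hquot _ (by linarith), ← add_sub_assoc, ← add_sub_assoc,
    fr, fb] at e1 e2
  have g1 : Delta nr * Delta nb * (1 + k) - Delta nb * q =
      ξ 0 * (Delta nr * Delta nb * (1 + k) - Delta nr * q) := by
    rw [hL.hk] at e1
    field_simp at e1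
    linear_combination e1
  have g2 : Delta nr - q = ξ 0 * (Delta nb - q) := by
    have n1 : nr - 1 ≠ 0 := by linarith
    have n2 : nb - 1 ≠ 0 := by linarith
    have d1 : Delta nr * (nr - 1) = nr := by rw [Delta]; field_simp
    have d2 : Delta nb * (nb - 1) = nb := by rw [Delta]; field_simp
    apply mul_left_cancel₀ (mul_ne_zero n1 n2)
    have x1 : nr * (1 - q / Delta nr) = (nr - 1) * (Delta nr - q) := by
      have := mul_div_cancel₀ q (show Delta nr ≠ 0 by linarith)
      linear_combination -(1 - q / Delta nr) * d1 - (nr - 1) * this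
    have x2 : nb * (1 - q / Delta nb) = (nb - 1) * (Delta nb - q) := by
      have := mul_div_cancel₀ q (show Delta nb ≠ 0 by linarith)
      linear_combination -(1 - q / Delta nb) * d2 - (nb - 1) * this
    linear_combination e2 - (nb - 1) * x1 + (nr - 1) * ξ 0 * x2
  have hcpos := sub_pos.2 hL.K_lt
  -- The second factor vanishes only for φ'(0) = -(K - Δ_b)/(Δ_r - K), the branch of the smaller
  -- root, which |φ'(0)| ≤ 1 excludes.
  have hqK : q = K := by
    have hprod : (q - K) * ((K - Delta nb) + ξ 0 * (Delta nr - K)) = 0 := by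
      linear_combination g1 - K * g2 - (1 - ξ 0) * hL.quad
    have : (K - Delta nb) + ξ 0 * (Delta nr - K) ≠ 0 := by
      have := (abs_le.1 hp').1
      nlinarith [hL.lt_K]
    exact sub_eq_zero.1 ((mul_eq_zero.1 hprod).resolve_right this)
  have hp : ξ 0 = p := by
    have hbpos := sub_pos.2 hL.Db_lt_K
    apply mul_right_cancel₀ hbpos.ne'
    rw [hL.p_eq]
    rw [hqK] at g2
    linear_combination g2
  rw [hL.velocity]
  ext i
  fin_cases i
  · exact hp
  · exact hY1
  · exact hY2
  · rw [← hqK]; exact hq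
  · exact hY4

/-- A solution of the lens problem gives a solution of the functional system. -/
lemma isSystemSolution (hδ : 0 < δ) (hL : LensData nr nb ρ₀ d₀ k K p) (hδπ : δ < Real.pi / 2)
    (hbd : ∀ t ∈ Icc (-δ) δ, |φ t| ≤ |t| ∧ 1 < nr * tau nr ρ₀ t (lensCurve ρ₀ δ ρ φ t) ∧
      1 < nb * tau nb ρ₀ t (lensCurve ρ₀ δ ρ φ t)) :
    IsSystemSolution nr nb ρ₀ d₀ δ (lensCurve ρ₀ δ ρ φ) := by
  have hr := hL.hr
  have hb := hL.hb
  have hρ := hL.hρ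
  have hc := h.isLensCurve hδ
  have heq := fun t (ht : t ∈ Icc (-δ) δ) => h.equations hδ hr hL.hrb hρ hδπ rfl rfl ht
  have hdφ := fun t (ht : t ∈ Icc (-δ) δ) => h.hasDerivWithinAt_phi hδ ht
  have hmap := h.phi_mapsTo
  have hv := h.derivWithin_lensCurve_zero hδ hL hδπ fun t ht => (hbd t ht).1
  have hφZ : ∀ t, lensCurve ρ₀ δ ρ φ t 0 = φ t := fun t => rfl
  have hdom : ∀ t ∈ Icc (-δ) δ, InDomain nr nb ρ₀ d₀ t (lensCurve ρ₀ δ ρ φ t)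
      (lensCurve ρ₀ δ ρ φ (φ t)) (derivWithin (lensCurve ρ₀ δ ρ φ) (Icc (-δ) δ) (φ t)) :=
    fun t ht => ⟨⟨by linarith [ht.1], by linarith [ht.2]⟩, hc.regular ht hr,
      hc.regular (hmap ht) hb, (heq _ (hmap ht)).2.2.2 (hbd _ (hmap ht)).2.2⟩
  have hnormal : ∀ t ∈ Icc (-δ) δ, mu nb ρ₀ (φ t) (lensCurve ρ₀ δ ρ φ (φ t)) *
      Lam nr ρ₀ t (lensCurve ρ₀ δ ρ φ t) - mu nr ρ₀ t (lensCurve ρ₀ δ ρ φ t) *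
      Lam nb ρ₀ (φ t) (lensCurve ρ₀ δ ρ φ (φ t)) = 0 := by
    intro t ht
    have e := (heq t ht).2.1
    have l1 := Lam_sq (hc.regular ht hr) (hc.norm_m ht hr)
    have l2 := Lam_sq (hc.regular (hmap ht) hb) (hc.norm_m (hmap ht) hb)
    have q1 := Lam_pos (hc.regular ht hr)
    have q2 := Lam_pos (hc.regular (hmap ht) hb)
    have p1 := (hbd t ht).2.1
    have p2 := (hbd _ (hmap ht)).2.2
    generalize mu nb ρ₀ (φ t) (lensCurve ρ₀ δ ρ φ (φ t)) = x' at *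
    generalize mu nr ρ₀ t (lensCurve ρ₀ δ ρ φ t) = x at *
    generalize tau nb ρ₀ (φ t) (lensCurve ρ₀ δ ρ φ (φ t)) = τ' at *
    generalize tau nr ρ₀ t (lensCurve ρ₀ δ ρ φ t) = τ at *
    generalize Lam nr ρ₀ t (lensCurve ρ₀ δ ρ φ t) = l at *
    generalize Lam nb ρ₀ (φ t) (lensCurve ρ₀ δ ρ φ (φ t)) = l' at *
    have y1 : 0 < τ - 1 / nr := by
      rw [sub_pos, div_lt_iff₀ (by linarith)]; linarith
    have y2 : 0 < τ' - 1 / nb := by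
      rw [sub_pos, div_lt_iff₀ (by linarith)]; linarith
    have e' : x * (τ' - 1 / nb) = x' * (τ - 1 / nr) := by
      have : nr ≠ 0 := by linarith
      have : nb ≠ 0 := by linarith
      field_simp
      linear_combination e
    -- Parallel normals with positive vertical components give equal unit normals; differentiating
    -- this equality will yield the fourth equation.
    have hl : (τ' - 1 / nb) * l = (τ - 1 / nr) * l' := by
      refine (pow_left_inj₀ (by positivity) (by positivity) two_ne_zero).1 ?_
      linear_combination (τ' - 1 / nb) ^ 2 * l1 - (τ - 1 / nr) ^ 2 * l2 +
        (x * (τ' - 1 / nb) + x' * (τ - 1 / nr)) * e'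
    apply mul_left_cancel₀ y1.ne'
    linear_combination -l * e' + x * hl
  refine ⟨h.contDiffOn_lensCurve hδ, h.lensCurve_zero hδ hr hL.hrb hδπ, hv,
    fun t ht => (hbd t ht).1, hdom, fun t ht => ?_⟩
  obtain ⟨-, hrr, hrb, hF⟩ := hdom t ht
  ext i
  fin_cases i
  · exact (eq_div_iff hF).2 (heq t ht).1.symm
  · exact hc.deriv_Z1 ht
  · exact hc.deriv_Z2 ht
  · have d1 := (hasDerivWithinAt_mu hb (hc.deriv _ (hmap ht)) hrb.1).comp t (hdφ t ht) hmap
    have d2 := (hasDerivWithinAt_Lam hb (hc.deriv _ (hmap ht)) hrb).comp t (hdφ t ht) hmap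
    have d3 := hasDerivWithinAt_mu hr (hc.deriv t ht) hrr.1
    have d4 := hasDerivWithinAt_Lam hr (hc.deriv t ht) hrr
    have e := (uniqueDiffOn_Icc (show -δ < δ by linarith) t ht).eq_deriv _
      ((d1.mul d4).sub (d3.mul d2))
      ((hasDerivWithinAt_const t _ (0 : ℝ)).congr hnormal (hnormal t ht))
    simp only [Function.comp_apply] at e
    show _ = h4 nr nb ρ₀ t _ _ _ _
    have hA := (A_neg hr hrr.1).ne
    have hL' := (Lam_pos hrb).ne'
    have hnr : nr ≠ 0 := by linarith
    rw [h4, ← neg_eq_iff_eq_neg, eq_div_iff (by positivity)]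
    simp only [hφZ]
    have e' : dmu nr ρ₀ t (lensCurve ρ₀ δ ρ φ t) (derivWithin (lensCurve ρ₀ δ ρ φ) (Icc (-δ) δ) t) =
      1 / nr * (Real.cos t - A nr ρ₀ (lensCurve ρ₀ δ ρ φ t) *
        derivWithin (lensCurve ρ₀ δ ρ φ) (Icc (-δ) δ) t 3 - dA nr ρ₀ (lensCurve ρ₀ δ ρ φ t)
          (derivWithin (lensCurve ρ₀ δ ρ φ) (Icc (-δ) δ) t) * lensCurve ρ₀ δ ρ φ t 3) := rfl
    simp only [Fin.reduceFinMk]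
    linear_combination -e - Lam nb ρ₀ (φ t) (lensCurve ρ₀ δ ρ φ (φ t)) * e'
  · exact hc.deriv_Z4 hδπ ht

end IsLensSolution

end AchromaticLens

end

theorem mainTheorem1 (nr nb : ℝ) (hr : 1 < nr) (hrb : nr < nb) :
    ∃ C : ℝ, 0 < C ∧ C < AchromaticLens.threshold nr nb ∧
      ∀ ρ₀ d₀ : ℝ, 0 < ρ₀ → 0 < d₀ → ρ₀ / d₀ < C →
        -- the functional system has a unique local solution
        (∃ δ₀ : ℝ, 0 < δ₀ ∧ δ₀ < Real.pi / 2 ∧ ∀ δ : ℝ, 0 < δ → δ ≤ δ₀ →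
          (∃ Z : ℝ → Fin 5 → ℝ, AchromaticLens.IsSystemSolution nr nb ρ₀ d₀ δ Z) ∧
          (∀ Z W : ℝ → Fin 5 → ℝ, AchromaticLens.IsSystemSolution nr nb ρ₀ d₀ δ Z →
            AchromaticLens.IsSystemSolution nr nb ρ₀ d₀ δ W →
            Set.EqOn Z W (Set.Icc (-δ) δ))) ∧
        -- the lens problem has a unique local solution
        (∃ δ₀ : ℝ, 0 < δ₀ ∧ δ₀ < Real.pi / 2 ∧ ∀ δ : ℝ, 0 < δ → δ ≤ δ₀ →
          (∃ ρ φ : ℝ → ℝ, AchromaticLens.IsLensSolution nr nb ρ₀ d₀ δ ρ φ) ∧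
          (∀ ρ φ ρ' φ' : ℝ → ℝ, AchromaticLens.IsLensSolution nr nb ρ₀ d₀ δ ρ φ →
            AchromaticLens.IsLensSolution nr nb ρ₀ d₀ δ ρ' φ' →
            Set.EqOn ρ ρ' (Set.Icc (-δ) δ) ∧ Set.EqOn φ φ' (Set.Icc (-δ) δ))) := by
  refine ⟨AchromaticLens.ratioBound nr nb, AchromaticLens.ratioBound_pos hr hrb,
    AchromaticLens.ratioBound_lt hr hrb, fun ρ₀ d₀ hρ hd hk => ?_⟩
  obtain ⟨k, K, p, hL⟩ := AchromaticLens.exists_lensData hr hrb hρ hd hk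
  obtain ⟨δ₀, hδ₀, hδ₀π, Z, Y, hZ, huniq⟩ := hL.exists_germSolution
  refine ⟨⟨δ₀, hδ₀, hδ₀π, fun δ hδ hle => ⟨⟨Z, hZ.sol δ hδ hle⟩, fun W W' hW hW' =>
    (huniq δ hδ hle W hW).trans (huniq δ hδ hle W' hW').symm⟩⟩, ?_⟩
  obtain ⟨δ₁, hδ₁, hδ₁₀, hex⟩ := hZ.exists_lensSolution hL hδ₀
  obtain ⟨δ₂, hδ₂, hδ₂π, hcontr⟩ := hL.exists_abs_phi_le
  refine ⟨min δ₁ δ₂, lt_min hδ₁ hδ₂, (min_le_right _ _).trans_lt hδ₂π, fun δ hδ hle =>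
    ⟨hex δ hδ (hle.trans (min_le_left _ _)), fun ρ φ ρ' φ' h h' => ?_⟩⟩
  have hle₂ := hle.trans (min_le_right δ₁ δ₂)
  have hle₀ := (hle.trans (min_le_left δ₁ δ₂)).trans hδ₁₀
  have hδπ := hle₂.trans_lt hδ₂π
  -- Both data curves solve the system, hence agree; their first component is φ and their second is
  -- ρ₀ - ρ cos t, which determines ρ.
  have hEq := (huniq δ hδ hle₀ _ (h.isSystemSolution hδ hL hδπ (hcontr δ hδ hle₂ ρ φ h))).trans
    (huniq δ hδ hle₀ _ (h'.isSystemSolution hδ hL hδπ (hcontr δ hδ hle₂ ρ' φ' h'))).symm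
  refine ⟨fun t ht => ?_, fun t ht => congrFun (hEq ht) 0⟩
  have hcos : 0 < Real.cos t :=
    Real.cos_pos_of_mem_Ioo ⟨by linarith [ht.1], by linarith [ht.2]⟩
  have h1 : ρ₀ - ρ t * Real.cos t = ρ₀ - ρ' t * Real.cos t := congrFun (hEq ht) 1
  exact mul_right_cancel₀ hcos.ne' (by linarith)
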